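/- **Setting.** Let $\mathcal A$ be a Hopf $*$-algebra over $\mathbb C$ (comultiplication $\Delta(a)=a_{(1)}\otimes a_{(2)}$, counit $\varepsilon$, antipode $S$, $\Delta(a^*)=(a_{(1)})^*\otimes (a_{(2)})^*$) which is cosemisimple, i.e. every corepresentation of $\mathcal A$ is a direct sum of simple ones. Let $h$ be the Haar functional of $\mathcal A$, that is, the left- and right-invariant linear functional with $h(1)=1$, and let $\rho$ be the algebra automorphism of $\mathcal A$ with $h(ab)=h(b\rho(a))$ for all $a,b\in\mathcal A$. Let $(\Gamma,\mathrm d)$ be a left-covariant first order differential $*$-calculus over $\mathcal A$, with left coaction $\Delta_L$, whose space $\Gamma_{\mathrm{inv}}=\{\theta:\Delta_L(\theta)=1\otimes\theta\}$ of left-invariant one-forms is finite dimensional. Put $\omega(a)=S(a_{(1)})\,\mathrm da_{(2)}$ and $\mathcal R_\Gamma=\{a\in\mathcal A:\omega(a)=0,\ \varepsilon(a)=0\}$. The calculus is assumed to be $S^2$-invariant: the quantum tangent space $\mathcal X=\{X\in\mathcal A': X(1)=0,\ X|_{\mathcal R_\Gamma}=0\}$ satisfies $\{X\circ S^2: X\in\mathcal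 X\}=\mathcal X$. Then there is a unique linear map $S^2:\Gamma\to\Gamma$ with $S^2(a\theta b)=S^2(a)S^2(\theta)S^2(b)$ and $S^2(\mathrm da)=\mathrm d\,S^2(a)$. On $\Gamma\otimes_{\mathcal A}\Gamma$ put $S^2(\theta\otimes\theta')=S^2(\theta)\otimes S^2(\theta')$ and $(\theta\otimes\theta')^*=\theta'^*\otimes\theta^*$. Let $\sigma$ be a braiding of $\Gamma$: an automorphism of the left-covariant $\mathcal A$-bimodule $\Gamma\otimes_{\mathcal A}\Gamma$ such that 1. $\sigma_{12}\sigma_{23}\sigma_{12}=\sigma_{23}\sigma_{12}\sigma_{23}$ on $\Gamma\otimes_{\mathcal A}\Gamma\otimes_{\mathcal A}\Gamma$; 2. $\sigma$ fixes $\omega(a_{(1)})\otimes\omega(a_{(2)})$ for every $a\in\mathcal R_\Gamma$; 3. $S^2\sigma=\sigma S^2$; 4. either $(\sigma t)^*=\sigma(t^*)$ for all $t\in \Gamma\otimes_{\mathcal A}\Gamma$, or $(\sigma t)^*=\sigma^{-1}(t^*)$ for all $t\in \Gamma\otimes_{\mathcal A}\Gamma$. Let $g:\Gamma\otimes_{\mathcal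 A}\Gamma\to\mathcal A$ be a left-covariant $\sigma$-metric: a homomorphism of left-covariant $\mathcal A$-bimodules that is non-degenerate (in each argument) and satisfies $g\sigma=g$, $g_{12}\sigma_{23}\sigma_{12}=g_{23}$ and $g_{12}\sigma_{23}^{-1}\sigma_{12}^{-1}=g_{23}$ on $\Gamma\otimes_{\mathcal A}\Gamma\otimes_{\mathcal A}\Gamma$, $g(\theta\otimes\theta')^*=g(\theta'^*\otimes\theta^*)$ for $\theta,\theta'\in\Gamma$, and $g(S^2(\theta')\otimes\theta)=g(\theta\otimes\theta')$ for $\theta,\theta'\in\Gamma_{\mathrm{inv}}$. Let $\mathrm{Cl}=\mathrm{Cl}(\Gamma,\sigma,g)$ be the quantum Clifford algebra, the quotient of the tensor algebra $\bigoplus_{k\ge0}\Gamma^{\otimes_{\mathcal A}k}$ by the two-sided ideal generated by all $t-g(t)$ with $t\in\ker(\mathrm{id}-\sigma)\subseteq\Gamma\otimes_{\mathcal A}\Gamma$. It carries the left coaction $\Delta_L$ of $\mathcal A$ (an algebra map) induced by those on $\mathcal A$ and $\Gamma$. Its main involution $\beta$ is the antilinear antimultiplicative involution $\beta:\mathrm{Cl}\to\mathrm{Cl}$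 with $\beta(a)=\rho(a)^*$ for $a\in\mathcal A$ and $\beta(\theta)=-S^2(\theta^*)$ for $\theta\in\Gamma_{\mathrm{inv}}$. A left ideal $J$ of $\mathrm{Cl}$ is left-covariant if $\Delta_L(J)\subseteq\mathcal A\otimes J$. **Proposition.** Suppose that $\mathrm{Cl}(\Gamma,\sigma,g)$ is a simple left-covariant algebra, i.e. it is nonzero and its only left-covariant two-sided ideals are $0$ and $\mathrm{Cl}$. Let $\mathcal S$ be a minimal nonzero left-covariant left ideal of $\mathrm{Cl}$ which is also an $\mathcal A$-bimodule, i.e. $\mathcal S\mathcal A\subseteq\mathcal S$. Then $h$, $\rho$ and $\beta$ as above exist, and there is a metric on $\mathcal S$, that is, a form $\langle\cdot,\cdot\rangle:\mathcal S\times\mathcal S\to\mathbb C$, linear in the first and antilinear in the second argument, such that * $\langle\cdot,\cdot\rangle=h\circ\langle\cdot,\cdot\rangle_0$ for some form $\langle\cdot,\cdot\rangle_0:\mathcal S\times\mathcal S\to\mathcal A$, linear in the first and antilinear in the second argument, with $\langle a\psi,b\psi'\rangle_0=a\langle\psi,\psi'\rangle_0b^*$ for $a,b\in\mathcal A$, which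 is left-covariant: $\Delta(\langle\psi,\psi'\rangle_0)=\psi_{(-1)}(\psi'_{(-1)})^*\otimes\langle\psi_{(0)},\psi'_{(0)}\rangle_0$, where $\Delta_L(\psi)=\psi_{(-1)}\otimes\psi_{(0)}$; * $\langle\cdot,\cdot\rangle$ is hermitian, $\langle\psi',\psi\rangle=\overline{\langle\psi,\psi'\rangle}$, and non-degenerate; and such that $$\langle u\psi,\psi'\rangle=\langle\psi,\beta(u)\psi'\rangle\qquad\text{for all }u\in\mathrm{Cl}(\Gamma,\sigma,g),\ \psi,\psi'\in\mathcal S.$$ -/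

import Mathlib

open scoped TensorProduct
open Coalgebra HopfAlgebra MulOpposite
universe u v
noncomputable section
set_option linter.unusedSectionVars false
namespace QuantumClifford

variable {A : Type u} [Ring A] [HopfAlgebra ℂ A]

/-! ### Hopf `*`-algebras, cosemisimplicity, the Haar functional -/

/-- `δ` is a (right) corepresentation of `A` on `V`. -/
structure IsCoaction {V : Type*} [AddCommGroup V] [Module ℂ V] (δ : V →ₗ[ℂ] V ⊗[ℂ] A) : Prop where
  coassoc : ∀ v, TensorProduct.assoc ℂ V A A (δ.rTensor A (δ v)) =
    (comul (R := ℂ)).lTensor V (δ v)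
  counit : ∀ v, TensorProduct.rid ℂ V ((Coalgebra.counit (R := ℂ)).lTensor V (δ v)) = v

/-- `W` is a subcorepresentation: `δ(W) ⊆ W ⊗ A`. -/
def IsSubcomodule {V : Type*} [AddCommGroup V] [Module ℂ V] (δ : V →ₗ[ℂ] V ⊗[ℂ] A)
    (W : Submodule ℂ V) : Prop :=
  ∀ w ∈ W, δ w ∈ LinearMap.range (W.subtype.rTensor A)

/-- `W` is a simple subcorepresentation. -/
def IsSimpleSubcomodule {V : Type*} [AddCommGroup V] [Module ℂ V] (δ : V →ₗ[ℂ] V ⊗[ℂ] A)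
    (W : Submodule ℂ V) : Prop :=
  IsSubcomodule δ W ∧ W ≠ ⊥ ∧ ∀ W' ≤ W, IsSubcomodule δ W' → W' = ⊥ ∨ W' = W

/-- Every corepresentation is a direct sum of simple corepresentations. -/
def IsCosemisimple (A : Type u) [Ring A] [HopfAlgebra ℂ A] : Prop :=
  ∀ (V : Type u) [AddCommGroup V] [Module ℂ V] (δ : V →ₗ[ℂ] V ⊗[ℂ] A), IsCoaction δ →
    ∃ s : Set (Submodule ℂ V), (∀ W ∈ s, IsSimpleSubcomodule δ W) ∧ sSupIndep s ∧ sSup s = ⊤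

/-- `Δ(a*) = (* ⊗ *) Δ(a)`: the Hopf algebra `A` with its involution `star` is a Hopf `*`-algebra. -/
def IsHopfStar (A : Type u) [Ring A] [HopfAlgebra ℂ A] [StarRing A] [StarModule ℂ A] : Prop :=
  ∀ a : A, comul (R := ℂ) (star a) = star (comul (R := ℂ) a)

/-- `h` is the Haar functional: left- and right-invariant with `h(1) = 1`. -/
structure IsHaar (h : A →ₗ[ℂ] ℂ) : Prop where
  map_one : h 1 = 1
  left_inv : ∀ a, TensorProduct.rid ℂ A (h.lTensor A (comul (R := ℂ) a)) = h a • 1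
  right_inv : ∀ a, TensorProduct.lid ℂ A (h.rTensor A (comul (R := ℂ) a)) = h a • 1

/-! ### The square of the antipode -/

/-- Auxiliary map `x ⊗ (b ⊗ (c ⊗ d)) ↦ S(b) c ⊗ S(x) d`. -/
def mixMap (A : Type u) [Ring A] [HopfAlgebra ℂ A] :
    A ⊗[ℂ] (A ⊗[ℂ] (A ⊗[ℂ] A)) →ₗ[ℂ] A ⊗[ℂ] A :=
  LinearMap.mul' ℂ (A ⊗[ℂ] A) ∘ₗ
    (TensorProduct.map (TensorProduct.map (antipode ℂ) (antipode ℂ) ∘ₗ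
      (TensorProduct.comm ℂ A A).toLinearMap) LinearMap.id) ∘ₗ
    (TensorProduct.assoc ℂ A A (A ⊗[ℂ] A)).symm.toLinearMap

theorem mixMap_assoc (x y d : A) :
    mixMap A (x ⊗ₜ (TensorProduct.assoc ℂ A A A (comul (R := ℂ) y ⊗ₜ d))) =
      counit (R := ℂ) y • ((1 : A) ⊗ₜ[ℂ] (antipode ℂ x * d)) := by
  have h : ∀ w : A ⊗[ℂ] A, mixMap A (x ⊗ₜ (TensorProduct.assoc ℂ A A A (w ⊗ₜ d))) =
      (LinearMap.mul' ℂ A ((antipode ℂ).rTensor A w)) ⊗ₜ[ℂ] (antipode ℂ x * d) := by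
    intro w
    induction w with
    | zero => simp
    | tmul b c => simp [mixMap]
    | add u v hu hv => simp only [TensorProduct.add_tmul, map_add, TensorProduct.tmul_add, hu, hv]
  rw [h, mul_antipode_rTensor_comul_apply, Algebra.algebraMap_eq_smul_one,
    TensorProduct.smul_tmul']

theorem comul_antipode (a : A) :
    comul (R := ℂ) (antipode ℂ a) =
      TensorProduct.map (antipode ℂ) (antipode ℂ) (TensorProduct.comm ℂ A A (comul (R := ℂ) a)) := by
  have h1 := LinearMap.comul_right_inv (R := ℂ) (C := A)
  have h2 : WithConv.toConv (TensorProduct.map (antipode ℂ) (antipode ℂ) ∘ₗ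
      (TensorProduct.comm ℂ A A).toLinearMap ∘ₗ comul (R := ℂ) (A := A)) *
      WithConv.toConv (comul (R := ℂ) (A := A)) = 1 := by
    ext a
    have e2 : ∀ w : A ⊗[ℂ] A, LinearMap.mul' ℂ (A ⊗[ℂ] A) (TensorProduct.map
        (TensorProduct.map (antipode ℂ) (antipode ℂ) ∘ₗ
        (TensorProduct.comm ℂ A A).toLinearMap ∘ₗ comul (R := ℂ) (A := A)) (comul (R := ℂ)) w) =
        mixMap A ((LinearMap.lTensor A (comul (R := ℂ) (A := A))).lTensor A
          ((TensorProduct.assoc ℂ A A A) ((comul (R := ℂ)).rTensor A w))) := by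
      intro w
      induction w with
      | zero => simp
      | add u v hu hv => simp only [map_add, hu, hv]
      | tmul p q =>
        simp only [TensorProduct.map_tmul, LinearMap.rTensor_tmul, LinearMap.comp_apply]
        induction comul (R := ℂ) p with
        | zero => simp
        | add u v hu hv => simp only [map_add, TensorProduct.add_tmul, hu, hv]
        | tmul x b => simp [mixMap]
    have e3 : ∀ w : A ⊗[ℂ] A, mixMap A ((LinearMap.lTensor A (comul (R := ℂ) (A := A))).lTensor A
          ((comul (R := ℂ)).lTensor A w)) =
        (1 : A) ⊗ₜ[ℂ] LinearMap.mul' ℂ A ((antipode ℂ).rTensor A w) := by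
      intro w
      induction w with
      | zero => simp
      | add u v hu hv => simp only [map_add, hu, hv, TensorProduct.tmul_add]
      | tmul x b =>
        simp only [LinearMap.lTensor_tmul]
        rw [← Coalgebra.coassoc_apply]
        have e4 : ∀ v : A ⊗[ℂ] A, mixMap A (x ⊗ₜ (TensorProduct.assoc ℂ A A A
            ((comul (R := ℂ)).rTensor A v))) =
            (1 : A) ⊗ₜ[ℂ] (antipode ℂ x * TensorProduct.lid ℂ A ((counit (R := ℂ)).rTensor A v)) := by
          intro v
          induction v with
          | zero => simp
          | add u v hu hv => simp only [map_add, hu, hv, TensorProduct.tmul_add, mul_add]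
          | tmul y d => 
            rw [LinearMap.rTensor_tmul, mixMap_assoc]
            simp
        rw [e4]
        simp
    rw [LinearMap.convMul_apply, WithConv.ofConv_toConv, WithConv.ofConv_toConv, e2, Coalgebra.coassoc_apply,
      e3, mul_antipode_rTensor_comul_apply, LinearMap.convOne_apply,
      Algebra.algebraMap_eq_smul_one, Algebra.algebraMap_eq_smul_one,
      TensorProduct.tmul_smul]
    rfl
  have := left_inv_eq_right_inv h2 h1
  have := congrArg (fun f => f.ofConv a) this
  exact this.symm

/-- The square of the antipode. -/
def antipodeSq (A : Type u) [Ring A] [HopfAlgebra ℂ A] : A →ₐ[ℂ] A :=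
  AlgHom.ofLinearMap (antipode ℂ ∘ₗ antipode ℂ) (by simp)
    (fun a b => by simp [antipode_mul_antidistrib])

theorem comul_antipodeSq (a : A) :
    comul (R := ℂ) (antipodeSq A a) =
      TensorProduct.map (antipodeSq A).toLinearMap (antipodeSq A).toLinearMap (comul (R := ℂ) a) := by
  change comul (R := ℂ) (antipode ℂ (antipode ℂ a)) = _
  rw [comul_antipode, comul_antipode]
  induction comul (R := ℂ) a with
  | zero => simp
  | add u v hu hv => simp only [map_add, hu, hv]
  | tmul x y => rfl

theorem exists_factor {U V W : Type*} [AddCommGroup U] [Module ℂ U] [AddCommGroup V] [Module ℂ V]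
    [AddCommGroup W] [Module ℂ W] (f : U →ₗ[ℂ] V) (g : U →ₗ[ℂ] W)
    (h : LinearMap.ker f ≤ LinearMap.ker g) : ∃ k : V →ₗ[ℂ] W, k ∘ₗ f = g := by
  obtain ⟨k, hk⟩ := LinearMap.exists_extend
    ((LinearMap.ker f).liftQ g h ∘ₗ f.quotKerEquivRange.symm.toLinearMap)
  refine ⟨k, LinearMap.ext fun u => ?_⟩
  have := LinearMap.congr_fun hk ⟨f u, u, rfl⟩
  have e : f.quotKerEquivRange.symm ⟨f u, u, rfl⟩ = (LinearMap.ker f).mkQ u :=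
    f.quotKerEquivRange_symm_apply_image u (LinearMap.mem_range_self f u)
  simp only [LinearMap.comp_apply, Submodule.subtype_apply, LinearEquiv.coe_coe, e] at this
  simpa using this

theorem dual_sep {U V : Type*} [AddCommGroup U] [Module ℂ U] [AddCommGroup V] [Module ℂ V]
    (w : U ⊗[ℂ] V) (h : ∀ f : Module.Dual ℂ V, f.lTensor U w = 0) : w = 0 := by
  classical
  let b := Module.Free.chooseBasis ℂ V
  apply (TensorProduct.equivFinsuppOfBasisRight (M := U) b).injective
  rw [map_zero]
  ext i
  have h1 : ∀ w : U ⊗[ℂ] V, TensorProduct.equivFinsuppOfBasisRight b w i =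
      TensorProduct.rid ℂ U ((b.coord i).lTensor U w) := by
    intro w
    induction w with
    | zero => simp
    | add u v hu hv => simp only [map_add, Finsupp.add_apply, hu, hv]
    | tmul x y => simp
  rw [h1, h, map_zero]
  rfl

/-! ### Left-covariant differential calculi -/

variable {Γ : Type v} [AddCommGroup Γ] [Module ℂ Γ] [Module A Γ] [Module Aᵐᵒᵖ Γ]
  [SMulCommClass A Aᵐᵒᵖ Γ] [IsScalarTower ℂ A Γ] [IsScalarTower ℂ Aᵐᵒᵖ Γ]

/-- The left action of `A ⊗ A` on `A ⊗ Γ`: `(a ⊗ b) · (c ⊗ ρ) = ac ⊗ bρ`. -/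
def actL (A : Type u) [Ring A] [HopfAlgebra ℂ A] (Γ : Type v) [AddCommGroup Γ] [Module ℂ Γ]
    [Module A Γ] [IsScalarTower ℂ A Γ] :
    A ⊗[ℂ] A →ₗ[ℂ] A ⊗[ℂ] Γ →ₗ[ℂ] A ⊗[ℂ] Γ :=
  TensorProduct.map₂ (LinearMap.mul ℂ A) (Algebra.lsmul ℂ ℂ Γ).toLinearMap

/-- The right action of `A ⊗ A` on `A ⊗ Γ`: `(c ⊗ ρ) · (a ⊗ b) = ca ⊗ ρb`. -/
def actR (A : Type u) [Ring A] [HopfAlgebra ℂ A] (Γ : Type v) [AddCommGroup Γ] [Module ℂ Γ]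
    [Module Aᵐᵒᵖ Γ] [IsScalarTower ℂ Aᵐᵒᵖ Γ] :
    A ⊗[ℂ] A →ₗ[ℂ] A ⊗[ℂ] Γ →ₗ[ℂ] A ⊗[ℂ] Γ :=
  TensorProduct.map₂ (LinearMap.mul ℂ A).flip
    ((Algebra.lsmul ℂ ℂ Γ : Aᵐᵒᵖ →ₐ[ℂ] Module.End ℂ Γ).toLinearMap ∘ₗ
      (opLinearEquiv ℂ : A ≃ₗ[ℂ] Aᵐᵒᵖ).toLinearMap)

variable [StarRing A] [StarModule ℂ A] [StarAddMonoid Γ] [StarModule ℂ Γ]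

variable (A Γ) in
/-- A (finite-dimensional) left-covariant first order differential `*`-calculus over the Hopf
`*`-algebra `A` with bimodule of one-forms `Γ`. The left and right actions of `A` on `Γ` are `a • ρ` and
`op a • ρ`, the involution of `Γ` is `star`. The left coaction `ρ ↦ ρ₋₁ ⊗ ρ₀` is `coact`. -/
structure StarCalculus where
  /-- the differential -/
  d : A →ₗ[ℂ] Γ
  /-- `d(ab) = a db + (da) b` -/
  leibniz : ∀ a b, d (a * b) = a • d b + op b • d a
  /-- every one-form is a sum of forms `a db` -/
  span_eq_top : Submodule.span ℂ {x : Γ | ∃ a b : A, x = a • d b} = ⊤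
  /-- the left coaction -/
  coact : Γ →ₗ[ℂ] A ⊗[ℂ] Γ
  coact_coassoc : ∀ ρ, TensorProduct.assoc ℂ A A Γ ((comul (R := ℂ)).rTensor Γ (coact ρ)) =
    coact.lTensor A (coact ρ)
  coact_counit : ∀ ρ, TensorProduct.lid ℂ Γ ((counit (R := ℂ)).rTensor Γ (coact ρ)) = ρ
  /-- `Δ_L(aρ) = Δ(a) Δ_L(ρ)` -/
  coact_smul : ∀ (a : A) (ρ : Γ), coact (a • ρ) = actL A Γ (comul (R := ℂ) a) (coact ρ)
  /-- `Δ_L(ρa) = Δ_L(ρ) Δ(a)` -/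
  coact_op_smul : ∀ (a : A) (ρ : Γ), coact (op a • ρ) = actR A Γ (comul (R := ℂ) a) (coact ρ)
  /-- `Δ_L(da) = (id ⊗ d) Δ(a)` -/
  coact_d : ∀ a, coact (d a) = d.lTensor A (comul (R := ℂ) a)
  /-- `(aρ)* = ρ* a*` -/
  involution_smul : ∀ (a : A) (ρ : Γ), star (a • ρ) = op (star a) • star ρ
  /-- `(da)* = d(a*)` -/
  involution_d : ∀ a, star (d a) = d (star a)
  /-- the space of left-invariant one-forms is finite dimensional -/
  finite_inv : Module.Finite ℂ (LinearMap.eqLocus coact (TensorProduct.mk ℂ A Γ 1))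

namespace StarCalculus
variable (C : StarCalculus A Γ)

/-- The left-invariant one-forms `{ρ | Δ_L(ρ) = 1 ⊗ ρ}`. -/
def inv : Submodule ℂ Γ := LinearMap.eqLocus C.coact (TensorProduct.mk ℂ A Γ 1)

/-- `a ⊗ b ↦ S(a) d b` -/
def mcAux : A ⊗[ℂ] A →ₗ[ℂ] Γ :=
  TensorProduct.lift ((Algebra.lsmul ℂ ℂ Γ).toLinearMap.compl₁₂ (antipode ℂ) C.d)

/-- The map `ω(a) = S(a₁) da₂`. -/
def mc : A →ₗ[ℂ] Γ := C.mcAux ∘ₗ comul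

/-- The quantum tangent space: all functionals `X` on `A` with `X(1) = 0` that vanish on
`R_Γ = {a | ω(a) = 0, ε(a) = 0}`. -/
def tangent : Submodule ℂ (Module.Dual ℂ A) where
  carrier := {X | X 1 = 0 ∧ ∀ a, C.mc a = 0 → counit (R := ℂ) a = 0 → X a = 0}
  zero_mem' := by simp
  add_mem' := by
    rintro X Y ⟨h1, h2⟩ ⟨h3, h4⟩
    exact ⟨by simp [h1, h3], fun a ha hb => by simp [h2 a ha hb, h4 a ha hb]⟩
  smul_mem' := by
    rintro c X ⟨h1, h2⟩
    exact ⟨by simp [h1], fun a ha hb => by simp [h2 a ha hb]⟩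

/-- The calculus is `S²`-invariant: `S²(𝒳) = 𝒳` for the quantum tangent space `𝒳`, where
`S²(X) = X ∘ S²`. -/
def IsS2Invariant : Prop := C.tangent.map (antipodeSq A).toLinearMap.dualMap = C.tangent

/-- `f` is the map induced by `S²` on one-forms: `S²(aρb) = S²(a) S²(ρ) S²(b)` and
`S²(da) = d(S²(a))`. Since `Γ` is spanned by the forms `a db`, such a map is unique. -/
def IsS2Map (f : Γ →ₗ[ℂ] Γ) : Prop :=
  (∀ (a : A) (ρ : Γ), f (a • ρ) = antipodeSq A a • f ρ) ∧
  (∀ (a : A) (ρ : Γ), f (op a • ρ) = op (antipodeSq A a) • f ρ) ∧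
  ∀ a, f (C.d a) = C.d (antipodeSq A a)

theorem d_one : C.d 1 = 0 := by
  have := C.leibniz 1 1
  simpa using this

theorem mc_one : C.mc 1 = 0 := by
  simp [mc, mcAux, Algebra.TensorProduct.one_def, C.d_one]

/-- `a ⊗ b ↦ a d b` -/
def adb : A ⊗[ℂ] A →ₗ[ℂ] Γ :=
  TensorProduct.lift ((Algebra.lsmul ℂ ℂ Γ).toLinearMap.compl₁₂ LinearMap.id C.d)

/-- `a ⊗ b ↦ a b₁ ⊗ b₂` -/
def shear (A : Type u) [Ring A] [HopfAlgebra ℂ A] : A ⊗[ℂ] A →ₗ[ℂ] A ⊗[ℂ] A :=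
  TensorProduct.lift ((LinearMap.mul ℂ (A ⊗[ℂ] A)).compl₁₂
    ((TensorProduct.mk ℂ A A).flip 1) comul)

/-- `a ⊗ ρ ↦ S(a) ρ` -/
def projAux (A : Type u) [Ring A] [HopfAlgebra ℂ A] (Γ : Type v) [AddCommGroup Γ] [Module ℂ Γ]
    [Module A Γ] [IsScalarTower ℂ A Γ] : A ⊗[ℂ] Γ →ₗ[ℂ] Γ :=
  TensorProduct.lift ((Algebra.lsmul ℂ ℂ Γ).toLinearMap.compl₁₂ (antipode ℂ) LinearMap.id)

theorem projAux_actL (a : A) (w : A ⊗[ℂ] Γ) :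
    projAux A Γ (actL A Γ (comul (R := ℂ) a) w) = counit (R := ℂ) a • projAux A Γ w := by
  induction w with
  | zero => simp
  | add u v hu hv => simp only [map_add, hu, hv, smul_add]
  | tmul c ρ =>
    have h : ∀ z : A ⊗[ℂ] A, projAux A Γ (actL A Γ z (c ⊗ₜ ρ)) =
        (antipode ℂ c * LinearMap.mul' ℂ A ((antipode ℂ).rTensor A z)) • ρ := by
      intro z
      induction z with
      | zero => simp
      | add u v hu hv => simp only [map_add, LinearMap.add_apply, hu, hv, mul_add, add_smul]
      | tmul x y => simp [projAux, actL, antipode_mul_antidistrib, mul_smul]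
    rw [h, mul_antipode_rTensor_comul_apply, Algebra.algebraMap_eq_smul_one]
    simp [projAux]

theorem shear_eq (z : A ⊗[ℂ] A) :
    (projAux A Γ ∘ₗ C.coact).lTensor A (C.coact (C.adb z)) = C.mc.lTensor A (shear A z) := by
  induction z with
  | zero => simp
  | add u v hu hv => simp only [map_add, hu, hv]
  | tmul a b => 
    have e0 : C.coact (C.adb (a ⊗ₜ b)) =
        actL A Γ (comul (R := ℂ) a) (C.d.lTensor A (comul (R := ℂ) b)) := by
      simp [adb, C.coact_smul, C.coact_d]
    rw [e0]
    have e1 : ∀ w v : A ⊗[ℂ] A, (projAux A Γ ∘ₗ C.coact).lTensor A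
        (actL A Γ w (C.d.lTensor A v)) =
        C.mc.lTensor A (((TensorProduct.rid ℂ A ((counit (R := ℂ)).lTensor A w)) ⊗ₜ (1 : A)) * v) := by
      intro w v
      induction w with
      | zero => simp
      | add u v hu hv => simp only [map_add, LinearMap.add_apply, hu, hv, TensorProduct.add_tmul, add_mul]
      | tmul x y =>
        induction v with
        | zero => simp
        | add u v hu hv => simp only [map_add, hu, hv, mul_add]
        | tmul p q =>
          have : projAux A Γ (C.coact (C.d q)) = C.mc q := by
            rw [C.coact_d]
            simp only [mc, LinearMap.comp_apply]
            induction comul (R := ℂ) q with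
            | zero => simp
            | add u v hu hv => simp only [map_add, hu, hv]
            | tmul r s => simp [projAux, mcAux]
          have e2 : projAux A Γ (C.coact (y • C.d q)) = counit (R := ℂ) y • C.mc q := by
            rw [C.coact_smul, projAux_actL, this]
          have e3 : actL A Γ (x ⊗ₜ y) (p ⊗ₜ C.d q) = (x * p) ⊗ₜ (y • C.d q) := rfl
          rw [LinearMap.lTensor_tmul, e3, LinearMap.lTensor_tmul, LinearMap.comp_apply, e2]
          simp [TensorProduct.smul_tmul']
    rw [e1]
    simp [shear]

theorem adb_eq (z : A ⊗[ℂ] A) :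
    C.adb z = TensorProduct.lift (Algebra.lsmul ℂ ℂ Γ).toLinearMap (C.mc.lTensor A (shear A z)) := by
  induction z with
  | zero => simp
  | add u v hu hv => simp only [map_add, hu, hv]
  | tmul a b =>
    have h : ∀ w : A ⊗[ℂ] A, TensorProduct.lift (Algebra.lsmul ℂ ℂ Γ).toLinearMap
        (C.mc.lTensor A ((a ⊗ₜ[ℂ] (1 : A)) * w)) =
        a • TensorProduct.lift (Algebra.lsmul ℂ ℂ Γ).toLinearMap (C.mcAux.lTensor A
          ((comul (R := ℂ)).lTensor A w)) := by
      intro w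
      induction w with
      | zero => simp
      | add u v hu hv => simp only [map_add, hu, hv, mul_add, smul_add]
      | tmul x y => simp [mc]
    have h2 : ∀ w : A ⊗[ℂ] A, TensorProduct.lift (Algebra.lsmul ℂ ℂ Γ).toLinearMap
        (C.mcAux.lTensor A (TensorProduct.assoc ℂ A A A ((comul (R := ℂ)).rTensor A w))) =
        C.d (TensorProduct.lid ℂ A ((counit (R := ℂ)).rTensor A w)) := by
      intro w
      induction w with
      | zero => simp
      | add u v hu hv => simp only [map_add, hu, hv]
      | tmul x y =>
        have h3 : ∀ v : A ⊗[ℂ] A, TensorProduct.lift (Algebra.lsmul ℂ ℂ Γ).toLinearMap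
            (C.mcAux.lTensor A (TensorProduct.assoc ℂ A A A (v ⊗ₜ y))) =
            LinearMap.mul' ℂ A ((antipode ℂ).lTensor A v) • C.d y := by
          intro v
          induction v with
          | zero => simp
          | add u v hu hv => simp only [map_add, hu, hv, TensorProduct.add_tmul, add_smul]
          | tmul p q => simp [mcAux, mul_smul]
        rw [LinearMap.rTensor_tmul, h3, mul_antipode_lTensor_comul_apply,
          Algebra.algebraMap_eq_smul_one]
        simp
    have e : shear A (a ⊗ₜ b) = (a ⊗ₜ[ℂ] (1 : A)) * comul (R := ℂ) b := by simp [shear]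
    rw [e, h, ← Coalgebra.coassoc_apply, h2]
    simp [adb]

theorem shear_antipodeSq (z : A ⊗[ℂ] A) :
    shear A (TensorProduct.map (antipodeSq A).toLinearMap (antipodeSq A).toLinearMap z) =
      TensorProduct.map (antipodeSq A).toLinearMap (antipodeSq A).toLinearMap (shear A z) := by
  induction z with
  | zero => simp
  | add u v hu hv => simp only [map_add, hu, hv]
  | tmul a b =>
    have e : ∀ a b : A, shear A (a ⊗ₜ b) = (a ⊗ₜ[ℂ] (1 : A)) * comul (R := ℂ) b := by
      intro a b; simp [shear]
    rw [TensorProduct.map_tmul, e, e]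
    simp only [AlgHom.toLinearMap_apply]
    rw [comul_antipodeSq]
    induction comul (R := ℂ) b with
    | zero => simp
    | add u v hu hv => simp only [map_add, hu, hv, mul_add]
    | tmul p q => simp

theorem adb_surjective : Function.Surjective C.adb := by
  rw [← LinearMap.range_eq_top, eq_top_iff, ← C.span_eq_top, Submodule.span_le]
  rintro x ⟨a, b, rfl⟩
  exact ⟨a ⊗ₜ b, by simp [adb]⟩

theorem adb_antipodeSq (hC : C.IsS2Invariant) (z : A ⊗[ℂ] A) (hz : C.adb z = 0) :
    C.adb (TensorProduct.map (antipodeSq A).toLinearMap (antipodeSq A).toLinearMap z) = 0 := by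
  have h1 : C.mc.lTensor A (shear A z) = 0 := by rw [← shear_eq, hz]; simp
  have h2 : ∀ X ∈ C.tangent, X.lTensor A (shear A z) = 0 := by
    rintro X ⟨hX1, hX2⟩
    have hk : LinearMap.ker C.mc ≤ LinearMap.ker X := by
      intro a ha
      rw [LinearMap.mem_ker] at ha ⊢
      have := hX2 (a - algebraMap ℂ A (counit (R := ℂ) a)) (by
        rw [map_sub, ha, Algebra.algebraMap_eq_smul_one, map_smul, mc_one]; simp) (by simp)
      rw [map_sub, Algebra.algebraMap_eq_smul_one, map_smul, hX1] at this
      simpa using this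
    obtain ⟨Y, rfl⟩ := exists_factor C.mc X hk
    rw [LinearMap.lTensor_comp, LinearMap.comp_apply, h1, map_zero]
  rw [adb_eq, shear_antipodeSq]
  suffices hs : C.mc.lTensor A (TensorProduct.map (antipodeSq A).toLinearMap
      (antipodeSq A).toLinearMap (shear A z)) = 0 by rw [hs, map_zero]
  apply dual_sep
  intro f
  have hf : f ∘ₗ C.mc ∈ C.tangent :=
    ⟨by simp [mc_one], fun a ha _ => by simp [ha]⟩
  have hf' : (f ∘ₗ C.mc) ∘ₗ (antipodeSq A).toLinearMap ∈ C.tangent := by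
    have : (antipodeSq A).toLinearMap.dualMap (f ∘ₗ C.mc) ∈ C.tangent := by
      have h := Submodule.mem_map_of_mem (f := (antipodeSq A).toLinearMap.dualMap) hf
      rwa [hC] at h
    exact this
  have h3 := h2 _ hf'
  have h4 : ∀ w : A ⊗[ℂ] A, f.lTensor A (C.mc.lTensor A (TensorProduct.map (antipodeSq A).toLinearMap
      (antipodeSq A).toLinearMap w)) = (antipodeSq A).toLinearMap.rTensor ℂ
      (((f ∘ₗ C.mc) ∘ₗ (antipodeSq A).toLinearMap).lTensor A w) := by
    intro w
    induction w with
    | zero => simp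
    | add u v hu hv => simp only [map_add, hu, hv]
    | tmul p q => simp
  rw [h4, h3, map_zero]

theorem exists_s2 (hC : C.IsS2Invariant) : ∃ f : Γ →ₗ[ℂ] Γ, C.IsS2Map f := by
  obtain ⟨f, hf⟩ : ∃ f : Γ →ₗ[ℂ] Γ, f ∘ₗ C.adb =
      C.adb ∘ₗ TensorProduct.map (antipodeSq A).toLinearMap (antipodeSq A).toLinearMap := by
    apply exists_factor
    intro z hz
    exact C.adb_antipodeSq hC z hz
  have hf' : ∀ a b, f (a • C.d b) = antipodeSq A a • C.d (antipodeSq A b) := by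
    intro a b
    have := LinearMap.congr_fun hf (a ⊗ₜ b)
    simpa [adb] using this
  have hd : ∀ a, f (C.d a) = C.d (antipodeSq A a) := by
    intro a; simpa using hf' 1 a
  refine ⟨f, ?_, ?_, hd⟩
  · intro a ρ
    obtain ⟨z, rfl⟩ := C.adb_surjective ρ
    induction z with
    | zero => simp
    | add u v hu hv => simp only [map_add, smul_add, hu, hv]
    | tmul p q =>
      have e : C.adb (p ⊗ₜ q) = p • C.d q := by simp [adb]
      rw [e, ← mul_smul, hf', hf', map_mul, mul_smul]
  · intro a ρ
    obtain ⟨z, rfl⟩ := C.adb_surjective ρ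
    induction z with
    | zero => simp
    | add u v hu hv => simp only [map_add, smul_add, hu, hv]
    | tmul p q =>
      have e : C.adb (p ⊗ₜ q) = p • C.d q := by simp [adb]
      have e2 : ∀ p q a : A, op a • p • C.d q = p • C.d (q * a) - (p * q) • C.d a := by
        intro p q a
        rw [C.leibniz, smul_add, mul_smul, smul_comm p (op a)]
        abel
      rw [e, e2, map_sub, hf', hf', hf', e2, map_mul (antipodeSq A) q, map_mul (antipodeSq A) p]

end StarCalculus

/-! ### The tensor algebra of a bimodule -/

section TensorAlgebra

variable (A Γ)

/-- The defining relations of the tensor algebra of the `A`-bimodule `Γ`. -/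
inductive TensorRel : TensorAlgebra ℂ (A × Γ) → TensorAlgebra ℂ (A × Γ) → Prop
  | one : TensorRel (TensorAlgebra.ι ℂ (1, 0)) 1
  | mul (a b : A) : TensorRel (TensorAlgebra.ι ℂ (a, 0) * TensorAlgebra.ι ℂ (b, 0))
      (TensorAlgebra.ι ℂ (a * b, 0))
  | left (a : A) (ρ : Γ) : TensorRel (TensorAlgebra.ι ℂ (a, 0) * TensorAlgebra.ι ℂ (0, ρ))
      (TensorAlgebra.ι ℂ (0, a • ρ))
  | right (ρ : Γ) (a : A) : TensorRel (TensorAlgebra.ι ℂ (0, ρ) * TensorAlgebra.ι ℂ (a, 0))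
      (TensorAlgebra.ι ℂ (0, op a • ρ))

/-- The congruence generated by the defining relations. -/
def tensorCon : RingCon (TensorAlgebra ℂ (A × Γ)) := ringConGen (TensorRel A Γ)

/-- The tensor algebra `⨁ₖ Γ^{⊗_A k}` of the `A`-bimodule `Γ`: the algebra generated by the algebra `A`
and the space `Γ` subject to the relations that identify products of elements of `A` and `Γ`
with the products in the bimodule `Γ`. -/
def BimodTensor : Type (max u v) := (tensorCon A Γ).Quotient

instance : Ring (BimodTensor A Γ) := inferInstanceAs <| Ring (RingCon.Quotient _)

instance : Algebra ℂ (BimodTensor A Γ) := inferInstanceAs <| Algebra ℂ (RingCon.Quotient _)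

namespace BimodTensor

variable {A Γ}

/-- The canonical projection. -/
def mk : TensorAlgebra ℂ (A × Γ) →ₐ[ℂ] BimodTensor A Γ := (tensorCon A Γ).mkₐ ℂ

theorem mk_rel {x y : TensorAlgebra ℂ (A × Γ)} (h : TensorRel A Γ x y) : mk x = mk y :=
  Quotient.sound <| RingCon.le_ringConGen _ _ h

variable (A Γ) in
/-- The canonical map from `A`. -/
def inl : A →ₐ[ℂ] BimodTensor A Γ :=
  AlgHom.ofLinearMap (mk.toLinearMap ∘ₗ TensorAlgebra.ι ℂ ∘ₗ LinearMap.inl ℂ A Γ)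
    (by
      have := mk_rel (TensorRel.one (A := A) (Γ := Γ))
      rw [map_one] at this
      exact this)
    (fun a b => by
      have := mk_rel (TensorRel.mul (Γ := Γ) a b)
      rw [map_mul] at this
      exact this.symm)

variable (A Γ) in
/-- The canonical map from `Γ`. -/
def inr : Γ →ₗ[ℂ] BimodTensor A Γ :=
  mk.toLinearMap ∘ₗ TensorAlgebra.ι ℂ ∘ₗ LinearMap.inr ℂ A Γ

theorem inl_mul_inr (a : A) (ρ : Γ) : inl A Γ a * inr A Γ ρ = inr A Γ (a • ρ) := by
  have := mk_rel (TensorRel.left a ρ)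
  rw [map_mul] at this
  exact this

theorem inr_mul_inl (ρ : Γ) (a : A) : inr A Γ ρ * inl A Γ a = inr A Γ (op a • ρ) := by
  have := mk_rel (TensorRel.right ρ a)
  rw [map_mul] at this
  exact this

/-- The universal property of the tensor algebra. -/
def lift {B : Type*} [Ring B] [Algebra ℂ B] (f : A →ₐ[ℂ] B) (k : Γ →ₗ[ℂ] B)
    (hl : ∀ a ρ, k (a • ρ) = f a * k ρ) (hr : ∀ a ρ, k (op a • ρ) = k ρ * f a) :
    BimodTensor A Γ →ₐ[ℂ] B :=
  RingCon.liftₐ (tensorCon A Γ) (TensorAlgebra.lift ℂ (f.toLinearMap.coprod k))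
    (RingCon.ringConGen_le.2 fun x y (h : TensorRel A Γ x y) => by
      cases h <;> simp [hl, hr])

section
variable {B : Type*} [Ring B] [Algebra ℂ B] (f : A →ₐ[ℂ] B) (k : Γ →ₗ[ℂ] B)
    (hl : ∀ a ρ, k (a • ρ) = f a * k ρ) (hr : ∀ a ρ, k (op a • ρ) = k ρ * f a)

@[simp] theorem lift_inl (a : A) : lift f k hl hr (inl A Γ a) = f a := by
  refine (RingCon.liftₐ_mk _ _ _ (TensorAlgebra.ι ℂ (a, 0))).trans ?_
  simp

@[simp] theorem lift_inr (ρ : Γ) : lift f k hl hr (inr A Γ ρ) = k ρ := by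
  refine (RingCon.liftₐ_mk _ _ _ (TensorAlgebra.ι ℂ (0, ρ))).trans ?_
  simp
end

variable (A Γ) in
/-- For `k ≥ 1`, the component `Γ^{⊗_A k} = Γ ⊗_A ⋯ ⊗_A Γ` of the tensor algebra. -/
def deg (k : ℕ) : Submodule ℂ (BimodTensor A Γ) := LinearMap.range (inr A Γ) ^ k

/-- The element `ρ ⊗_A ρ'` of `Γ ⊗_A Γ`. -/
def tmul (ρ ρ' : Γ) : deg A Γ 2 :=
  ⟨inr A Γ ρ * inr A Γ ρ', by
    rw [deg, pow_two]; exact Submodule.mul_mem_mul ⟨ρ, rfl⟩ ⟨ρ', rfl⟩⟩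

theorem deg_two_induction {p : BimodTensor A Γ → Prop}
    (h : ∀ ρ ρ', p (inr A Γ ρ * inr A Γ ρ')) (hadd : ∀ x y, p x → p y → p (x + y))
    {t : BimodTensor A Γ} (ht : t ∈ deg A Γ 2) : p t := by
  rw [deg, pow_two] at ht
  refine Submodule.mul_induction_on ht ?_ hadd
  rintro _ ⟨ρ, rfl⟩ _ ⟨ρ', rfl⟩
  exact h ρ ρ'

/-- Left multiplication by `A` on `Γ ⊗_A Γ`. -/
def lsmul (a : A) (t : deg A Γ 2) : deg A Γ 2 :=
  ⟨inl A Γ a * t, deg_two_induction (p := fun x => inl A Γ a * x ∈ deg A Γ 2)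
    (fun ρ ρ' => by rw [← mul_assoc, inl_mul_inr]; exact (tmul _ _).2)
    (fun x y hx hy => by rw [mul_add]; exact add_mem hx hy) t.2⟩

/-- Right multiplication by `A` on `Γ ⊗_A Γ`. -/
def rsmul (t : deg A Γ 2) (a : A) : deg A Γ 2 :=
  ⟨t * inl A Γ a, deg_two_induction (p := fun x => x * inl A Γ a ∈ deg A Γ 2)
    (fun ρ ρ' => by rw [mul_assoc, inr_mul_inl]; exact (tmul _ _).2)
    (fun x y hx hy => by rw [add_mul]; exact add_mem hx hy) t.2⟩

/-- `Tᵐᵒᵖ` with the complex conjugate scalar multiplication. -/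
def ConjOp (A : Type u) [Ring A] [HopfAlgebra ℂ A] (Γ : Type v) [AddCommGroup Γ] [Module ℂ Γ]
    [Module A Γ] [Module Aᵐᵒᵖ Γ] : Type (max u v) := (BimodTensor A Γ)ᵐᵒᵖ

instance : Ring (ConjOp A Γ) := inferInstanceAs (Ring (BimodTensor A Γ)ᵐᵒᵖ)

instance : Algebra ℂ (ConjOp A Γ) := Algebra.compHom (BimodTensor A Γ)ᵐᵒᵖ (starRingEnd ℂ)

/-- The identity map. -/
def toConjOp : BimodTensor A Γ ≃+ ConjOp A Γ := opAddEquiv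

theorem toConjOp_mul (x y : BimodTensor A Γ) :
    toConjOp (x * y) = toConjOp y * toConjOp x := rfl

theorem toConjOp_smul (c : ℂ) (x : BimodTensor A Γ) :
    toConjOp (star c • x) = c • toConjOp x := rfl

end BimodTensor
end TensorAlgebra

namespace StarCalculus
open BimodTensor
variable (C : StarCalculus A Γ)

/-- The left coaction on the tensor algebra: the algebra map that extends `Δ` and `Δ_L`. -/
def tensorCoact : BimodTensor A Γ →ₐ[ℂ] A ⊗[ℂ] BimodTensor A Γ :=
  BimodTensor.lift
    ((Algebra.TensorProduct.map (AlgHom.id ℂ A) (inl A Γ)).comp (Bialgebra.comulAlgHom ℂ A))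
    ((inr A Γ).lTensor A ∘ₗ C.coact)
    (by
      intro a ρ
      have h : ∀ (w : A ⊗[ℂ] A) (z : A ⊗[ℂ] Γ), (inr A Γ).lTensor A (actL A Γ w z) =
          Algebra.TensorProduct.map (AlgHom.id ℂ A) (inl A Γ) w * (inr A Γ).lTensor A z := by
        intro w z
        induction w with
        | zero => simp
        | add u v hu hv => simp only [map_add, LinearMap.add_apply, hu, hv, add_mul]
        | tmul x y =>
          induction z with
          | zero => simp
          | add u v hu hv => simp only [map_add, hu, hv, mul_add]
          | tmul p ρ => simp [actL, ← inl_mul_inr, Algebra.TensorProduct.tmul_mul_tmul]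
      simp [C.coact_smul, h])
    (by
      intro a ρ
      have h : ∀ (w : A ⊗[ℂ] A) (z : A ⊗[ℂ] Γ), (inr A Γ).lTensor A (actR A Γ w z) =
          (inr A Γ).lTensor A z * Algebra.TensorProduct.map (AlgHom.id ℂ A) (inl A Γ) w := by
        intro w z
        induction w with
        | zero => simp
        | add u v hu hv => simp only [map_add, LinearMap.add_apply, hu, hv, mul_add]
        | tmul x y =>
          induction z with
          | zero => simp
          | add u v hu hv => simp only [map_add, hu, hv, add_mul]
          | tmul p ρ => simp [actR, ← inr_mul_inl, Algebra.TensorProduct.tmul_mul_tmul]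
      simp [C.coact_op_smul, h])

/-- The map `S²` on `Γ`, determined by `s2_spec`. -/
def s2 (hC : C.IsS2Invariant) : Γ →ₗ[ℂ] Γ := (C.exists_s2 hC).choose

theorem s2_spec (hC : C.IsS2Invariant) : C.IsS2Map (C.s2 hC) := (C.exists_s2 hC).choose_spec

/-- The algebra endomorphism of the tensor algebra that extends `S²` on `A` and `Γ`. -/
def tensorS2 (hC : C.IsS2Invariant) : BimodTensor A Γ →ₐ[ℂ] BimodTensor A Γ :=
  BimodTensor.lift ((inl A Γ).comp (antipodeSq A)) (inr A Γ ∘ₗ C.s2 hC)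
    (fun a ρ => by simp [(C.s2_spec hC).1, inl_mul_inr])
    (fun a ρ => by simp [(C.s2_spec hC).2.1, inr_mul_inl])

/-- `S²` on `Γ ⊗_A Γ`. -/
def s2Two (hC : C.IsS2Invariant) (t : deg A Γ 2) : deg A Γ 2 :=
  ⟨C.tensorS2 hC t, deg_two_induction (p := fun x => C.tensorS2 hC x ∈ deg A Γ 2)
    (fun ρ ρ' => by
      rw [map_mul, tensorS2, lift_inr, lift_inr]; exact (tmul _ _).2)
    (fun x y hx hy => by rw [map_add]; exact add_mem hx hy) t.2⟩

theorem involution_op_smul (C : StarCalculus A Γ) (a : A) (ρ : Γ) : star (op a • ρ) = star a • star ρ := by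
  have := C.involution_smul (star a) (star ρ)
  rw [star_star, star_star] at this
  rw [← this, star_star]

/-- The involution `*` of the tensor algebra, as a map to the conjugate opposite algebra. -/
def tensorStarHom : BimodTensor A Γ →ₐ[ℂ] ConjOp A Γ :=
  BimodTensor.lift
    (AlgHom.ofLinearMap
      { toFun := fun a => toConjOp (inl A Γ (star a))
        map_add' := fun a b => by simp
        map_smul' := fun c a => by
          rw [star_smul, map_smul, toConjOp_smul]; rfl }
      (by simp; rfl)
      (fun a b => by simp [toConjOp_mul]))
    { toFun := fun ρ => toConjOp (inr A Γ (star ρ))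
      map_add' := fun a b => by simp
      map_smul' := fun c a => by
        rw [star_smul, map_smul, toConjOp_smul]; rfl }
    (fun a ρ => by
      change toConjOp (inr A Γ (star (a • ρ))) =
        toConjOp (inl A Γ (star a)) * toConjOp (inr A Γ (star ρ))
      rw [← toConjOp_mul, inr_mul_inl, C.involution_smul])
    (fun a ρ => by
      change toConjOp (inr A Γ (star (op a • ρ))) =
        toConjOp (inr A Γ (star ρ)) * toConjOp (inl A Γ (star a))
      rw [← toConjOp_mul, inl_mul_inr, C.involution_op_smul])

/-- The involution of the tensor algebra: the antilinear antimultiplicative extension of `*` on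
`A` and `Γ`. -/
def tensorStar (t : BimodTensor A Γ) : BimodTensor A Γ := toConjOp.symm (C.tensorStarHom t)

theorem tensorStar_add (x y : BimodTensor A Γ) :
    C.tensorStar (x + y) = C.tensorStar x + C.tensorStar y := by
  simp [tensorStar]

theorem tensorStar_mul (x y : BimodTensor A Γ) :
    C.tensorStar (x * y) = C.tensorStar y * C.tensorStar x := by
  rw [tensorStar, map_mul]; rfl

theorem tensorStar_inr (ρ : Γ) : C.tensorStar (inr A Γ ρ) = inr A Γ (star ρ) := by
  rw [tensorStar, tensorStarHom, lift_inr]; rfl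

theorem tensorStar_inl (a : A) : C.tensorStar (inl A Γ a) = inl A Γ (star a) := by
  rw [tensorStar, tensorStarHom, lift_inl]; rfl

/-- The involution of `Γ ⊗_A Γ`, `(ρ ⊗ ρ')* = ρ'* ⊗ ρ*`. -/
def starTwo (t : deg A Γ 2) : deg A Γ 2 :=
  ⟨C.tensorStar t, deg_two_induction (p := fun x => C.tensorStar x ∈ deg A Γ 2)
    (fun ρ ρ' => by
      rw [tensorStar_mul, tensorStar_inr, tensorStar_inr]; exact (tmul _ _).2)
    (fun x y hx hy => by rw [tensorStar_add]; exact add_mem hx hy) t.2⟩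

/-- `σ` is a braiding of `Γ`. The maps `σ₁₂`, `σ₂₃` on `Γ ⊗_A Γ ⊗_A Γ` are the (unique) ones with
`σ₁₂(t ⊗ ρ) = σ(t) ⊗ ρ` and `σ₂₃(ρ ⊗ t) = ρ ⊗ σ(t)`. -/
structure IsBraiding (hC : C.IsS2Invariant) (σ : deg A Γ 2 ≃ₗ[ℂ] deg A Γ 2) : Prop where
  map_lsmul : ∀ a t, σ (lsmul a t) = lsmul a (σ t)
  map_rsmul : ∀ t a, σ (rsmul t a) = rsmul (σ t) a
  /-- `Δ_L(σ(t)) = (id ⊗ σ) Δ_L(t)` -/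
  covariant : ∀ t : deg A Γ 2, ∃ z : A ⊗[ℂ] deg A Γ 2,
    (deg A Γ 2).subtype.lTensor A z = C.tensorCoact t ∧
    (deg A Γ 2).subtype.lTensor A (σ.toLinearMap.lTensor A z) = C.tensorCoact (σ t)
  /-- the braid relation -/
  braid : ∃ σ₁₂ σ₂₃ : deg A Γ 3 →ₗ[ℂ] deg A Γ 3,
    (∀ (x : deg A Γ 3) (t : deg A Γ 2) (ρ : Γ), (x : BimodTensor A Γ) = t * inr A Γ ρ →
      (σ₁₂ x : BimodTensor A Γ) = σ t * inr A Γ ρ) ∧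
    (∀ (x : deg A Γ 3) (ρ : Γ) (t : deg A Γ 2), (x : BimodTensor A Γ) = inr A Γ ρ * t →
      (σ₂₃ x : BimodTensor A Γ) = inr A Γ ρ * σ t) ∧
    σ₁₂ ∘ₗ σ₂₃ ∘ₗ σ₁₂ = σ₂₃ ∘ₗ σ₁₂ ∘ₗ σ₂₃
  /-- `σ` fixes `ω(a₁) ⊗ ω(a₂)` for all `a` with `ω(a) = 0`, `ε(a) = 0` -/
  ker_mc : ∀ a : A, C.mc a = 0 → counit (R := ℂ) a = 0 → ∀ t : deg A Γ 2,
    (t : BimodTensor A Γ) = LinearMap.mul' ℂ (BimodTensor A Γ)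
      (TensorProduct.map (inr A Γ ∘ₗ C.mc) (inr A Γ ∘ₗ C.mc) (comul (R := ℂ) a)) → σ t = t
  map_s2 : ∀ t, C.s2Two hC (σ t) = σ (C.s2Two hC t)
  map_star : (∀ t, C.starTwo (σ t) = σ (C.starTwo t)) ∨
    (∀ t, C.starTwo (σ t) = σ.symm (C.starTwo t))

/-- `g` is a left-covariant `σ`-metric. Here `g₁₂(t ⊗ ρ) = g(t)ρ`, `g₂₃(ρ ⊗ t) = ρ g(t)`, and
`legs` states `g₁₂ τ₂₃ τ₁₂ = g₂₃` for `τ = σ` and for `τ = σ⁻¹`. -/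
structure IsSigmaMetric (hC : C.IsS2Invariant) (σ : deg A Γ 2 ≃ₗ[ℂ] deg A Γ 2)
    (g : deg A Γ 2 →ₗ[ℂ] A) : Prop where
  map_lsmul : ∀ a t, g (lsmul a t) = a * g t
  map_rsmul : ∀ t a, g (rsmul t a) = g t * a
  /-- `Δ(g(t)) = (id ⊗ g) Δ_L(t)` -/
  covariant : ∀ t : deg A Γ 2, ∃ z : A ⊗[ℂ] deg A Γ 2,
    (deg A Γ 2).subtype.lTensor A z = C.tensorCoact t ∧
    g.lTensor A z = comul (R := ℂ) (g t)
  nondeg_left : ∀ ρ : Γ, (∀ ρ', g (tmul ρ ρ') = 0) → ρ = 0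
  nondeg_right : ∀ ρ' : Γ, (∀ ρ, g (tmul ρ ρ') = 0) → ρ' = 0
  comp_braiding : ∀ t, g (σ t) = g t
  legs : ∀ τ : deg A Γ 2 ≃ₗ[ℂ] deg A Γ 2, τ = σ ∨ τ = σ.symm →
    ∃ (τ₁₂ τ₂₃ : deg A Γ 3 →ₗ[ℂ] deg A Γ 3) (g₁₂ g₂₃ : deg A Γ 3 →ₗ[ℂ] Γ),
    (∀ (x : deg A Γ 3) (t : deg A Γ 2) (ρ : Γ), (x : BimodTensor A Γ) = t * inr A Γ ρ →
      (τ₁₂ x : BimodTensor A Γ) = τ t * inr A Γ ρ ∧ g₁₂ x = g t • ρ) ∧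
    (∀ (x : deg A Γ 3) (ρ : Γ) (t : deg A Γ 2), (x : BimodTensor A Γ) = inr A Γ ρ * t →
      (τ₂₃ x : BimodTensor A Γ) = inr A Γ ρ * τ t ∧ g₂₃ x = op (g t) • ρ) ∧
    g₁₂ ∘ₗ τ₂₃ ∘ₗ τ₁₂ = g₂₃
  map_star : ∀ ρ ρ', star (g (tmul ρ ρ')) = g (tmul (star ρ') (star ρ))
  map_s2 : ∀ ρ ∈ C.inv, ∀ ρ' ∈ C.inv, g (tmul (C.s2 hC ρ') ρ) = g (tmul ρ ρ')

end StarCalculus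

section Clifford
open BimodTensor

/-- The relations `t = g(t)` for `t ∈ ker(id - σ) ⊆ Γ ⊗_A Γ`. -/
inductive CliffordRel (σ : deg A Γ 2 ≃ₗ[ℂ] deg A Γ 2) (g : deg A Γ 2 →ₗ[ℂ] A) :
    BimodTensor A Γ → BimodTensor A Γ → Prop
  | of (t : deg A Γ 2) (ht : σ t = t) : CliffordRel σ g t (inl A Γ (g t))

/-- The congruence modulo the two-sided ideal generated by the elements `t - g(t)`,
`t ∈ ker(id - σ)`. -/
def cliffordCon (σ : deg A Γ 2 ≃ₗ[ℂ] deg A Γ 2) (g : deg A Γ 2 →ₗ[ℂ] A) :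
    RingCon (BimodTensor A Γ) := ringConGen (CliffordRel σ g)

/-- The quantum Clifford algebra `Cl(Γ, σ, g)`. -/
def QCl (σ : deg A Γ 2 ≃ₗ[ℂ] deg A Γ 2) (g : deg A Γ 2 →ₗ[ℂ] A) : Type (max u v) :=
  (cliffordCon σ g).Quotient

instance (σ : deg A Γ 2 ≃ₗ[ℂ] deg A Γ 2) (g : deg A Γ 2 →ₗ[ℂ] A) : Ring (QCl σ g) :=
  inferInstanceAs <| Ring (RingCon.Quotient _)

instance (σ : deg A Γ 2 ≃ₗ[ℂ] deg A Γ 2) (g : deg A Γ 2 →ₗ[ℂ] A) : Algebra ℂ (QCl σ g) :=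
  inferInstanceAs <| Algebra ℂ (RingCon.Quotient _)

namespace QCl
variable (σ : deg A Γ 2 ≃ₗ[ℂ] deg A Γ 2) (g : deg A Γ 2 →ₗ[ℂ] A)

/-- The canonical projection from the tensor algebra. -/
def mk : BimodTensor A Γ →ₐ[ℂ] QCl σ g := (cliffordCon σ g).mkₐ ℂ

theorem mk_rel (t : deg A Γ 2) (ht : σ t = t) : mk σ g t = mk σ g (BimodTensor.inl A Γ (g t)) :=
  Quotient.sound <| RingCon.le_ringConGen _ _ (CliffordRel.of t ht)

/-- The canonical map from `A`. -/
def inl : A →ₐ[ℂ] QCl σ g := (mk σ g).comp (BimodTensor.inl A Γ)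

/-- The canonical map from `Γ`. -/
def inr : Γ →ₗ[ℂ] QCl σ g := (mk σ g).toLinearMap ∘ₗ BimodTensor.inr A Γ

variable {σ g}

/-- The left coaction of `A` on `Cl(Γ, σ, g)`: the algebra map induced by the left coaction on the
tensor algebra. -/
def coact {C : StarCalculus A Γ} {hC : C.IsS2Invariant} (hσ : C.IsBraiding hC σ)
    (hg : C.IsSigmaMetric hC σ g) : QCl σ g →ₐ[ℂ] A ⊗[ℂ] QCl σ g :=
  RingCon.liftₐ (cliffordCon σ g)
    ((Algebra.TensorProduct.map (AlgHom.id ℂ A) (mk σ g)).comp C.tensorCoact)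
    (RingCon.ringConGen_le.2 <| by
      rintro _ _ ⟨t, ht⟩
      obtain ⟨z, hz1, hz2⟩ := hσ.covariant t
      obtain ⟨w, hw1, hw2⟩ := hg.covariant t
      have inj : Function.Injective ((deg A Γ 2).subtype.lTensor A) :=
        Module.Flat.lTensor_preserves_injective_linearMap _ (Submodule.subtype_injective _)
      obtain rfl : z = w := inj (hz1.trans hw1.symm)
      have hσz : σ.toLinearMap.lTensor A z = z := inj (by rw [hz2, ht, hz1])
      let q : deg A Γ 2 →ₗ[ℂ] QCl σ g :=
        (mk σ g).toLinearMap ∘ₗ (deg A Γ 2).subtype - (inl σ g).toLinearMap ∘ₗ g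
      obtain ⟨k, hk⟩ := exists_factor (σ.toLinearMap - LinearMap.id) q (by
        intro x hx
        have hx' : σ x = x := sub_eq_zero.mp hx
        exact sub_eq_zero.mpr (mk_rel σ g x hx'))
      have hq : q.lTensor A z = 0 := by
        rw [← hk, LinearMap.lTensor_comp, LinearMap.comp_apply, LinearMap.lTensor_sub,
          LinearMap.sub_apply, hσz, LinearMap.lTensor_id, LinearMap.id_apply, sub_self, map_zero]
      have e1 : Algebra.TensorProduct.map (AlgHom.id ℂ A) (mk σ g) (C.tensorCoact t) =
          ((mk σ g).toLinearMap ∘ₗ (deg A Γ 2).subtype).lTensor A z := by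
        rw [LinearMap.lTensor_comp, LinearMap.comp_apply, hz1]; rfl
      have e2 : Algebra.TensorProduct.map (AlgHom.id ℂ A) (mk σ g)
          (C.tensorCoact (BimodTensor.inl A Γ (g t))) =
          ((inl σ g).toLinearMap ∘ₗ g).lTensor A z := by
        rw [LinearMap.lTensor_comp, LinearMap.comp_apply, hw2, StarCalculus.tensorCoact, lift_inl,
          AlgHom.comp_apply, ← AlgHom.comp_apply, ← Algebra.TensorProduct.map_comp]
        rfl
      change Algebra.TensorProduct.map (AlgHom.id ℂ A) (mk σ g) (C.tensorCoact t) =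
        Algebra.TensorProduct.map (AlgHom.id ℂ A) (mk σ g)
          (C.tensorCoact (BimodTensor.inl A Γ (g t)))
      rw [e1, e2, ← sub_eq_zero, ← LinearMap.sub_apply,
        ← LinearMap.lTensor_sub]
      exact hq)

/-- A left ideal `J` is left-covariant: `Δ_L(J) ⊆ A ⊗ J`. -/
def IsLeftCovariant {C : StarCalculus A Γ} {hC : C.IsS2Invariant} (hσ : C.IsBraiding hC σ)
    (hg : C.IsSigmaMetric hC σ g) (J : Ideal (QCl σ g)) : Prop :=
  ∀ u ∈ J, coact hσ hg u ∈ LinearMap.range ((J.restrictScalars ℂ).subtype.lTensor A)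

/-- `Cl(Γ, σ, g)` is a simple left-covariant algebra: it is nonzero and has no left-covariant
two-sided ideals besides zero and itself. -/
def IsSimpleLeftCovariant {C : StarCalculus A Γ} {hC : C.IsS2Invariant} (hσ : C.IsBraiding hC σ)
    (hg : C.IsSigmaMetric hC σ g) : Prop :=
  Nontrivial (QCl σ g) ∧
    ∀ J : Ideal (QCl σ g), J.IsTwoSided → IsLeftCovariant hσ hg J → J = ⊥ ∨ J = ⊤

/-- `S` is a minimal spinor module: a minimal (nonzero) left-covariant left ideal that is also an
`A`-bimodule. -/
structure IsMinimalSpinorModule {C : StarCalculus A Γ} {hC : C.IsS2Invariant}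
    (hσ : C.IsBraiding hC σ) (hg : C.IsSigmaMetric hC σ g) (S : Ideal (QCl σ g)) : Prop where
  covariant : IsLeftCovariant hσ hg S
  ne_bot : S ≠ ⊥
  minimal : ∀ J : Ideal (QCl σ g), IsLeftCovariant hσ hg J → J ≤ S → J = ⊥ ∨ J = S
  mul_mem : ∀ ψ ∈ S, ∀ a : A, ψ * inl σ g a ∈ S

/-- `β` is the main involution of `Cl(Γ, σ, g)`, where `ρ` is the automorphism of `A` with
`h(ab) = h(bρ(a))`: an antilinear antimultiplicative involution with `β(a) = ρ(a)*` on `A` and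
`β(θ) = -S²(θ*)` on left-invariant one-forms. In terms of a basis `θᵢ` with `θᵢ* = -∑ⱼ conj(Eⱼᵢ) θⱼ` and
`S²(θⱼ) = ∑ₖ Fₖⱼ θₖ` the latter is `β(θᵢ) = ∑ₖ conj(Bₖᵢ) θₖ` with `B = conj(F) E`. -/
structure IsMainInvolution (C : StarCalculus A Γ) (hC : C.IsS2Invariant)
    (σ : deg A Γ 2 ≃ₗ[ℂ] deg A Γ 2) (g : deg A Γ 2 →ₗ[ℂ] A)
    (ρ : A ≃ₐ[ℂ] A) (β : QCl σ g → QCl σ g) : Prop where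
  map_add : ∀ u v, β (u + v) = β u + β v
  map_smul : ∀ (c : ℂ) u, β (c • u) = star c • β u
  map_mul : ∀ u v, β (u * v) = β v * β u
  involutive : ∀ u, β (β u) = u
  map_inl : ∀ a, β (inl σ g a) = inl σ g (star (ρ a))
  map_inr : ∀ θ ∈ C.inv, β (inr σ g θ) = -inr σ g (C.s2 hC (star θ))

/-- `m` is a metric on `S` (linear in the first, antilinear in the second argument): hermitian,
non-degenerate, and of the form `h ∘ m₀` for a left-covariant `A`-valued form `m₀` with
`m₀(aψ, bψ') = a m₀(ψ, ψ') b*`. -/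
structure IsSpinorMetric {C : StarCalculus A Γ} {hC : C.IsS2Invariant}
    (hσ : C.IsBraiding hC σ) (hg : C.IsSigmaMetric hC σ g) (h : A →ₗ[ℂ] ℂ)
    (S : Ideal (QCl σ g)) (m : S →ₗ[ℂ] S →ₗ⋆[ℂ] ℂ) : Prop where
  exists_form : ∃ m₀ : S →ₗ[ℂ] S →ₗ⋆[ℂ] A,
    (∀ (a b : A) (ψ ψ' : S),
      m₀ (inl σ g a • ψ) (inl σ g b • ψ') = a * m₀ ψ ψ' * star b) ∧
    (∀ (ψ ψ' : S) (n k : ℕ) (a : Fin n → A) (φ : Fin n → S) (b : Fin k → A) (φ' : Fin k → S),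
      coact hσ hg ψ = ∑ i, a i ⊗ₜ[ℂ] (φ i : QCl σ g) →
      coact hσ hg ψ' = ∑ j, b j ⊗ₜ[ℂ] (φ' j : QCl σ g) →
      comul (R := ℂ) (m₀ ψ ψ') = ∑ i, ∑ j, (a i * star (b j)) ⊗ₜ[ℂ] m₀ (φ i) (φ' j)) ∧
    ∀ ψ ψ', m ψ ψ' = h (m₀ ψ ψ')
  hermitian : ∀ ψ ψ', m ψ' ψ = star (m ψ ψ')
  nondeg_left : ∀ ψ, (∀ ψ', m ψ ψ' = 0) → ψ = 0
  nondeg_right : ∀ ψ', (∀ ψ, m ψ ψ' = 0) → ψ' = 0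

end QCl
end Clifford
end QuantumClifford
end

/-! Everything rests on a splitting. Let B be the subalgebra of Cl generated by the left-invariant
one-forms. The coaction is trivial on B, every element of Cl is a sum of products ab with a in A and
b in B, and u ↦ u₋₂ ⊗ S(u₋₁)u₀ sends ab to a ⊗ b (`splitting_inl_mul`, `mulMap_splitting`). A
left-covariant left ideal is likewise generated over A by its elements in B (`mem_induction`).

Existence of h, ρ, β. Cosemisimplicity of A as a comodule over itself gives a right-invariant
functional; composing it with S makes it left-invariant, and the two must agree (`exists_isHaar`).
The form h(ab) is non-degenerate, and ρ is given explicitly by ρ(a) = χ(a₁)S⁻²(a₂) with χ(a) =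
h(a₁S⁻³(a₂)) (`IsHaar.modular_spec`). Non-degeneracy makes ρ multiplicative, so χ = ε∘ρ is a
character. Since S²(ρ(a)) = χ(a₁)a₂, the involution β is the endomorphism u ↦ χ(u₋₁)u₀ followed by
the antilinear antimultiplicative map with a ↦ S²(a*) and γ ↦ -S²(γ*). The latter respects the
Clifford relations because σ and g are compatible with S² and with the star
(`exists_isMainInvolution`).

The metric. For a functional f on Cl with f(β(u)) = conj f(u), put ⟨au, bv⟩₀ = f(β(v)u) ab* for u, v
in B. Covariance and the A-linearity rules are immediate. Because h(ρ(b)*a) = h(ab*), one finds h⟨u,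
v⟩₀ = f(E(β(v)u)) for all u, v in Cl, where E(u) = h(u₋₁)u₀ (`haar_algForm`). The right side depends
only on β(v)u, so the adjoint of multiplication by r is multiplication by β(r).

Non-degeneracy. Simplicity forces the two-sided ideal generated by the spinor module to be Cl;
projecting to B writes 1 as a sum of products vb with v in the module and v, b in B
(`one_mem_span_mul`). Hence β(w)v ≠ 0 for some v, w in B and in the module, and f is chosen with
f(β(w)v) ≠ 0. The radical is a left ideal by adjointness, so minimality excludes nonzero elements of
B from its intersection with the module, and the splitting reduces the general case to this one
(`eq_zero_of_haar_algForm_eq_zero`). -/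

noncomputable section
set_option linter.unusedSectionVars false

namespace QuantumClifford


/-! ### Sums over tensors in Sweedler notation -/

section Sweedler
variable {U V W M N : Type*} [AddCommGroup U] [Module ℂ U] [AddCommGroup V] [Module ℂ V]
  [AddCommGroup W] [Module ℂ W] [AddCommGroup M] [Module ℂ M] [AddCommGroup N] [Module ℂ N]

/-- The function `f` is bilinear. -/
structure IsBilin (f : U → V → M) : Prop where
  add_left : ∀ x x' y, f (x + x') y = f x y + f x' y
  smul_left : ∀ (c : ℂ) x y, f (c • x) y = c • f x y
  add_right : ∀ x y y', f x (y + y') = f x y + f x y'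
  smul_right : ∀ (c : ℂ) x y, f x (c • y) = c • f x y

/-- The bilinear map given by a bilinear function. -/
def IsBilin.toLin {f : U → V → M} (hf : IsBilin f) : U →ₗ[ℂ] V →ₗ[ℂ] M :=
  LinearMap.mk₂ ℂ f hf.add_left hf.smul_left hf.add_right hf.smul_right

/-- `f(w₁, w₂)`, the sum of the values of `f` at the terms of a decomposition of the tensor `w`. -/
def sw (w : U ⊗[ℂ] V) (f : U → V → M) : M :=
  ∑ i ∈ (TensorProduct.exists_finset w).choose, f i.1 i.2

/-- Bilinearity makes the choice of decomposition irrelevant. Rules that only rearrange a finite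
sum, such as `map_sw` and `sw_comm`, hold for arbitrary functions; bilinearity is needed only where
the tensor itself is rewritten. -/
theorem sw_eq_lift {f : U → V → M} (hf : IsBilin f) (w : U ⊗[ℂ] V) :
    sw w f = TensorProduct.lift hf.toLin w := by
  conv_rhs => rw [(TensorProduct.exists_finset w).choose_spec, map_sum]
  rfl

theorem sw_tmul {f : U → V → M} (hf : IsBilin f) (x : U) (y : V) : sw (x ⊗ₜ[ℂ] y) f = f x y := by
  rw [sw_eq_lift hf]; rfl

theorem sw_add {f : U → V → M} (hf : IsBilin f) (w w' : U ⊗[ℂ] V) :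
    sw (w + w') f = sw w f + sw w' f := by
  simp only [sw_eq_lift hf, map_add]

theorem sw_smul {f : U → V → M} (hf : IsBilin f) (c : ℂ) (w : U ⊗[ℂ] V) :
    sw (c • w) f = c • sw w f := by
  simp only [sw_eq_lift hf, map_smul]

theorem sw_zero {f : U → V → M} (hf : IsBilin f) : sw (0 : U ⊗[ℂ] V) f = 0 := by
  simp only [sw_eq_lift hf, map_zero]

theorem sw_mk (w : U ⊗[ℂ] V) : sw w (fun x y => x ⊗ₜ[ℂ] y) = w :=
  (TensorProduct.exists_finset w).choose_spec.symm

theorem map_sw {F : Type*} [FunLike F M N] [AddMonoidHomClass F M N] (φ : F) (w : U ⊗[ℂ] V)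
    (f : U → V → M) : φ (sw w f) = sw w fun x y => φ (f x y) :=
  map_sum φ _ _

theorem sw_smul_apply (c : ℂ) (w : U ⊗[ℂ] V) (f : U → V → M) :
    c • sw w f = sw w fun x y => c • f x y := Finset.smul_sum

theorem sw_congr (w : U ⊗[ℂ] V) {f f' : U → V → M} (h : ∀ x y, f x y = f' x y) :
    sw w f = sw w f' := Finset.sum_congr rfl fun _ _ => h _ _

theorem sw_add_apply (w : U ⊗[ℂ] V) (f f' : U → V → M) :
    (sw w fun x y => f x y + f' x y) = sw w f + sw w f' := Finset.sum_add_distrib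

theorem sw_comm {U' V' : Type*} [AddCommGroup U'] [Module ℂ U'] [AddCommGroup V'] [Module ℂ V']
    (w : U ⊗[ℂ] V) (z : U' ⊗[ℂ] V') (f : U → V → U' → V' → M) :
    (sw w fun x y => sw z fun p q => f x y p q) = sw z fun p q => sw w fun x y => f x y p q :=
  Finset.sum_comm

theorem sw_map {U' V' : Type*} [AddCommGroup U'] [Module ℂ U'] [AddCommGroup V'] [Module ℂ V']
    {f : U' → V' → M} (hf : IsBilin f) (φ : U →ₗ[ℂ] U') (ψ : V →ₗ[ℂ] V') (w : U ⊗[ℂ] V) :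
    sw (TensorProduct.map φ ψ w) f = sw w fun x y => f (φ x) (ψ y) := by
  conv_lhs => rw [← sw_mk w, map_sw, sw_eq_lift hf, map_sw]
  rfl

theorem sw_comm_map {f : V → U → M} (hf : IsBilin f) (w : U ⊗[ℂ] V) :
    sw (TensorProduct.comm ℂ U V w) f = sw w fun x y => f y x := by
  conv_lhs => rw [← sw_mk w, map_sw, sw_eq_lift hf, map_sw]
  rfl

theorem sw_mul {R T : Type*} [Ring R] [Algebra ℂ R] [Ring T] [Algebra ℂ T] {f : R → T → M}
    (hf : IsBilin f) (w z : R ⊗[ℂ] T) :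
    sw (w * z) f = sw w fun x y => sw z fun p q => f (x * p) (y * q) := by
  have h : w * z = sw w fun x y => sw z fun p q => (x * p) ⊗ₜ[ℂ] (y * q) := by
    conv_lhs => rw [← sw_mk w, ← sw_mk z]
    simp only [sw, Finset.sum_mul, Finset.mul_sum, Algebra.TensorProduct.tmul_mul_tmul]
    exact Finset.sum_comm
  rw [h, sw_eq_lift hf, map_sw]
  simp only [map_sw]
  rfl

theorem sw_star {R T : Type*} [Ring R] [StarRing R] [Algebra ℂ R] [StarModule ℂ R] [Ring T] [StarRing T]
    [Algebra ℂ T] [StarModule ℂ T] {f : R → T → M} (hf : IsBilin f) (w : R ⊗[ℂ] T) :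
    sw (star w) f = sw w fun x y => f (star x) (star y) := by
  have h : star w = sw w fun x y => star x ⊗ₜ[ℂ] star y := by
    conv_lhs => rw [← sw_mk w]
    exact map_sum starAddEquiv _ _
  rw [h, sw_eq_lift hf, map_sw]
  rfl

theorem sw_mul_left {R : Type*} [Ring R] (a : R) (w : U ⊗[ℂ] V) (f : U → V → R) :
    a * sw w f = sw w fun x y => a * f x y := Finset.mul_sum _ _ _

theorem sw_mul_right {R : Type*} [Ring R] (a : R) (w : U ⊗[ℂ] V) (f : U → V → R) :
    sw w f * a = sw w fun x y => f x y * a := Finset.sum_mul _ _ _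

/-- The function `f` is trilinear. -/
structure IsTrilin (f : U → V → W → M) : Prop where
  bilin : ∀ x, IsBilin (f x)
  add_left : ∀ x x' y z, f (x + x') y z = f x y z + f x' y z
  smul_left : ∀ (c : ℂ) x y z, f (c • x) y z = c • f x y z

theorem IsTrilin.bilin_right {f : U → V → W → M} (hf : IsTrilin f) (z : W) :
    IsBilin fun x y => f x y z :=
  ⟨fun _ _ _ => hf.add_left _ _ _ _, fun _ _ _ => hf.smul_left _ _ _ _,
    fun _ _ _ => (hf.bilin _).add_left _ _ _, fun _ _ _ => (hf.bilin _).smul_left _ _ _⟩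

/-- The linear map on the triple tensor product given by a trilinear function. -/
def IsTrilin.lift {f : U → V → W → M} (hf : IsTrilin f) : U ⊗[ℂ] (V ⊗[ℂ] W) →ₗ[ℂ] M :=
  TensorProduct.lift
    { toFun := fun x => TensorProduct.lift (hf.bilin x).toLin
      map_add' := fun x x' => by
        ext y z; exact hf.add_left x x' y z
      map_smul' := fun c x => by
        ext y z; exact hf.smul_left c x y z }

theorem IsTrilin.lift_tmul {f : U → V → W → M} (hf : IsTrilin f) (x : U) (w : V ⊗[ℂ] W) :
    hf.lift (x ⊗ₜ w) = sw w (f x) := by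
  rw [sw_eq_lift (hf.bilin x)]; rfl

/-- Both iterated sums are values of the linear map induced by f on the triple tensor product, so
any coassociativity-type identity transfers to sums. -/
theorem sw_assoc {P Q : Type*} [AddCommGroup P] [Module ℂ P] [AddCommGroup Q] [Module ℂ Q]
    {f : U → V → W → M} (hf : IsTrilin f)
    (w : P ⊗[ℂ] W) (w' : U ⊗[ℂ] Q) (φ : P →ₗ[ℂ] U ⊗[ℂ] V) (ψ : Q →ₗ[ℂ] V ⊗[ℂ] W)
    (h : TensorProduct.assoc ℂ U V W (φ.rTensor W w) = ψ.lTensor U w') :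
    (sw w fun x y => sw (φ x) fun p q => f p q y) = sw w' fun x y => sw (ψ y) fun p q => f x p q := by
  have h1 : hf.lift (ψ.lTensor U w') = sw w' fun x y => sw (ψ y) fun p q => f x p q := by
    conv_lhs => rw [← sw_mk w', map_sw, map_sw]
    simp only [LinearMap.lTensor_tmul, hf.lift_tmul]
  have h2 : hf.lift (TensorProduct.assoc ℂ U V W (φ.rTensor W w)) =
      sw w fun x y => sw (φ x) fun p q => f p q y := by
    conv_lhs => rw [← sw_mk w, map_sw, map_sw, map_sw]
    refine sw_congr _ fun x y => ?_
    have : ∀ v : U ⊗[ℂ] V, hf.lift (TensorProduct.assoc ℂ U V W (v ⊗ₜ y)) =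
        sw v fun p q => f p q y := by
      intro v
      induction v with
      | zero => rw [sw_zero (hf.bilin_right y)]; simp
      | add u v hu hv =>
        rw [sw_add (hf.bilin_right y), ← hu, ← hv, TensorProduct.add_tmul, map_add, map_add]
      | tmul p q => rw [sw_tmul (hf.bilin_right y)]; rfl
    rw [LinearMap.rTensor_tmul, this]
  rw [← h1, ← h2, h]

end Sweedler

/-! ### The Hopf algebra axioms as identities between Sweedler sums -/

section Coalgebra
variable {A : Type u} [Ring A] [HopfAlgebra ℂ A] {M : Type*} [AddCommGroup M] [Module ℂ M]

theorem comul_assoc {f : A → A → A → M} (hf : IsTrilin f) (a : A) :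
    (sw (comul (R := ℂ) a) fun x y => sw (comul (R := ℂ) x) fun p q => f p q y) =
      sw (comul (R := ℂ) a) fun x y => sw (comul (R := ℂ) y) fun p q => f x p q :=
  sw_assoc hf _ _ comul comul (Coalgebra.coassoc_apply a)

theorem counit_left (f : A →ₗ[ℂ] M) (a : A) :
    (sw (comul (R := ℂ) a) fun x y => counit (R := ℂ) x • f y) = f a := by
  have h := Coalgebra.rTensor_counit_comul (R := ℂ) a
  have hf : IsBilin fun (c : ℂ) (y : A) => c • f y :=
    ⟨fun _ _ _ => add_smul _ _ _, fun _ _ _ => smul_assoc _ _ _,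
      fun _ _ _ => by rw [map_add, smul_add], fun _ _ _ => by rw [map_smul, smul_comm]⟩
  have := congrArg (fun w => sw w fun (c : ℂ) (y : A) => c • f y) h
  simp only [sw_tmul hf, LinearMap.rTensor, sw_map hf] at this
  simpa using this

theorem counit_right (f : A →ₗ[ℂ] M) (a : A) :
    (sw (comul (R := ℂ) a) fun x y => counit (R := ℂ) y • f x) = f a := by
  have h := Coalgebra.lTensor_counit_comul (R := ℂ) a
  have hf : IsBilin fun (y : A) (c : ℂ) => c • f y :=
    ⟨fun _ _ _ => by rw [map_add, smul_add], fun _ _ _ => by rw [map_smul, smul_comm],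
      fun _ _ _ => add_smul _ _ _, fun _ _ _ => smul_assoc _ _ _⟩
  have := congrArg (fun w => sw w fun (y : A) (c : ℂ) => c • f y) h
  simp only [sw_tmul hf, LinearMap.lTensor, sw_map hf] at this
  simpa using this

theorem antipode_mul_sw (a : A) :
    (sw (comul (R := ℂ) a) fun x y => antipode ℂ x * y) = counit (R := ℂ) a • (1 : A) := by
  have h := mul_antipode_rTensor_comul_apply (R := ℂ) a
  rw [← sw_mk (comul (R := ℂ) a), map_sw, map_sw, Algebra.algebraMap_eq_smul_one] at h
  simpa using h

theorem mul_antipode_sw (a : A) :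
    (sw (comul (R := ℂ) a) fun x y => x * antipode ℂ y) = counit (R := ℂ) a • (1 : A) := by
  have h := mul_antipode_lTensor_comul_apply (R := ℂ) a
  rw [← sw_mk (comul (R := ℂ) a), map_sw, map_sw, Algebra.algebraMap_eq_smul_one] at h
  simpa using h

theorem sw_comul_antipode {f : A → A → M} (hf : IsBilin f) (a : A) :
    sw (comul (R := ℂ) (antipode ℂ a)) f =
      sw (comul (R := ℂ) a) fun x y => f (antipode ℂ y) (antipode ℂ x) := by
  have hf' : IsBilin fun x y => f (antipode ℂ x) (antipode ℂ y) := by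
    constructor <;> intros <;> simp [hf.add_left, hf.smul_left, hf.add_right, hf.smul_right]
  rw [comul_antipode, sw_map hf, sw_comm_map hf']

end Coalgebra

/-! ### The inverse of the antipode -/

section Antipode
variable {A : Type u} [Ring A] [HopfAlgebra ℂ A] [StarRing A] [StarModule ℂ A]

variable (A) in
/-- The map `a ↦ S(a*)*`, the inverse of the antipode of a Hopf `*`-algebra. -/
def antipodeInv : A →ₗ[ℂ] A where
  toFun a := star (antipode ℂ (star a))
  map_add' a b := by simp
  map_smul' c a := by simp

theorem antipodeInv_apply (a : A) : antipodeInv A a = star (antipode ℂ (star a)) := rfl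

theorem antipodeInv_mul (a b : A) : antipodeInv A (a * b) = antipodeInv A b * antipodeInv A a := by
  simp [antipodeInv_apply, antipode_mul_antidistrib]

theorem antipodeInv_one : antipodeInv A 1 = 1 := by
  simp [antipodeInv_apply]

theorem sw_comul_star (hStar : IsHopfStar A) {M : Type*} [AddCommGroup M] [Module ℂ M]
    {f : A → A → M} (hf : IsBilin f) (a : A) :
    sw (comul (R := ℂ) (star a)) f = sw (comul (R := ℂ) a) fun x y => f (star x) (star y) := by
  rw [hStar, sw_star hf]

theorem isBilin_mul {f g : A →ₗ[ℂ] A} : IsBilin fun x y => f x * g y := by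
  constructor <;> intros <;> simp [add_mul, mul_add]

theorem isBilin_smul (e : A →ₗ[ℂ] ℂ) {M : Type*} [AddCommGroup M] [Module ℂ M] (f : A →ₗ[ℂ] M) :
    IsBilin fun x y => e x • f y :=
  ⟨fun _ _ _ => by rw [map_add, add_smul], fun _ _ _ => by rw [map_smul, smul_assoc],
    fun _ _ _ => by rw [map_add, smul_add], fun _ _ _ => by rw [map_smul, smul_comm]⟩

theorem isBilin_smul_flip (e : A →ₗ[ℂ] ℂ) {M : Type*} [AddCommGroup M] [Module ℂ M]
    (f : A →ₗ[ℂ] M) : IsBilin fun x y => e y • f x :=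
  ⟨fun _ _ _ => by rw [map_add, smul_add], fun _ _ _ => by rw [map_smul, smul_comm],
    fun _ _ _ => by rw [map_add, add_smul], fun _ _ _ => by rw [map_smul, smul_assoc]⟩

/-- The functional a ↦ conj ε(a*) is also a left counit for Δ, and a left counit agrees with the
two-sided counit ε. -/
theorem counit_star (hStar : IsHopfStar A) (a : A) :
    counit (R := ℂ) (star a) = star (counit (R := ℂ) a) := by
  let e : A →ₗ[ℂ] ℂ :=
    { toFun := fun a => star (counit (R := ℂ) (star a))
      map_add' := by simp
      map_smul' := by simp }
  have h1 : ∀ a, e a = star (counit (R := ℂ) (star a)) := fun _ => rfl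
  have h2 : (sw (comul (R := ℂ) a) fun x y => e x • y) = a := by
    have h3 := congrArg star (counit_left LinearMap.id (star a))
    rw [sw_comul_star hStar (isBilin_smul counit LinearMap.id), ← starAddEquiv_apply, map_sw] at h3
    simpa [h1] using h3
  have h4 := congrArg (counit (R := ℂ)) h2
  rw [map_sw] at h4
  have h5 : e a = counit (R := ℂ) a := by
    rw [← h4, ← counit_right e a]
    exact sw_congr _ fun x y => by simp [mul_comm]
  rw [← h5, h1, star_star]

/-- This is the image under the star of S(a₁)a₂ = ε(a); the star reverses the factors but not the
tensor legs, hence the opposite order of the indices. -/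
theorem mul_antipodeInv_sw (hStar : IsHopfStar A) (a : A) :
    (sw (comul (R := ℂ) a) fun x y => y * antipodeInv A x) = counit (R := ℂ) a • (1 : A) := by
  have h := congrArg star ((sw_comul_star hStar
    (isBilin_mul (f := antipode ℂ) (g := LinearMap.id)) a).symm.trans (antipode_mul_sw (star a)))
  rw [counit_star hStar, star_smul, star_star, star_one] at h
  rw [← h, ← starAddEquiv_apply, map_sw]
  refine sw_congr _ fun x y => ?_
  simp [antipodeInv_apply]

theorem antipodeInv_mul_sw (hStar : IsHopfStar A) (a : A) :
    (sw (comul (R := ℂ) a) fun x y => antipodeInv A y * x) = counit (R := ℂ) a • (1 : A) := by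
  have h := congrArg star ((sw_comul_star hStar
    (isBilin_mul (f := LinearMap.id) (g := antipode ℂ)) a).symm.trans (mul_antipode_sw (star a)))
  rw [counit_star hStar, star_smul, star_star, star_one] at h
  rw [← h, ← starAddEquiv_apply, map_sw]
  refine sw_congr _ fun x y => ?_
  simp [antipodeInv_apply]

/-- Applying S to a₂S⁻¹(a₁) = ε(a) shows that the composite is a left convolution inverse of S. The
identity is a right one, and the two coincide. -/
theorem antipode_antipodeInv (hStar : IsHopfStar A) (a : A) :
    antipode ℂ (antipodeInv A a) = a := by
  have h : WithConv.toConv (antipode ℂ ∘ₗ antipodeInv A) *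
      WithConv.toConv (antipode ℂ (A := A)) = 1 := by
    ext a
    rw [LinearMap.convMul_apply, LinearMap.convOne_apply, ← sw_mk (comul (R := ℂ) a), map_sw, map_sw,
      Algebra.algebraMap_eq_smul_one]
    have := congrArg (antipode ℂ) (mul_antipodeInv_sw hStar a)
    rw [map_sw, map_smul, antipode_one] at this
    simpa [antipode_mul_antidistrib] using this
  have := left_inv_eq_right_inv h (LinearMap.antipode_mul_id (R := ℂ) (C := A))
  exact congrArg (fun f => f.ofConv a) this

theorem antipodeInv_antipode (hStar : IsHopfStar A) (a : A) :
    antipodeInv A (antipode ℂ a) = a := by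
  have := congrArg star (antipode_antipodeInv hStar (star a))
  simpa [antipodeInv_apply] using this

theorem comul_antipodeInv (hStar : IsHopfStar A) (a : A) :
    comul (R := ℂ) (antipodeInv A a) = TensorProduct.map (antipodeInv A) (antipodeInv A)
      (TensorProduct.comm ℂ A A (comul (R := ℂ) a)) := by
  rw [antipodeInv_apply, hStar, comul_antipode, hStar]
  induction comul (R := ℂ) a with
  | zero => simp
  | add u v hu hv => simp only [star_add, map_add, hu, hv]
  | tmul x y => simp [antipodeInv_apply]

theorem sw_comul_antipodeInv (hStar : IsHopfStar A) {M : Type*} [AddCommGroup M] [Module ℂ M]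
    {f : A → A → M} (hf : IsBilin f) (a : A) :
    sw (comul (R := ℂ) (antipodeInv A a)) f =
      sw (comul (R := ℂ) a) fun x y => f (antipodeInv A y) (antipodeInv A x) := by
  have h : IsBilin fun x y => f (antipodeInv A x) (antipodeInv A y) := by
    constructor <;> intros <;> simp [hf.add_left, hf.smul_left, hf.add_right, hf.smul_right]
  rw [comul_antipodeInv hStar, sw_map hf, sw_comm_map h]

end Antipode

/-! ### The Haar functional -/

section Haar
variable {A : Type u} [Ring A] [HopfAlgebra ℂ A]

theorem IsHaar.left {h : A →ₗ[ℂ] ℂ} (hh : IsHaar h) (a : A) :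
    (sw (comul (R := ℂ) a) fun x y => h y • x) = h a • (1 : A) := by
  rw [← hh.left_inv, ← sw_mk (comul (R := ℂ) a), map_sw, map_sw, sw_mk]
  rfl

theorem IsHaar.right {h : A →ₗ[ℂ] ℂ} (hh : IsHaar h) (a : A) :
    (sw (comul (R := ℂ) a) fun x y => h x • y) = h a • (1 : A) := by
  rw [← hh.right_inv, ← sw_mk (comul (R := ℂ) a), map_sw, map_sw, sw_mk]
  rfl

/-- Evaluate k(a₁)h(a₂) in two ways: invariance of h gives h(a)k(1), invariance of k gives k(a)h(1).
-/
theorem eq_of_left_of_right {h k : A →ₗ[ℂ] ℂ} (h1 : h 1 = 1) (k1 : k 1 = 1)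
    (hl : ∀ a, (sw (comul (R := ℂ) a) fun x y => h y • x) = h a • (1 : A))
    (kr : ∀ a, (sw (comul (R := ℂ) a) fun x y => k x • y) = k a • (1 : A)) : h = k := by
  ext a
  have e1 := congrArg k (hl a)
  have e2 := congrArg h (kr a)
  rw [map_sw, map_smul, k1] at e1
  rw [map_sw, map_smul, h1] at e2
  simp only [map_smul, smul_eq_mul, mul_one] at e1 e2
  rw [← e1, ← e2]
  exact sw_congr _ fun x y => mul_comm _ _

theorem isCoaction_comul : IsCoaction (comul (R := ℂ) (A := A)) :=
  ⟨fun v => Coalgebra.coassoc_apply v, fun v => by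
    rw [Coalgebra.lTensor_counit_comul]; simp⟩

/-- A nonzero vector of a direct sum has a nonzero component in some summand. By induction over
finitely many summands containing it: if the vector also lies in the sum of the other summands, its
W-component is zero by independence and W can be dropped. -/
theorem exists_notMem_sSup_sdiff {E : Type*} [AddCommGroup E] [Module ℂ E] {s : Set (Submodule ℂ E)}
    (hs : sSupIndep s) {x : E} (hx : x ≠ 0) (hxs : x ∈ sSup s) : ∃ W ∈ s, x ∉ sSup (s \ {W}) := by
  classical
  obtain ⟨t, hts, hxt⟩ := Submodule.mem_sSup_iff_exists_finset.1 hxs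
  induction t using Finset.induction with
  | empty => simp [hx] at hxt
  | insert W t hW ih =>
    have hWs : W ∈ s := hts (by simp)
    have hts' : (t : Set (Submodule ℂ E)) ⊆ s := fun U hU => hts (by simp [Finset.mem_coe.1 hU])
    by_cases h : x ∈ sSup (s \ {W})
    · rw [Finset.iSup_insert] at hxt
      obtain ⟨w, hw, y, hy, rfl⟩ := Submodule.mem_sup.1 hxt
      have hle : ⨆ U ∈ t, U ≤ sSup (s \ {W}) := iSup₂_le fun U hU =>
        le_sSup ⟨hts' hU, fun h => hW (h ▸ hU)⟩
      have hw' : w ∈ sSup (s \ {W}) := by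
        simpa using sub_mem h (hle hy)
      have hw0 : w = 0 := by
        simpa using (hs hWs).le_bot (Submodule.mem_inf.2 ⟨hw, hw'⟩)
      exact ih hts' (by simpa [hw0] using hy)
    · exact ⟨W, hWs, h⟩

theorem IsSubcomodule.sSup {V : Type*} [AddCommGroup V] [Module ℂ V] {δ : V →ₗ[ℂ] V ⊗[ℂ] A}
    {s : Set (Submodule ℂ V)} (hs : ∀ W ∈ s, IsSubcomodule δ W) : IsSubcomodule δ (sSup s) := by
  suffices h : SupSet.sSup s ≤
      (LinearMap.range ((SupSet.sSup s).subtype.rTensor A)).comap δ from h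
  refine sSup_le fun W hW w hw => ?_
  obtain ⟨z, hz⟩ := hs W hW w hw
  refine ⟨(Submodule.inclusion (le_sSup hW)).rTensor A z, ?_⟩
  rw [← LinearMap.comp_apply, ← LinearMap.rTensor_comp, ← hz]
  rfl

/-- The functional is the coefficient of a comodule projection onto a one-dimensional summand of A
on which 1 has a nonzero component. -/
theorem exists_right_haar (hA : IsCosemisimple A) : ∃ h : A →ₗ[ℂ] ℂ, h 1 = 1 ∧
    ∀ a, (sw (comul (R := ℂ) a) fun x y => h x • y) = h a • (1 : A) := by
  obtain ⟨s, hs, hind, htop⟩ := hA A comul isCoaction_comul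
  have h10 : (1 : A) ≠ 0 := fun h => by
    simpa using congrArg (counit (R := ℂ)) h
  obtain ⟨W, hWs, h1⟩ := exists_notMem_sSup_sdiff hind h10 (by rw [htop]; trivial)
  have hc : IsCompl W (sSup (s \ {W})) :=
    ⟨hind hWs, codisjoint_iff_le_sup.2 <| by
      rw [← htop]
      refine sSup_le fun U hU => ?_
      by_cases h : U = W
      · exact h ▸ le_sup_left
      · exact le_sup_of_le_right (le_sSup ⟨hU, h⟩)⟩
  have hW' : IsSubcomodule (comul (R := ℂ) (A := A)) (sSup (s \ {W})) :=
    IsSubcomodule.sSup fun U hU => (hs U hU.1).1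
  obtain ⟨hW, hW0, hmin⟩ := hs W hWs
  generalize sSup (s \ {W}) = W' at *
  let π : A →ₗ[ℂ] A := W.projection W' hc
  have hπ1 : ∀ x ∈ W, π x = x := fun x hx => Submodule.projection_apply_of_mem_left hc hx
  have hπ2 : ∀ x ∈ W', π x = 0 := fun x hx => Submodule.projection_apply_of_mem_right hc hx
  -- The complement is a subcomodule too, so the projection is a comodule map.
  have hπ : ∀ a, comul (R := ℂ) (π a) = π.rTensor A (comul (R := ℂ) a) := by
    intro a
    obtain ⟨w, hw, w', hw', rfl⟩ := Submodule.mem_sup.1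
      (show a ∈ W ⊔ W' by rw [hc.sup_eq_top]; trivial)
    obtain ⟨z, hz⟩ := hW w hw
    obtain ⟨z', hz'⟩ := hW' w' hw'
    rw [map_add, hπ1 w hw, hπ2 w' hw', add_zero, map_add, map_add, ← hz, ← hz', ← LinearMap.comp_apply,
      ← LinearMap.comp_apply, ← LinearMap.rTensor_comp, ← LinearMap.rTensor_comp,
      show π ∘ₗ W.subtype = W.subtype from LinearMap.ext fun x => hπ1 x x.2,
      show π ∘ₗ W'.subtype = 0 from LinearMap.ext fun x => hπ2 x x.2]
    simp
  have hu : π 1 ≠ 0 := fun h => h1 ((Submodule.projection_apply_eq_zero_iff hc).1 h)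
  have hδu : comul (R := ℂ) (π 1) = π 1 ⊗ₜ 1 := by
    rw [hπ, Bialgebra.comul_one, Algebra.TensorProduct.one_def, LinearMap.rTensor_tmul]
  -- By `hδu` the line through π(1) is a nonzero subcomodule of the simple comodule W.
  have huW : Submodule.span ℂ {π 1} = W := by
    refine (hmin _ ?_ ?_).resolve_left ?_
    · rw [Submodule.span_singleton_le_iff_mem]
      exact Submodule.projection_apply_mem hc 1
    · intro x hx
      obtain ⟨c, rfl⟩ := Submodule.mem_span_singleton.1 hx
      refine ⟨c • (⟨π 1, Submodule.mem_span_singleton_self _⟩ ⊗ₜ 1), ?_⟩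
      rw [map_smul, map_smul, hδu]
      rfl
    · simpa using hu
  obtain ⟨k, hk⟩ := Module.Projective.exists_dual_ne_zero ℂ hu
  -- Normalised so that π(a) = h(a)π(1); applying k to the first leg of Δ(π(a)) = π(a₁) ⊗ a₂ then
  -- gives invariance.
  let h : A →ₗ[ℂ] ℂ := (k (π 1))⁻¹ • (k ∘ₗ π)
  have hh : ∀ a, π a = h a • π 1 := by
    intro a
    obtain ⟨c, hc⟩ := Submodule.mem_span_singleton.1
      (huW.symm ▸ Submodule.projection_apply_mem hc a : π a ∈ Submodule.span ℂ {π 1})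
    have : h a = c := by
      simp only [h, LinearMap.smul_apply, LinearMap.comp_apply, ← hc, map_smul, smul_eq_mul]
      field_simp
    rw [this, hc]
  refine ⟨h, ?_, fun a => ?_⟩
  · simp [h, hk]
  · have e : ∀ w : A ⊗[ℂ] A, (sw w fun x y => h x • y) =
        TensorProduct.lid ℂ A (((k (π 1))⁻¹ • k).rTensor A (π.rTensor A w)) := by
      intro w
      conv_rhs => rw [← sw_mk w, map_sw, map_sw, map_sw]
      exact sw_congr _ fun x y => by simp [h, mul_smul]
    have hδ : comul (R := ℂ) (π a) = h a • (π 1 ⊗ₜ 1) := by rw [hh a, map_smul, hδu]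
    rw [e, ← hπ, hδ, map_smul]
    simp [hk]

/-- The antipode reverses Δ, so h∘S is left-invariant whenever h is right-invariant;
`eq_of_left_of_right` identifies h∘S with h, which is therefore invariant on both sides. -/
theorem exists_isHaar [StarRing A] [StarModule ℂ A] (hStar : IsHopfStar A) (hA : IsCosemisimple A) :
    ∃ h : A →ₗ[ℂ] ℂ, IsHaar h := by
  obtain ⟨h, h1, hr⟩ := exists_right_haar hA
  have hl : ∀ a, (sw (comul (R := ℂ) a) fun x y => (h ∘ₗ antipode ℂ) y • x) =
      (h ∘ₗ antipode ℂ) a • (1 : A) := by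
    intro a
    have e := congrArg (antipodeInv A) (hr (antipode ℂ a))
    have hb : IsBilin fun x y : A => h x • y := isBilin_smul h LinearMap.id
    rw [sw_comul_antipode hb, map_sw, map_smul, antipodeInv_one] at e
    simpa [antipodeInv_antipode hStar] using e
  have e : h ∘ₗ antipode ℂ = h := eq_of_left_of_right (by simp [h1]) h1 hl hr
  rw [e] at hl
  refine ⟨h, h1, fun a => ?_, fun a => ?_⟩
  · rw [← hl, ← sw_mk (comul (R := ℂ) a), map_sw, map_sw, sw_mk]
    rfl
  · rw [← hr, ← sw_mk (comul (R := ℂ) a), map_sw, map_sw, sw_mk]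
    rfl

/-- The functional a ↦ conj h(a*) is again normalised and right-invariant, hence equals h. -/
theorem IsHaar.map_star [StarRing A] [StarModule ℂ A] (hStar : IsHopfStar A) {h : A →ₗ[ℂ] ℂ}
    (hh : IsHaar h) (a : A) : h (star a) = star (h a) := by
  let k : A →ₗ[ℂ] ℂ :=
    { toFun := fun a => star (h (star a))
      map_add' := by simp
      map_smul' := by simp }
  have hk : h = k := by
    refine eq_of_left_of_right hh.map_one (by simp [k, hh.map_one]) hh.left fun a => ?_
    have e := congrArg star ((sw_comul_star hStar (isBilin_smul h LinearMap.id) a).symm.trans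
      (hh.right (star a)))
    rw [← starAddEquiv_apply, map_sw] at e
    simpa [k] using e
  rw [show h a = star (h (star a)) from LinearMap.congr_fun hk a, star_star]

end Haar

/-! ### The modular automorphism -/

section Modular
variable {A : Type u} [Ring A] [HopfAlgebra ℂ A] [StarRing A] [StarModule ℂ A] {h : A →ₗ[ℂ] ℂ}

/-- Invariance gives h(bc₂)1 = b₁c₂h(b₂c₃); multiplied on the right by S⁻¹(c₁), the product
c₂S⁻¹(c₁) collapses to the counit. -/
theorem IsHaar.strong_left (hStar : IsHopfStar A) (hh : IsHaar h) (b c : A) :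
    (sw (comul (R := ℂ) b) fun x y => h (y * c) • x) =
      sw (comul (R := ℂ) c) fun p q => h (b * q) • antipodeInv A p := by
  have hb : IsBilin fun x y : A => h y • x := isBilin_smul_flip h LinearMap.id
  have e1 : ∀ p q, h (b * q) • antipodeInv A p = sw (comul (R := ℂ) b) fun x y =>
      sw (comul (R := ℂ) q) fun q₁ q₂ => h (y * q₂) • (x * q₁ * antipodeInv A p) := by
    intro p q
    have := congrArg (· * antipodeInv A p) (hh.left (b * q))
    simp only [Bialgebra.comul_mul, sw_mul hb, sw_mul_right, smul_mul_assoc, one_mul] at this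
    exact this.symm
  have e2 : ∀ x y, (sw (comul (R := ℂ) c) fun p q => sw (comul (R := ℂ) q) fun q₁ q₂ =>
      h (y * q₂) • (x * q₁ * antipodeInv A p)) = h (y * c) • x := by
    intro x y
    have ht : IsTrilin fun p q₁ q₂ : A => h (y * q₂) • (x * q₁ * antipodeInv A p) := by
      refine ⟨fun _ => ?_, ?_, ?_⟩ <;> try constructor
      all_goals intros; simp [mul_add, add_mul, add_smul, mul_smul]
      all_goals exact smul_comm _ _ _
    rw [← comul_assoc ht]
    have := counit_left ((h ∘ₗ LinearMap.mulLeft ℂ y).smulRight x) c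
    simp only [LinearMap.smulRight_apply, LinearMap.comp_apply, LinearMap.mulLeft_apply] at this
    rw [← this]
    refine sw_congr _ fun p q => ?_
    rw [← sw_smul_apply]
    simp only [mul_assoc]
    rw [← sw_mul_left, mul_antipodeInv_sw hStar, mul_smul_comm, mul_one, smul_comm]
  rw [sw_congr _ e1, sw_comm]
  exact (sw_congr _ e2).symm

/-- The mirror image of `IsHaar.strong_left`: right invariance for a₁b, together with S⁻¹(a₂)a₁ =
ε(a). -/
theorem IsHaar.strong_right (hStar : IsHopfStar A) (hh : IsHaar h) (a b : A) :
    (sw (comul (R := ℂ) b) fun x y => h (a * x) • y) =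
      sw (comul (R := ℂ) a) fun p q => h (p * b) • antipodeInv A q := by
  have hb : IsBilin fun x y : A => h x • y := isBilin_smul h LinearMap.id
  have e1 : ∀ p q, h (p * b) • antipodeInv A q = sw (comul (R := ℂ) b) fun x y =>
      sw (comul (R := ℂ) p) fun p₁ p₂ => h (p₁ * x) • (antipodeInv A q * (p₂ * y)) := by
    intro p q
    have := congrArg (antipodeInv A q * ·) (hh.right (p * b))
    simp only [Bialgebra.comul_mul, sw_mul hb, sw_mul_left, mul_smul_comm, mul_one] at this
    rw [← this, sw_comm]
  have e2 : ∀ x y, (sw (comul (R := ℂ) a) fun p q => sw (comul (R := ℂ) p) fun p₁ p₂ =>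
      h (p₁ * x) • (antipodeInv A q * (p₂ * y))) = h (a * x) • y := by
    intro x y
    have ht : IsTrilin fun p₁ p₂ q : A => h (p₁ * x) • (antipodeInv A q * (p₂ * y)) := by
      refine ⟨fun _ => ?_, ?_, ?_⟩ <;> try constructor
      all_goals intros; simp [mul_add, add_mul, add_smul, mul_smul]
      all_goals exact smul_comm _ _ _
    rw [comul_assoc ht]
    have := counit_right ((h ∘ₗ LinearMap.mulRight ℂ x).smulRight y) a
    simp only [LinearMap.smulRight_apply, LinearMap.comp_apply, LinearMap.mulRight_apply] at this
    rw [← this]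
    refine sw_congr _ fun p q => ?_
    rw [← sw_smul_apply]
    simp only [← mul_assoc]
    rw [← sw_mul_right, antipodeInv_mul_sw hStar, smul_mul_assoc, one_mul, smul_comm]
  rw [sw_congr _ e1, sw_comm]
  exact (sw_congr _ e2).symm

/-- The form `h(ab)` is non-degenerate. -/
theorem IsHaar.eq_zero (hStar : IsHopfStar A) (hh : IsHaar h) (a : A) (ha : ∀ b, h (a * b) = 0) :
    a = 0 := by
  let Φ : A →ₗ[ℂ] Module.Dual ℂ A := (LinearMap.mul ℂ A).compr₂ h
  have hΦ : ∀ x y, Φ x y = h (x * y) := fun _ _ => rfl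
  have h1 : ∀ a, (∀ b, h (a * b) = 0) → ∀ c, (sw (comul (R := ℂ) a) fun x y => h (y * c) • x) = 0 := by
    intro a ha c
    rw [hh.strong_left hStar, sw_congr _ fun p q => by rw [ha, zero_smul]]
    exact Finset.sum_const_zero
  -- Vanishing of a₁h(a₂c) for every c means that a₁ ⊗ h(a₂ ·) is zero as a tensor. It may then be
  -- evaluated at the varying argument c = S⁻¹(a₁), which yields h(a₂S⁻¹(a₁)) = ε(a).
  have h2 : ∀ a, (∀ b, h (a * b) = 0) → counit (R := ℂ) a = 0 := by
    intro a ha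
    have hw : (TensorProduct.comm ℂ A _ (Φ.lTensor A (comul (R := ℂ) a))) = 0 := by
      refine dual_sep _ fun f => ?_
      apply (TensorProduct.rid ℂ _).injective
      rw [← sw_mk (comul (R := ℂ) a)]
      simp only [map_sw, map_zero]
      ext c
      have := congrArg f (h1 a ha c)
      rw [map_sw, map_zero] at this
      simp only [map_smul] at this
      rw [← LinearMap.applyₗ_apply_apply c, map_sw, LinearMap.zero_apply, ← this]
      exact sw_congr _ fun x y => by simp [hΦ, mul_comm]
    rw [LinearEquiv.map_eq_zero_iff] at hw
    have h4 := congrArg h (mul_antipodeInv_sw hStar a)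
    rw [map_smul, hh.map_one, smul_eq_mul, mul_one, map_sw] at h4
    have h5 := congrArg (TensorProduct.lift (LinearMap.id.compl₁₂ (LinearMap.applyₗ ∘ₗ antipodeInv A)
      LinearMap.id)) hw
    rw [← sw_mk (comul (R := ℂ) a), map_sw, map_sw, map_zero] at h5
    rw [← h4, ← h5]
    rfl
  rw [← Module.forall_dual_apply_eq_zero_iff ℂ]
  intro f
  -- The element f(a₁)a₂ again lies in the left kernel, and its counit is f(a).
  have h3 := h2 (sw (comul (R := ℂ) a) fun x y => f x • y) fun c => by
    have := congrArg f (h1 a ha c)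
    rw [map_sw, map_zero] at this
    rw [sw_mul_right, map_sw, ← this]
    exact sw_congr _ fun x y => by simp [mul_comm]
  rw [map_sw] at h3
  rw [← counit_right f a, ← h3]
  exact sw_congr _ fun x y => by simp [mul_comm]

theorem IsHaar.eq_zero' (hStar : IsHopfStar A) (hh : IsHaar h) (a : A) (ha : ∀ b, h (b * a) = 0) :
    a = 0 := by
  have := hh.eq_zero hStar (star a) fun b => by
    rw [← star_star b, ← star_mul, hh.map_star hStar, ha, star_zero]
  exact star_eq_zero.1 this

/-! ### Explicit formula for the modular automorphism -/

/-- The functional `a ↦ h(a₁ S⁻³(a₂))`. -/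
def modularFunctional (h : A →ₗ[ℂ] ℂ) : A →ₗ[ℂ] ℂ :=
  h ∘ₗ TensorProduct.lift ((LinearMap.mul ℂ A).compl₁₂ LinearMap.id
    (antipodeInv A ∘ₗ antipodeInv A ∘ₗ antipodeInv A)) ∘ₗ comul

theorem modularFunctional_apply (h : A →ₗ[ℂ] ℂ) (a : A) : modularFunctional h a =
    sw (comul (R := ℂ) a) fun x y => h (x * antipodeInv A (antipodeInv A (antipodeInv A y))) := by
  rw [modularFunctional, LinearMap.comp_apply, LinearMap.comp_apply, ← sw_mk (comul (R := ℂ) a),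
    map_sw, map_sw, sw_mk]
  rfl

/-- The modular automorphism `a ↦ χ(a₁) S⁻²(a₂)`, where `χ` is the modular functional. -/
def modular (h : A →ₗ[ℂ] ℂ) : A →ₗ[ℂ] A :=
  TensorProduct.lift ((LinearMap.lsmul ℂ A).compl₁₂ (modularFunctional h)
    (antipodeInv A ∘ₗ antipodeInv A)) ∘ₗ comul

theorem modular_apply (h : A →ₗ[ℂ] ℂ) (a : A) : modular h a =
    sw (comul (R := ℂ) a) fun x y => modularFunctional h x • antipodeInv A (antipodeInv A y) := by
  rw [modular, LinearMap.comp_apply, ← sw_mk (comul (R := ℂ) a), map_sw, sw_mk]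
  rfl

theorem antipodeSq_modular (hStar : IsHopfStar A) (h : A →ₗ[ℂ] ℂ) (a : A) :
    antipodeSq A (modular h a) = sw (comul (R := ℂ) a) fun x y => modularFunctional h x • y := by
  rw [modular_apply, map_sw]
  refine sw_congr _ fun x y => ?_
  rw [map_smul]
  change _ • antipode ℂ (antipode ℂ _) = _
  rw [antipode_antipodeInv hStar, antipode_antipodeInv hStar]

/-- The two strong invariance identities are combined into `key` and specialised so that one side
collapses to h(ab). -/
theorem IsHaar.modular_spec (hStar : IsHopfStar A) (hh : IsHaar h) (a b : A) :
    h (a * b) = h (b * modular h a) := by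
  let T := antipodeInv A
  -- Both sides equal h(ab₁)h(b₂c), computed by moving one of the two coproducts of b at a time.
  have key : ∀ a c, (sw (comul (R := ℂ) c) fun p q => h (a * T p) • h (b * q)) =
      sw (comul (R := ℂ) a) fun p q => h (p * b) • h (T q * c) := by
    intro a c
    have h1 := congrArg (fun x => h (a * x)) (hh.strong_left hStar b c)
    have h2 := congrArg (fun x => h (x * c)) (hh.strong_right hStar a b)
    simp only [sw_mul_left, sw_mul_right, map_sw, mul_smul_comm, smul_mul_assoc, map_smul] at h1 h2
    rw [← h2]
    simp only [smul_eq_mul] at h1 ⊢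
    simp only [T, mul_comm (h (a * _))]
    rw [← h1]
  have hT : ∀ x c : A, (fun y => sw (comul (R := ℂ) (T (T y))) fun p q => h (x * T p) • h (b * q)) =
      fun y => sw (comul (R := ℂ) y) fun p q => h (x * T (T (T p))) • h (b * T (T q)) := by
    intro x c
    ext y
    rw [sw_comul_antipodeInv hStar, sw_comul_antipodeInv hStar]
    all_goals constructor <;> intros <;> simp [T, mul_add, add_mul, mul_left_comm, mul_assoc]
  -- The identity is used with a replaced by a₁ and c by S⁻²(a₂). Since S⁻² preserves the order of
  -- the legs, the left side becomes h(a₁S⁻³(a₂))h(bS⁻²(a₃)).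
  have e1 := sw_congr (comul (R := ℂ) a) fun x y => key x (T (T y))
  have ht1 : IsTrilin fun x p q : A => h (x * T (T (T p))) • h (b * T (T q)) := by
    refine ⟨fun _ => ?_, ?_, ?_⟩ <;> try constructor
    all_goals intros; simp [mul_add, add_mul, mul_left_comm, mul_assoc]
  have ht2 : IsTrilin fun x p q : A => h (x * b) • h (T p * T (T q)) := by
    refine ⟨fun _ => ?_, ?_, ?_⟩ <;> try constructor
    all_goals intros; simp [mul_add, add_mul, mul_left_comm, mul_assoc]
  rw [sw_congr _ fun x y => congrFun (hT x y) y, ← comul_assoc ht1, comul_assoc ht2] at e1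
  have e2 : (sw (comul (R := ℂ) a) fun x y => sw (comul (R := ℂ) x) fun p q =>
      h (p * T (T (T q))) • h (b * T (T y))) = h (b * modular h a) := by
    rw [modular_apply, sw_mul_left, map_sw]
    refine sw_congr _ fun x y => ?_
    rw [mul_smul_comm, map_smul, modularFunctional_apply, smul_eq_mul, sw_mul_right]
    rfl
  -- Here S⁻¹(p)S⁻²(q) = S⁻¹(S⁻¹(q)p), and S⁻¹(q)p sums to the counit.
  have e3 : (sw (comul (R := ℂ) a) fun x y => sw (comul (R := ℂ) y) fun p q =>
      h (x * b) • h (T p * T (T q))) = h (a * b) := by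
    have := counit_right (h ∘ₗ LinearMap.mulRight ℂ b) a
    simp only [LinearMap.comp_apply, LinearMap.mulRight_apply] at this
    rw [← this]
    refine sw_congr _ fun x y => ?_
    have e4 := congrArg (fun z => h (T z)) (antipodeInv_mul_sw hStar y)
    simp only [map_sw, map_smul, T, antipodeInv_one, hh.map_one, antipodeInv_mul] at e4
    rw [← sw_smul_apply, e4]
    simp [mul_comm]
  rw [← e2, ← e3, e1]

/-- Moving a and b cyclically one at a time gives h(cρ(ab)) = h(abc) = h(cρ(a)ρ(b)); non-degeneracy
of h removes c. -/
theorem IsHaar.modular_mul (hStar : IsHopfStar A) (hh : IsHaar h) (a b : A) :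
    modular h (a * b) = modular h a * modular h b := by
  rw [← sub_eq_zero]
  refine hh.eq_zero' hStar _ fun c => ?_
  rw [mul_sub, map_sub, ← hh.modular_spec hStar, ← mul_assoc, ← hh.modular_spec hStar, mul_assoc,
    hh.modular_spec hStar a, mul_assoc, sub_self]

theorem IsHaar.modular_one (hStar : IsHopfStar A) (hh : IsHaar h) : modular h 1 = 1 := by
  rw [← sub_eq_zero]
  refine hh.eq_zero' hStar _ fun b => ?_
  rw [mul_sub, map_sub, ← hh.modular_spec hStar, one_mul, mul_one, sub_self]

/-- Hermiticity of h shows that the modular map conjugated by the star is its inverse. This gives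
both the bijectivity of ρ and the involutivity of a ↦ ρ(a)*. -/
theorem IsHaar.star_modular_star (hStar : IsHopfStar A) (hh : IsHaar h) (a : A) :
    star (modular h (star (modular h a))) = a := by
  rw [← star_inj, star_star, ← sub_eq_zero]
  refine hh.eq_zero' hStar _ fun b => ?_
  rw [mul_sub, map_sub, ← hh.modular_spec hStar, ← star_star b, ← star_mul, ← star_mul,
    hh.map_star hStar, hh.map_star hStar, ← hh.modular_spec hStar, sub_self]

/-- The modular automorphism as an algebra automorphism. -/
def IsHaar.modularEquiv (hStar : IsHopfStar A) (hh : IsHaar h) : A ≃ₐ[ℂ] A :=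
  AlgEquiv.ofBijective
    (AlgHom.ofLinearMap (modular h) (hh.modular_one hStar) (hh.modular_mul hStar))
    ⟨fun a b hab => by
      rw [← hh.star_modular_star hStar a, ← hh.star_modular_star hStar b]
      exact congrArg (fun x => star (modular h (star x))) hab,
    fun a => ⟨star (modular h (star a)), by
      have := hh.star_modular_star hStar (star a)
      exact star_injective this⟩⟩

theorem IsHaar.modularEquiv_apply (hStar : IsHopfStar A) (hh : IsHaar h) (a : A) :
    hh.modularEquiv hStar a = modular h a := rfl

/-- The modular functional as a character. -/
def IsHaar.modularChar (hStar : IsHopfStar A) (hh : IsHaar h) : A →ₐ[ℂ] ℂ :=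
  (Bialgebra.counitAlgHom ℂ A).comp (hh.modularEquiv hStar)

theorem counit_antipodeInv (hStar : IsHopfStar A) (a : A) :
    counit (R := ℂ) (antipodeInv A a) = counit (R := ℂ) a := by
  rw [antipodeInv_apply, counit_star hStar, counit_antipode, counit_star hStar, star_star]

theorem IsHaar.modularChar_apply (hStar : IsHopfStar A) (hh : IsHaar h) (a : A) :
    hh.modularChar hStar a = modularFunctional h a := by
  change counit (R := ℂ) (modular h a) = _
  rw [modular_apply, map_sw, ← counit_right (modularFunctional h) a]
  refine sw_congr _ fun x y => ?_
  rw [map_smul, counit_antipodeInv hStar, counit_antipodeInv hStar, smul_eq_mul, smul_eq_mul, mul_comm]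

/-- Up to S², the modular automorphism is the translation by a character; such a translation extends
to all of Cl through the coaction. -/
theorem IsHaar.antipodeSq_modularEquiv (hStar : IsHopfStar A) (hh : IsHaar h) (a : A) :
    antipodeSq A (hh.modularEquiv hStar a) =
      sw (comul (R := ℂ) a) fun x y => hh.modularChar hStar x • y := by
  rw [hh.modularEquiv_apply, antipodeSq_modular hStar]
  exact sw_congr _ fun x y => by rw [hh.modularChar_apply]

end Modular

/-! ### Left-invariant one-forms -/

/-- Conjugating S² by the star gives S⁻². -/
theorem antipodeSq_star_antipodeSq_star {A : Type u} [Ring A] [HopfAlgebra ℂ A] [StarRing A]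
    [StarModule ℂ A] (hStar : IsHopfStar A) (a : A) :
    antipodeSq A (star (antipodeSq A (star a))) = a := by
  have h : star (antipodeSq A (star a)) = antipodeInv A (antipodeInv A a) := by
    simp only [antipodeInv_apply, star_star]
    rfl
  rw [h]
  change antipode ℂ (antipode ℂ _) = a
  rw [antipode_antipodeInv hStar, antipode_antipodeInv hStar]

namespace StarCalculus
variable {A : Type u} [Ring A] [HopfAlgebra ℂ A]
  {Γ : Type v} [AddCommGroup Γ] [Module ℂ Γ] [Module A Γ] [Module Aᵐᵒᵖ Γ]
  [SMulCommClass A Aᵐᵒᵖ Γ] [IsScalarTower ℂ A Γ] [IsScalarTower ℂ Aᵐᵒᵖ Γ]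
  [StarRing A] [StarModule ℂ A] [StarAddMonoid Γ] [StarModule ℂ Γ]
  (C : StarCalculus A Γ)

theorem mem_inv {C : StarCalculus A Γ} {θ : Γ} : θ ∈ C.inv ↔ C.coact θ = 1 ⊗ₜ θ := Iff.rfl

theorem mc_apply (a : A) :
    C.mc a = sw (comul (R := ℂ) a) fun x y => antipode ℂ x • C.d y := by
  rw [mc, LinearMap.comp_apply, ← sw_mk (comul (R := ℂ) a), map_sw, sw_mk]
  rfl

theorem coact_smul_d (a b : A) : C.coact (a • C.d b) =
    sw (comul (R := ℂ) b) fun r s => sw (comul (R := ℂ) a) fun p q => (p * r) ⊗ₜ (q • C.d s) := by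
  rw [C.coact_smul, C.coact_d]
  conv_lhs => rw [← sw_mk (comul (R := ℂ) a), ← sw_mk (comul (R := ℂ) b), map_sw, map_sw, map_sw]
  refine sw_congr _ fun r s => ?_
  rw [LinearMap.lTensor_tmul]
  exact map_sw (LinearMap.applyₗ (R := ℂ) (r ⊗ₜ[ℂ] C.d s)) (comul (R := ℂ) a) _

/-- In Sweedler notation Δ_L(S(a₁)da₂) = S(a₂)a₃ ⊗ S(a₁)da₄, and S(a₂)a₃ contracts to the counit. -/
theorem mc_mem_inv (a : A) : C.mc a ∈ C.inv := by
  rw [mem_inv, mc_apply, map_sw]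
  let E : A →ₗ[ℂ] A →ₗ[ℂ] Γ :=
    (Algebra.lsmul ℂ ℂ Γ).toLinearMap.compl₁₂ (antipode ℂ) C.d
  have hE : ∀ x y, antipode ℂ x • C.d y = E x y := fun _ _ => rfl
  let G : A → A → A → A → A ⊗[ℂ] Γ := fun p q r s => (antipode ℂ q * r) ⊗ₜ (E p s)
  have hG : ∀ p q, IsBilin (G p q) := by
    intro p q
    constructor <;> intros <;>
      simp [G, mul_add, TensorProduct.add_tmul, TensorProduct.tmul_add, TensorProduct.smul_tmul']
  have hG2 : ∀ r s, IsBilin fun p q => G p q r s := by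
    intro r s
    constructor <;> intros <;>
      simp [G, add_mul, TensorProduct.add_tmul, TensorProduct.tmul_add,
        TensorProduct.smul_tmul']
  have hG3 : ∀ p, IsTrilin (G p) := fun p =>
    ⟨fun q => hG p q, fun _ _ _ _ => (hG2 _ _).add_right _ _ _,
      fun _ _ _ _ => (hG2 _ _).smul_right _ _ _⟩
  have hF : IsTrilin fun p q y => sw (comul (R := ℂ) y) fun r s => G p q r s := by
    refine ⟨fun p => ⟨fun q q' y => ?_, fun c q y => ?_, fun q y y' => ?_, fun c q y => ?_⟩,
      fun p p' q y => ?_, fun c p q y => ?_⟩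
    · rw [← sw_add_apply]
      exact sw_congr _ fun r s => (hG2 r s).add_right _ _ _
    · rw [sw_smul_apply]
      exact sw_congr _ fun r s => (hG2 r s).smul_right _ _ _
    · rw [map_add, sw_add (hG p q)]
    · rw [map_smul, sw_smul (hG p q)]
    · rw [← sw_add_apply]
      exact sw_congr _ fun r s => (hG2 r s).add_left _ _ _
    · rw [sw_smul_apply]
      exact sw_congr _ fun r s => (hG2 r s).smul_left _ _ _
  have e1 : ∀ x y, C.coact (antipode ℂ x • C.d y) = sw (comul (R := ℂ) x) fun p q =>
      sw (comul (R := ℂ) y) fun r s => G p q r s := by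
    intro x y
    rw [coact_smul_d, sw_comm (comul (R := ℂ) x)]
    refine sw_congr (comul (R := ℂ) y) fun r s => ?_
    let L : A →ₗ[ℂ] A →ₗ[ℂ] Γ := (Algebra.lsmul ℂ ℂ Γ).toLinearMap.compl₁₂ LinearMap.id C.d
    have hL : IsBilin fun p q => (p * r) ⊗ₜ[ℂ] L q s := by
      constructor <;> intros <;>
        simp [add_mul, TensorProduct.add_tmul, TensorProduct.tmul_add, TensorProduct.smul_tmul']
    exact sw_comul_antipode hL x
  rw [sw_congr _ e1, comul_assoc hF]
  have e2 : ∀ x y, (sw (comul (R := ℂ) y) fun q z => sw (comul (R := ℂ) z) fun r s => G x q r s) =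
      1 ⊗ₜ (antipode ℂ x • C.d y) := by
    intro x y
    rw [← comul_assoc (hG3 x)]
    have := counit_left ((TensorProduct.mk ℂ A Γ 1).comp (E x)) y
    refine Eq.trans ?_ this
    refine sw_congr _ fun p q => ?_
    have := congrArg ((TensorProduct.mk ℂ A Γ).flip (E x q)) (antipode_mul_sw p)
    rw [map_sw, map_smul] at this
    exact this
  rw [sw_congr _ e2]
  exact (map_sw (TensorProduct.mk ℂ A Γ 1) _ _).symm

/-- One-forms are sums of forms `aθ` with left-invariant `θ`. -/
theorem smul_inv_induction {p : Γ → Prop} (hadd : ∀ x y, p x → p y → p (x + y))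
    (h : ∀ (a : A), ∀ θ ∈ C.inv, p (a • θ)) (γ : Γ) : p γ := by
  obtain ⟨z, rfl⟩ := C.adb_surjective γ
  rw [adb_eq]
  induction shear A z with
  | zero => simpa using h 0 0 C.inv.zero_mem
  | add u v hu hv => rw [map_add, map_add]; exact hadd _ _ hu hv
  | tmul a b => exact h a _ (C.mc_mem_inv b)

theorem smul_d_induction {p : Γ → Prop} (hadd : ∀ x y, p x → p y → p (x + y))
    (h : ∀ a b : A, p (a • C.d b)) (γ : Γ) : p γ := by
  obtain ⟨z, rfl⟩ := C.adb_surjective γ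
  induction z with
  | zero => simpa using h 0 0
  | add u v hu hv => rw [map_add]; exact hadd _ _ hu hv
  | tmul a b => exact h a b

theorem involution_smul_d (a b : A) : star (a • C.d b) = op (star a) • C.d (star b) := by
  rw [C.involution_smul, C.involution_d]

theorem coact_star (hStar : IsHopfStar A) (γ : Γ) : C.coact (star γ) = star (C.coact γ) := by
  induction γ using C.smul_d_induction with
  | hadd x y hx hy => rw [star_add, map_add, map_add, star_add, hx, hy]
  | h a b =>
    have h1 : ∀ w z : A ⊗[ℂ] A, actR A Γ (star w) (C.d.lTensor A (star z)) =
        star (actL A Γ w (C.d.lTensor A z)) := by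
      intro w z
      induction w with
      | zero => simp
      | add u v hu hv => simp only [star_add, map_add, LinearMap.add_apply, hu, hv]
      | tmul p q =>
        induction z with
        | zero => simp
        | add u v hu hv => simp only [star_add, map_add, hu, hv]
        | tmul r s => simp [actL, actR, involution_smul_d]
    rw [involution_smul_d, C.coact_op_smul, C.coact_smul, C.coact_d, C.coact_d, hStar, hStar, h1]

theorem star_mem_inv (hStar : IsHopfStar A) {θ : Γ} (hθ : θ ∈ C.inv) : star θ ∈ C.inv := by
  rw [mem_inv] at *
  rw [C.coact_star hStar, hθ, TensorProduct.star_tmul, star_one]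

/-- It suffices to check forms a db, where both sides are determined by the compatibility of Δ with
S²; as a consequence S² preserves left-invariance. -/
theorem coact_s2 (hC : C.IsS2Invariant) (γ : Γ) : C.coact (C.s2 hC γ) =
    TensorProduct.map (antipodeSq A).toLinearMap (C.s2 hC) (C.coact γ) := by
  obtain ⟨hl, -, hd⟩ := C.s2_spec hC
  induction γ using C.smul_d_induction with
  | hadd x y hx hy => simp only [map_add, hx, hy]
  | h a b =>
    rw [hl, hd, C.coact_smul, C.coact_smul, C.coact_d, C.coact_d, comul_antipodeSq, comul_antipodeSq]
    generalize comul (R := ℂ) a = w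
    generalize comul (R := ℂ) b = z
    induction w with
    | zero => simp
    | add u v hu hv => simp only [map_add, LinearMap.add_apply, hu, hv]
    | tmul p q =>
      induction z with
      | zero => simp
      | add u v hu hv => simp only [map_add, hu, hv]
      | tmul r s => simp [actL, hl, hd]

theorem s2_mem_inv (hC : C.IsS2Invariant) {θ : Γ} (hθ : θ ∈ C.inv) : C.s2 hC θ ∈ C.inv := by
  rw [mem_inv] at *
  rw [coact_s2, hθ, TensorProduct.map_tmul, AlgHom.toLinearMap_apply, map_one]

theorem s2_star_s2_star (hStar : IsHopfStar A) (hC : C.IsS2Invariant) (γ : Γ) :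
    C.s2 hC (star (C.s2 hC (star γ))) = γ := by
  obtain ⟨hl, hr, hd⟩ := C.s2_spec hC
  induction γ using C.smul_d_induction with
  | hadd x y hx hy => simp only [star_add, map_add, hx, hy]
  | h a b =>
    rw [involution_smul_d, hr, hd, C.involution_op_smul, C.involution_d, hl, hd,
      antipodeSq_star_antipodeSq_star hStar, antipodeSq_star_antipodeSq_star hStar]

end StarCalculus

/-! ### The tensor algebra and the Clifford algebra -/

section Clifford
open BimodTensor
variable {A : Type u} [Ring A] [HopfAlgebra ℂ A]
  {Γ : Type v} [AddCommGroup Γ] [Module ℂ Γ] [Module A Γ] [Module Aᵐᵒᵖ Γ]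
  [SMulCommClass A Aᵐᵒᵖ Γ] [IsScalarTower ℂ A Γ] [IsScalarTower ℂ Aᵐᵒᵖ Γ]
  [StarRing A] [StarModule ℂ A] [StarAddMonoid Γ] [StarModule ℂ Γ]
  {C : StarCalculus A Γ} {hC : C.IsS2Invariant}
  {σ : deg A Γ 2 ≃ₗ[ℂ] deg A Γ 2} {g : deg A Γ 2 →ₗ[ℂ] A}

theorem BimodTensor.mk_surjective : Function.Surjective (mk : TensorAlgebra ℂ (A × Γ) →ₐ[ℂ] _) :=
  fun x => Quotient.inductionOn' x fun y => ⟨y, rfl⟩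

theorem BimodTensor.adjoin_eq_top :
    Algebra.adjoin ℂ (Set.range (inl A Γ) ∪ Set.range (inr A Γ)) = ⊤ := by
  rw [eq_top_iff, ← (AlgHom.range_eq_top _).2 (mk_surjective (A := A) (Γ := Γ)),
    ← Algebra.map_top, ← TensorAlgebra.adjoin_range_ι, AlgHom.map_adjoin]
  refine Algebra.adjoin_le ?_
  rintro _ ⟨_, ⟨⟨a, γ⟩, rfl⟩, rfl⟩
  have e : mk (TensorAlgebra.ι ℂ (a, γ)) = inl A Γ a + inr A Γ γ := by
    rw [show (a, γ) = (a, 0) + (0, γ) by simp, map_add, map_add]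
    rfl
  rw [e]
  exact add_mem (Algebra.subset_adjoin (Or.inl ⟨a, rfl⟩)) (Algebra.subset_adjoin (Or.inr ⟨γ, rfl⟩))

theorem BimodTensor.tmul_induction {p : deg A Γ 2 → Prop}
    (hadd : ∀ x y, p x → p y → p (x + y)) (h : ∀ γ γ', p (tmul γ γ')) (t : deg A Γ 2) : p t := by
  obtain ⟨x, hx⟩ := t
  obtain ⟨hx', hp⟩ : ∃ h : x ∈ deg A Γ 2, p ⟨x, h⟩ :=
    deg_two_induction (p := fun x => ∃ h : x ∈ deg A Γ 2, p ⟨x, h⟩)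
      (fun γ γ' => ⟨_, h γ γ'⟩)
      (fun x y ⟨hx, hpx⟩ ⟨hy, hpy⟩ => ⟨add_mem hx hy, hadd _ _ hpx hpy⟩) hx
  exact hp

theorem tmul_smul_left (a : A) (γ γ' : Γ) : tmul (a • γ) γ' = lsmul a (tmul γ γ') :=
  Subtype.ext <| by
    change inr A Γ (a • γ) * inr A Γ γ' = inl A Γ a * (inr A Γ γ * inr A Γ γ')
    rw [← inl_mul_inr, mul_assoc]

theorem tmul_smul_right (a : A) (γ γ' : Γ) : tmul (A := A) γ (a • γ') = tmul (op a • γ) γ' :=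
  Subtype.ext <| by
    change inr A Γ γ * inr A Γ (a • γ') = inr A Γ (op a • γ) * inr A Γ γ'
    rw [← inl_mul_inr, ← inr_mul_inl, mul_assoc]

theorem tmul_add_left (γ₁ γ₂ γ' : Γ) : tmul (A := A) (γ₁ + γ₂) γ' = tmul γ₁ γ' + tmul γ₂ γ' :=
  Subtype.ext <| by
    change inr A Γ (γ₁ + γ₂) * inr A Γ γ' = inr A Γ γ₁ * inr A Γ γ' + inr A Γ γ₂ * inr A Γ γ'
    rw [map_add, add_mul]

theorem tmul_add_right (γ' γ₁ γ₂ : Γ) : tmul (A := A) γ' (γ₁ + γ₂) = tmul γ' γ₁ + tmul γ' γ₂ :=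
  Subtype.ext <| by
    change inr A Γ γ' * inr A Γ (γ₁ + γ₂) = inr A Γ γ' * inr A Γ γ₁ + inr A Γ γ' * inr A Γ γ₂
    rw [map_add, mul_add]

/-- Coefficients from A in the second factor are moved across the tensor sign to the first factor,
which is then expanded again in left-invariant forms. -/
theorem tmul_inv_induction (C : StarCalculus A Γ) {p : deg A Γ 2 → Prop}
    (hadd : ∀ x y, p x → p y → p (x + y))
    (h : ∀ (a : A), ∀ θ ∈ C.inv, ∀ θ' ∈ C.inv, p (lsmul a (tmul θ θ'))) (t : deg A Γ 2) : p t := by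
  have h1 : ∀ γ, ∀ θ' ∈ C.inv, p (tmul γ θ') := by
    intro γ θ' hθ'
    induction γ using C.smul_inv_induction with
    | hadd x y hx hy => rw [tmul_add_left]; exact hadd _ _ hx hy
    | h a θ hθ => rw [tmul_smul_left]; exact h a θ hθ θ' hθ'
  refine tmul_induction hadd (fun γ γ' => ?_) t
  induction γ' using C.smul_inv_induction with
  | hadd x y hx hy => rw [tmul_add_right]; exact hadd _ _ hx hy
  | h a θ hθ => rw [tmul_smul_right]; exact h1 _ _ hθ

/-! ### Compatibility of the metric and the braiding with S² and the star -/

namespace StarCalculus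

theorem s2Two_add (x y : deg A Γ 2) : C.s2Two hC (x + y) = C.s2Two hC x + C.s2Two hC y :=
  Subtype.ext (map_add (C.tensorS2 hC) _ _)

theorem s2Two_tmul (γ γ' : Γ) : C.s2Two hC (tmul γ γ') = tmul (C.s2 hC γ) (C.s2 hC γ') :=
  Subtype.ext <| by
    change C.tensorS2 hC (inr A Γ γ * inr A Γ γ') = inr A Γ (C.s2 hC γ) * inr A Γ (C.s2 hC γ')
    rw [map_mul, tensorS2, lift_inr, lift_inr]
    rfl

theorem s2Two_lsmul (a : A) (t : deg A Γ 2) :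
    C.s2Two hC (lsmul a t) = lsmul (antipodeSq A a) (C.s2Two hC t) :=
  Subtype.ext <| by
    change C.tensorS2 hC (inl A Γ a * t) = inl A Γ (antipodeSq A a) * C.tensorS2 hC t
    rw [map_mul, tensorS2, lift_inl]
    rfl

theorem starTwo_add (x y : deg A Γ 2) : C.starTwo (x + y) = C.starTwo x + C.starTwo y :=
  Subtype.ext (C.tensorStar_add _ _)

theorem starTwo_tmul (γ γ' : Γ) : C.starTwo (tmul γ γ') = tmul (star γ') (star γ) :=
  Subtype.ext <| by
    change C.tensorStar (inr A Γ γ * inr A Γ γ') = inr A Γ (star γ') * inr A Γ (star γ)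
    rw [tensorStar_mul, tensorStar_inr, tensorStar_inr]

theorem tensorCoact_inr (C : StarCalculus A Γ) (γ : Γ) :
    C.tensorCoact (inr A Γ γ) = (inr A Γ).lTensor A (C.coact γ) := by
  rw [tensorCoact, lift_inr]
  rfl

theorem tensorCoact_inl (C : StarCalculus A Γ) (a : A) : C.tensorCoact (inl A Γ a) =
    Algebra.TensorProduct.map (AlgHom.id ℂ A) (inl A Γ) (comul (R := ℂ) a) := by
  rw [tensorCoact, lift_inl]
  rfl

theorem tensorCoact_tmul {θ θ' : Γ} (hθ : θ ∈ C.inv) (hθ' : θ' ∈ C.inv) :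
    C.tensorCoact (tmul θ θ' : deg A Γ 2) =
      (1 : A) ⊗ₜ[ℂ] ((tmul θ θ' : deg A Γ 2) : BimodTensor A Γ) := by
  change C.tensorCoact (inr A Γ θ * inr A Γ θ') = (1 : A) ⊗ₜ[ℂ] (inr A Γ θ * inr A Γ θ')
  rw [map_mul, tensorCoact_inr, tensorCoact_inr, mem_inv.1 hθ, mem_inv.1 hθ']
  simp [Algebra.TensorProduct.tmul_mul_tmul]

/-- Covariance of g gives Δ(x) = 1 ⊗ x for the value x = g(θ ⊗ θ'), and applying the counit to the
second leg shows that x is a scalar. -/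
theorem IsSigmaMetric.tmul_inv (hg : C.IsSigmaMetric hC σ g) {θ θ' : Γ} (hθ : θ ∈ C.inv)
    (hθ' : θ' ∈ C.inv) : g (tmul θ θ') = counit (R := ℂ) (g (tmul θ θ')) • (1 : A) := by
  obtain ⟨z, hz, hz'⟩ := hg.covariant (tmul θ θ')
  have inj : Function.Injective ((deg A Γ 2).subtype.lTensor A) :=
    Module.Flat.lTensor_preserves_injective_linearMap _ (Submodule.subtype_injective _)
  obtain rfl : z = 1 ⊗ₜ tmul θ θ' := inj (by rw [hz, tensorCoact_tmul hθ hθ']; rfl)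
  have h := congrArg (fun w => TensorProduct.rid ℂ A ((counit (R := ℂ)).lTensor A w)) hz'
  simpa using h.symm

/-- Two uses of the twisted symmetry give g(S²θ ⊗ S²θ') = g(S²θ' ⊗ θ) = g(θ ⊗ θ') on invariant
forms, and this value is a scalar, hence fixed by S². -/
theorem IsSigmaMetric.map_s2Two (hg : C.IsSigmaMetric hC σ g) (t : deg A Γ 2) :
    g (C.s2Two hC t) = antipodeSq A (g t) := by
  induction t using tmul_inv_induction C with
  | hadd x y hx hy => rw [s2Two_add, map_add, map_add, map_add, hx, hy]
  | h a θ hθ θ' hθ' =>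
    rw [s2Two_lsmul, s2Two_tmul, hg.map_lsmul, hg.map_lsmul, map_mul,
      hg.map_s2 _ (C.s2_mem_inv hC hθ') _ hθ, hg.map_s2 _ hθ _ hθ', hg.tmul_inv hθ hθ', map_smul, map_one]

theorem IsSigmaMetric.map_starTwo (hg : C.IsSigmaMetric hC σ g) (t : deg A Γ 2) :
    g (C.starTwo t) = star (g t) := by
  induction t using tmul_induction with
  | hadd x y hx hy => rw [starTwo_add, map_add, map_add, star_add, hx, hy]
  | h γ γ' => rw [starTwo_tmul, hg.map_star]

/-- A fixed vector of σ is also one of σ⁻¹, so either alternative for the star makes ker(id - σ)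
star-stable. This is what lets the star descend to the Clifford algebra. -/
theorem IsBraiding.fixes_s2Two_starTwo (hσ : C.IsBraiding hC σ) {t : deg A Γ 2} (ht : σ t = t) :
    σ (C.s2Two hC (C.starTwo t)) = C.s2Two hC (C.starTwo t) := by
  have h : σ (C.starTwo t) = C.starTwo t := by
    rcases hσ.map_star with h | h
    · rw [← h, ht]
    · rw [← σ.eq_symm_apply, ← h, ht]
  rw [← hσ.map_s2, h]

end StarCalculus

/-! ### Generators of the Clifford algebra -/

namespace QCl

theorem mk_surjective : Function.Surjective (mk σ g) :=
  fun x => Quotient.inductionOn' x fun y => ⟨y, rfl⟩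

theorem adjoin_eq_top :
    Algebra.adjoin ℂ (Set.range (inl σ g) ∪ Set.range (inr σ g)) = ⊤ := by
  have h := congrArg (Subalgebra.map (mk σ g)) (BimodTensor.adjoin_eq_top (A := A) (Γ := Γ))
  rw [AlgHom.map_adjoin, Algebra.map_top, (AlgHom.range_eq_top _).2 mk_surjective, Set.image_union,
    ← Set.range_comp, ← Set.range_comp] at h
  exact h

theorem inl_mul_inr (a : A) (γ : Γ) : inl σ g a * inr σ g γ = inr σ g (a • γ) :=
  (map_mul (mk σ g) _ _).symm.trans (congrArg (mk σ g) (BimodTensor.inl_mul_inr a γ))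

theorem inr_mul_inl (γ : Γ) (a : A) : inr σ g γ * inl σ g a = inr σ g (op a • γ) :=
  (map_mul (mk σ g) _ _).symm.trans (congrArg (mk σ g) (BimodTensor.inr_mul_inl γ a))

theorem mk_tmul (γ γ' : Γ) : mk σ g (tmul γ γ' : deg A Γ 2) = inr σ g γ * inr σ g γ' :=
  map_mul (mk σ g) _ _

variable (C σ g) in
/-- The subalgebra generated by the left-invariant one-forms. -/
def formAlg : Subalgebra ℂ (QCl σ g) := Algebra.adjoin ℂ (inr σ g '' C.inv)

theorem inr_mem_formAlg {θ : Γ} (hθ : θ ∈ C.inv) : inr σ g θ ∈ formAlg C σ g :=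
  Algebra.subset_adjoin ⟨θ, hθ, rfl⟩

variable (C) in
/-- The Clifford algebra is spanned by the products `ab` with `a ∈ A` and `b` in the subalgebra
generated by the left-invariant one-forms. -/
theorem span_inl_mul :
    Submodule.span ℂ {u | ∃ a : A, ∃ b ∈ formAlg C σ g, u = inl σ g a * b} = ⊤ := by
  set L := Submodule.span ℂ {u | ∃ a : A, ∃ b ∈ formAlg C σ g, u = inl σ g a * b} with hL
  have hmem : ∀ a : A, ∀ b ∈ formAlg C σ g, inl σ g a * b ∈ L := fun a b hb =>
    Submodule.subset_span ⟨a, b, hb, rfl⟩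
  have hl : ∀ (a : A), ∀ x ∈ L, inl σ g a * x ∈ L := by
    intro a x hx
    induction hx using Submodule.span_induction with
    | mem x h =>
      obtain ⟨c, b, hb, rfl⟩ := h
      rw [← mul_assoc, ← map_mul]
      exact hmem _ _ hb
    | zero => rw [mul_zero]; exact zero_mem _
    | add x y _ _ hx hy => rw [mul_add]; exact add_mem hx hy
    | smul c x _ hx => rw [mul_smul_comm]; exact L.smul_mem c hx
  have hr : ∀ (γ : Γ), ∀ x ∈ L, inr σ g γ * x ∈ L := by
    intro γ x hx
    induction hx using Submodule.span_induction with
    | mem x h =>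
      obtain ⟨c, b, hb, rfl⟩ := h
      rw [← mul_assoc, inr_mul_inl]
      -- The coefficient c has been absorbed into the form on its left; re-expanding that form as a
      -- sum of aθ with θ left-invariant puts the new coefficients in front.
      generalize op c • γ = γ'
      induction γ' using C.smul_inv_induction with
      | hadd x y hx hy => rw [map_add, add_mul]; exact add_mem hx hy
      | h a θ hθ =>
        rw [← inl_mul_inr, mul_assoc]
        exact hmem _ _ (mul_mem (inr_mem_formAlg hθ) hb)
    | zero => rw [mul_zero]; exact zero_mem _
    | add x y _ _ hx hy => rw [mul_add]; exact add_mem hx hy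
    | smul c x _ hx => rw [mul_smul_comm]; exact L.smul_mem c hx
  have key : ∀ u : QCl σ g, ∀ x ∈ L, u * x ∈ L := by
    intro u
    have hu : u ∈ Algebra.adjoin ℂ (Set.range (inl σ g) ∪ Set.range (inr σ g)) := by
      rw [adjoin_eq_top]; trivial
    induction hu using Algebra.adjoin_induction with
    | mem u h =>
      rcases h with ⟨a, rfl⟩ | ⟨γ, rfl⟩
      exacts [hl a, hr γ]
    | algebraMap r =>
      intro x hx
      rw [← Algebra.smul_def]
      exact L.smul_mem r hx
    | add u v _ _ hu hv => intro x hx; rw [add_mul]; exact add_mem (hu x hx) (hv x hx)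
    | mul u v _ _ hu hv => intro x hx; rw [mul_assoc]; exact hu _ (hv x hx)
  rw [eq_top_iff]
  intro u _
  have h1 := key u (inl σ g 1 * 1) (hmem 1 1 (one_mem _))
  simpa using h1

variable (C) in
-- Scalars are absorbed into the factor from the form algebra and zero is the case a = 0, so only
-- additivity of p is required. This makes the principle usable for antilinear maps as well.
theorem inl_mul_induction {p : QCl σ g → Prop} (hadd : ∀ x y, p x → p y → p (x + y))
    (h : ∀ a : A, ∀ b ∈ formAlg C σ g, p (inl σ g a * b)) (u : QCl σ g) : p u := by
  have hu : u ∈ Submodule.span ℂ {u | ∃ a : A, ∃ b ∈ formAlg C σ g, u = inl σ g a * b} := by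
    rw [span_inl_mul]; trivial
  induction hu using Submodule.closure_induction with
  | zero => simpa using h 0 0 (zero_mem _)
  | add x y _ _ hx hy => exact hadd x y hx hy
  | smul_mem c x hx =>
    obtain ⟨a, b, hb, rfl⟩ := hx
    rw [← mul_smul_comm]
    exact h a _ (Subalgebra.smul_mem _ hb c)

variable (C) in
theorem algHom_ext {R : Type*} [Ring R] [Algebra ℂ R] {φ ψ : QCl σ g →ₐ[ℂ] R}
    (h1 : ∀ a, φ (inl σ g a) = ψ (inl σ g a)) (h2 : ∀ θ ∈ C.inv, φ (inr σ g θ) = ψ (inr σ g θ)) :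
    φ = ψ := by
  have h3 : ∀ b ∈ formAlg C σ g, φ b = ψ b := by
    intro b hb
    have : formAlg C σ g ≤ AlgHom.equalizer φ ψ := Algebra.adjoin_le <| by
      rintro _ ⟨θ, hθ, rfl⟩
      exact h2 θ hθ
    exact this hb
  ext u
  induction u using inl_mul_induction C with
  | hadd x y hx hy => rw [map_add, map_add, hx, hy]
  | h a b hb => rw [map_mul, map_mul, h1, h3 b hb]

variable (hσ : C.IsBraiding hC σ) (hg : C.IsSigmaMetric hC σ g)

theorem coact_mk (t : BimodTensor A Γ) : coact hσ hg (mk σ g t) =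
    Algebra.TensorProduct.map (AlgHom.id ℂ A) (mk σ g) (C.tensorCoact t) := rfl

theorem coact_inl (a : A) : coact hσ hg (inl σ g a) =
    Algebra.TensorProduct.map (AlgHom.id ℂ A) (inl σ g) (comul (R := ℂ) a) := by
  change coact hσ hg (mk σ g (BimodTensor.inl A Γ a)) = _
  rw [coact_mk, C.tensorCoact_inl, ← AlgHom.comp_apply, ← Algebra.TensorProduct.map_comp]
  rfl

theorem coact_inr {θ : Γ} (hθ : θ ∈ C.inv) : coact hσ hg (inr σ g θ) = 1 ⊗ₜ inr σ g θ := by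
  change coact hσ hg (mk σ g (BimodTensor.inr A Γ θ)) = _
  rw [coact_mk, C.tensorCoact_inr, StarCalculus.mem_inv.1 hθ]
  rfl

end QCl
end Clifford

/-! ### The main involution -/

/-- `Rᵐᵒᵖ` with the complex conjugate scalar multiplication. -/
def ConjMulOpposite (R : Type*) : Type _ := Rᵐᵒᵖ

namespace ConjMulOpposite
variable {R : Type*} [Ring R] [Algebra ℂ R]

instance : Ring (ConjMulOpposite R) := inferInstanceAs (Ring Rᵐᵒᵖ)

instance : Algebra ℂ (ConjMulOpposite R) := Algebra.compHom Rᵐᵒᵖ (starRingEnd ℂ)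

/-- The identity map. -/
def conjOp : R ≃+ ConjMulOpposite R := opAddEquiv

theorem conjOp_mul (x y : R) : conjOp (x * y) = conjOp y * conjOp x := rfl

theorem conjOp_one : conjOp (1 : R) = 1 := rfl

theorem conjOp_smul (c : ℂ) (x : R) : conjOp (star c • x) = c • conjOp x := rfl

theorem conjOp_symm_smul (c : ℂ) (x : ConjMulOpposite R) :
    conjOp.symm (c • x) = star c • conjOp.symm x := rfl

theorem conjOp_symm_mul (x y : ConjMulOpposite R) :
    conjOp.symm (x * y) = conjOp.symm y * conjOp.symm x := rfl

end ConjMulOpposite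

namespace QCl
open BimodTensor ConjMulOpposite
variable {A : Type u} [Ring A] [HopfAlgebra ℂ A]
  {Γ : Type v} [AddCommGroup Γ] [Module ℂ Γ] [Module A Γ] [Module Aᵐᵒᵖ Γ]
  [SMulCommClass A Aᵐᵒᵖ Γ] [IsScalarTower ℂ A Γ] [IsScalarTower ℂ Aᵐᵒᵖ Γ]
  [StarRing A] [StarModule ℂ A] [StarAddMonoid Γ] [StarModule ℂ Γ]
  {C : StarCalculus A Γ} {hC : C.IsS2Invariant}
  {σ : deg A Γ 2 ≃ₗ[ℂ] deg A Γ 2} {g : deg A Γ 2 →ₗ[ℂ] A}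

variable (C hC σ g) in
/-- The antilinear antimultiplicative map with `a ↦ S²(a*)` on `A` and `γ ↦ -S²(γ*)` on `Γ`, on the
tensor algebra. -/
def tensorTwistedStar : BimodTensor A Γ →ₐ[ℂ] ConjMulOpposite (QCl σ g) :=
  BimodTensor.lift
    (AlgHom.ofLinearMap
      { toFun := fun a => conjOp (inl σ g (antipodeSq A (star a)))
        map_add' := fun a b => by simp
        map_smul' := fun c a => by
          rw [star_smul, map_smul, map_smul, conjOp_smul]; rfl }
      (by simp [conjOp_one])
      (fun a b => by simp [conjOp_mul]))
    { toFun := fun γ => conjOp (-inr σ g (C.s2 hC (star γ)))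
      map_add' := fun a b => by simp [add_comm]
      map_smul' := fun c a => by
        rw [star_smul, map_smul, map_smul, ← smul_neg, conjOp_smul]; rfl }
    (fun a γ => by
      change conjOp (-inr σ g (C.s2 hC (star (a • γ)))) =
        conjOp (inl σ g (antipodeSq A (star a))) * conjOp (-inr σ g (C.s2 hC (star γ)))
      rw [← conjOp_mul, neg_mul, inr_mul_inl, C.involution_smul, (C.s2_spec hC).2.1])
    (fun a γ => by
      change conjOp (-inr σ g (C.s2 hC (star (op a • γ)))) =
        conjOp (-inr σ g (C.s2 hC (star γ))) * conjOp (inl σ g (antipodeSq A (star a)))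
      rw [← conjOp_mul, mul_neg, inl_mul_inr, C.involution_op_smul, (C.s2_spec hC).1])

theorem tensorTwistedStar_inl (a : A) : tensorTwistedStar C hC σ g (BimodTensor.inl A Γ a) =
    conjOp (inl σ g (antipodeSq A (star a))) := by
  rw [tensorTwistedStar, lift_inl]
  rfl

theorem tensorTwistedStar_inr (γ : Γ) : tensorTwistedStar C hC σ g (BimodTensor.inr A Γ γ) =
    conjOp (-inr σ g (C.s2 hC (star γ))) := by
  rw [tensorTwistedStar, lift_inr]
  rfl

/-- The two minus signs cancel in degree two; this is why the sign in β is consistent with the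
relations t = g(t). -/
theorem tensorTwistedStar_deg_two (t : deg A Γ 2) : tensorTwistedStar C hC σ g t =
    conjOp (mk σ g (C.s2Two hC (C.starTwo t))) := by
  induction t using tmul_induction with
  | hadd x y hx hy =>
    rw [C.starTwo_add, C.s2Two_add, Submodule.coe_add, map_add, hx, hy, Submodule.coe_add, map_add,
      map_add]
  | h γ γ' =>
    rw [C.starTwo_tmul, C.s2Two_tmul, mk_tmul]
    change tensorTwistedStar C hC σ g (BimodTensor.inr A Γ γ * BimodTensor.inr A Γ γ') = _
    rw [map_mul, tensorTwistedStar_inr, tensorTwistedStar_inr, ← conjOp_mul, neg_mul_neg]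

/-- The antilinear antimultiplicative map with `a ↦ S²(a*)` on `A` and `γ ↦ -S²(γ*)` on `Γ`. -/
def twistedStar (hσ : C.IsBraiding hC σ) (hg : C.IsSigmaMetric hC σ g) :
    QCl σ g →ₐ[ℂ] ConjMulOpposite (QCl σ g) :=
  RingCon.liftₐ (cliffordCon σ g) (tensorTwistedStar C hC σ g) (RingCon.ringConGen_le.2 <| by
    rintro _ _ ⟨t, ht⟩
    change tensorTwistedStar C hC σ g t = tensorTwistedStar C hC σ g (BimodTensor.inl A Γ (g t))
    -- The element S²(t*) is again fixed by σ, so in Cl it equals g(S²(t*)) = S²(g(t)*), the image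
    -- of g(t).
    rw [tensorTwistedStar_deg_two, mk_rel _ _ _ (hσ.fixes_s2Two_starTwo ht), tensorTwistedStar_inl,
      hg.map_s2Two, hg.map_starTwo]
    rfl)

variable (hσ : C.IsBraiding hC σ) (hg : C.IsSigmaMetric hC σ g)

theorem twistedStar_inl (a : A) : twistedStar hσ hg (inl σ g a) =
    conjOp (inl σ g (antipodeSq A (star a))) := tensorTwistedStar_inl a

theorem twistedStar_inr (γ : Γ) : twistedStar hσ hg (inr σ g γ) =
    conjOp (-inr σ g (C.s2 hC (star γ))) := tensorTwistedStar_inr γ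

/-- The algebra endomorphism `u ↦ χ(u₋₁) u₀` for a character `χ` of `A`. -/
def charAct (χ : A →ₐ[ℂ] ℂ) : QCl σ g →ₐ[ℂ] QCl σ g :=
  ((Algebra.TensorProduct.lid ℂ (QCl σ g)).toAlgHom.comp
    (Algebra.TensorProduct.map χ (AlgHom.id ℂ _))).comp (coact hσ hg)

theorem charAct_inl (χ : A →ₐ[ℂ] ℂ) (a : A) : charAct hσ hg χ (inl σ g a) =
    inl σ g (sw (comul (R := ℂ) a) fun x y => χ x • y) := by
  rw [charAct, AlgHom.comp_apply, coact_inl, map_sw]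
  conv_lhs => rw [← sw_mk (comul (R := ℂ) a), map_sw, map_sw]
  exact sw_congr _ fun x y => by simp

theorem charAct_inr (χ : A →ₐ[ℂ] ℂ) {θ : Γ} (hθ : θ ∈ C.inv) :
    charAct hσ hg χ (inr σ g θ) = inr σ g θ := by
  rw [charAct, AlgHom.comp_apply, coact_inr hσ hg hθ]
  simp

/-- The prescription on A is a ↦ S²((χ(a₁)a₂)*), because S²(ρ(a)) = χ(a₁)a₂ and S²∘*∘S²∘* is the
identity. The translation by χ fixes left-invariant forms, so composing it with `twistedStar` gives
the required values on all generators. -/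
theorem exists_isMainInvolution (hσ : C.IsBraiding hC σ) (hg : C.IsSigmaMetric hC σ g) (hStar : IsHopfStar A) {h : A →ₗ[ℂ] ℂ} (hh : IsHaar h) :
    ∃ β : QCl σ g → QCl σ g, IsMainInvolution C hC σ g (hh.modularEquiv hStar) β := by
  let χ := hh.modularChar hStar
  let β : QCl σ g → QCl σ g := fun u => conjOp.symm (twistedStar hσ hg (charAct hσ hg χ u))
  have hadd : ∀ u v, β (u + v) = β u + β v := fun u v => by simp [β]
  have hsmul : ∀ (c : ℂ) u, β (c • u) = star c • β u := fun c u => by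
    simp only [β, map_smul, conjOp_symm_smul]
  have hmul : ∀ u v, β (u * v) = β v * β u := fun u v => by
    simp only [β, map_mul, conjOp_symm_mul]
  have hinl : ∀ a, β (inl σ g a) = inl σ g (star (hh.modularEquiv hStar a)) := fun a => by
    simp only [β, χ]
    rw [charAct_inl, ← hh.antipodeSq_modularEquiv hStar, twistedStar_inl, AddEquiv.symm_apply_apply]
    have := antipodeSq_star_antipodeSq_star hStar (star (hh.modularEquiv hStar a))
    rw [star_star] at this
    rw [this]
  have hinr : ∀ θ ∈ C.inv, β (inr σ g θ) = -inr σ g (C.s2 hC (star θ)) := fun θ hθ => by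
    simp only [β]
    rw [charAct_inr hσ hg χ hθ, twistedStar_inr, AddEquiv.symm_apply_apply]
  have hone : β 1 = 1 := by simpa using hinl 1
  -- The square of an antilinear antimultiplicative map is an algebra endomorphism, so involutivity
  -- need only be tested on A and on left-invariant forms.
  let ββ : QCl σ g →ₐ[ℂ] QCl σ g := AlgHom.ofLinearMap
    { toFun := fun u => β (β u)
      map_add' := fun u v => by rw [hadd, hadd]
      map_smul' := fun c u => by rw [hsmul, hsmul, star_star]; rfl }
    (by change β (β 1) = 1; rw [hone, hone])
    (fun u v => by change β (β (u * v)) = β (β u) * β (β v); rw [hmul, hmul])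
  have hββ : ββ = AlgHom.id ℂ _ := algHom_ext C
    (fun a => by
      change β (β (inl σ g a)) = inl σ g a
      rw [hinl, hinl]
      exact congrArg _ (hh.star_modular_star hStar a))
    (fun θ hθ => by
      change β (β (inr σ g θ)) = inr σ g θ
      have hneg : ∀ u, β (-u) = -β u := fun u => by
        have := hsmul (-1) u
        simpa using this
      rw [hinr θ hθ, hneg, hinr _ (C.s2_mem_inv hC (C.star_mem_inv hStar hθ)), neg_neg,
        C.s2_star_s2_star hStar])
  exact ⟨β, hadd, hsmul, hmul, fun u => AlgHom.congr_fun hββ u, hinl, hinr⟩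

end QCl

/-! ### Sesquilinear maps on tensor products -/

section Sesquilinear
variable {U V M N : Type*} [AddCommGroup U] [Module ℂ U] [AddCommGroup V] [Module ℂ V]
  [AddCommGroup M] [Module ℂ M] [AddCommGroup N] [Module ℂ N]

/-- The sesquilinear map `(x ⊗ y, x' ⊗ y') ↦ G(x, x') ⊗ H(y, y')`. -/
def sesqTensor (G : U →ₗ[ℂ] U →ₗ⋆[ℂ] M) (H : V →ₗ[ℂ] V →ₗ⋆[ℂ] N) :
    U ⊗[ℂ] V →ₗ[ℂ] U ⊗[ℂ] V →ₗ⋆[ℂ] M ⊗[ℂ] N :=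
  TensorProduct.lift <| LinearMap.mk₂ ℂ
    (fun x y => TensorProduct.lift <| LinearMap.mk₂'ₛₗ (starRingEnd ℂ) (starRingEnd ℂ)
      (fun x' y' => G x x' ⊗ₜ[ℂ] H y y')
      (by intros; simp [TensorProduct.add_tmul]) (by intros; simp [TensorProduct.smul_tmul'])
      (by intros; simp [TensorProduct.tmul_add]) (by intros; simp))
    (by intros; ext; simp [TensorProduct.add_tmul]; rfl)
    (by intros; ext; simp; exact TensorProduct.smul_tmul' _ _ _)
    (by intros; ext; simp [TensorProduct.tmul_add]; rfl)
    (by intros; ext; simp; rfl)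

theorem sesqTensor_tmul (G : U →ₗ[ℂ] U →ₗ⋆[ℂ] M) (H : V →ₗ[ℂ] V →ₗ⋆[ℂ] N) (x x' : U) (y y' : V) :
    sesqTensor G H (x ⊗ₜ y) (x' ⊗ₜ y') = G x x' ⊗ₜ H y y' := rfl

end Sesquilinear

namespace QCl
open BimodTensor
variable {A : Type u} [Ring A] [HopfAlgebra ℂ A]
  {Γ : Type v} [AddCommGroup Γ] [Module ℂ Γ] [Module A Γ] [Module Aᵐᵒᵖ Γ]
  [SMulCommClass A Aᵐᵒᵖ Γ] [IsScalarTower ℂ A Γ] [IsScalarTower ℂ Aᵐᵒᵖ Γ]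
  [StarRing A] [StarModule ℂ A] [StarAddMonoid Γ] [StarModule ℂ Γ]
  {C : StarCalculus A Γ} {hC : C.IsS2Invariant}
  {σ : deg A Γ 2 ≃ₗ[ℂ] deg A Γ 2} {g : deg A Γ 2 →ₗ[ℂ] A}
  (hσ : C.IsBraiding hC σ) (hg : C.IsSigmaMetric hC σ g)

/-! ### The Clifford algebra as a Hopf module -/

theorem coact_formAlg {b : QCl σ g} (hb : b ∈ formAlg C σ g) : coact hσ hg b = 1 ⊗ₜ b := by
  have : formAlg C σ g ≤ AlgHom.equalizer (coact hσ hg) Algebra.TensorProduct.includeRight :=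
    Algebra.adjoin_le <| by
      rintro _ ⟨θ, hθ, rfl⟩
      exact coact_inr hσ hg hθ
  exact this hb

theorem coact_inl_mul (a : A) {b : QCl σ g} (hb : b ∈ formAlg C σ g) :
    coact hσ hg (inl σ g a * b) = sw (comul (R := ℂ) a) fun x y => x ⊗ₜ (inl σ g y * b) := by
  rw [map_mul, coact_formAlg hσ hg hb, coact_inl]
  conv_lhs => rw [← sw_mk (comul (R := ℂ) a), map_sw, sw_mul_right]
  exact sw_congr _ fun x y => by simp [Algebra.TensorProduct.tmul_mul_tmul]

/-- The projection `u ↦ S(u₋₁) u₀` onto the left-invariant elements. -/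
def invProj : QCl σ g →ₗ[ℂ] QCl σ g :=
  TensorProduct.lift ((LinearMap.mul ℂ (QCl σ g)).compl₁₂ ((inl σ g).toLinearMap ∘ₗ antipode ℂ)
    LinearMap.id) ∘ₗ (coact hσ hg).toLinearMap

theorem invProj_inl_mul (a : A) {b : QCl σ g} (hb : b ∈ formAlg C σ g) :
    invProj hσ hg (inl σ g a * b) = counit (R := ℂ) a • b := by
  have h := congrArg (fun x => inl σ g x * b) (antipode_mul_sw a)
  simp only [map_sw, sw_mul_right, map_smul, map_one, smul_mul_assoc, one_mul] at h
  rw [invProj, LinearMap.comp_apply, AlgHom.toLinearMap_apply, coact_inl_mul hσ hg a hb, map_sw, ← h]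
  exact sw_congr _ fun x y => by simp [mul_assoc]

theorem invProj_of_mem {b : QCl σ g} (hb : b ∈ formAlg C σ g) : invProj hσ hg b = b := by
  simpa using invProj_inl_mul hσ hg 1 hb

theorem invProj_mem (u : QCl σ g) : invProj hσ hg u ∈ formAlg C σ g := by
  induction u using inl_mul_induction C with
  | hadd x y hx hy => rw [map_add]; exact add_mem hx hy
  | h a b hb => rw [invProj_inl_mul hσ hg a hb]; exact Subalgebra.smul_mem _ hb _

/-- The map `u ↦ u₋₂ ⊗ S(u₋₁) u₀`. -/
def splitting : QCl σ g →ₗ[ℂ] A ⊗[ℂ] QCl σ g :=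
  (invProj hσ hg).lTensor A ∘ₗ (coact hσ hg).toLinearMap

theorem splitting_apply (u : QCl σ g) :
    splitting hσ hg u = (invProj hσ hg).lTensor A (coact hσ hg u) := rfl

theorem splitting_inl_mul (a : A) {b : QCl σ g} (hb : b ∈ formAlg C σ g) :
    splitting hσ hg (inl σ g a * b) = a ⊗ₜ b := by
  have h := counit_right ((TensorProduct.mk ℂ A (QCl σ g)).flip b) a
  rw [splitting_apply, coact_inl_mul hσ hg a hb, map_sw]
  refine Eq.trans (sw_congr _ fun x y => ?_) h
  rw [LinearMap.lTensor_tmul, invProj_inl_mul hσ hg y hb, TensorProduct.tmul_smul]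
  rfl

theorem splitting_of_mem {b : QCl σ g} (hb : b ∈ formAlg C σ g) :
    splitting hσ hg b = 1 ⊗ₜ b := by
  simpa using splitting_inl_mul hσ hg 1 hb

/-- The map `a ⊗ u ↦ au`. -/
def mulMap : A ⊗[ℂ] QCl σ g →ₗ[ℂ] QCl σ g :=
  TensorProduct.lift ((LinearMap.mul ℂ (QCl σ g)).compl₁₂ (inl σ g).toLinearMap LinearMap.id)

theorem mulMap_tmul (a : A) (u : QCl σ g) : mulMap (a ⊗ₜ u) = inl σ g a * u := rfl

theorem mulMap_splitting (u : QCl σ g) : mulMap (splitting hσ hg u) = u := by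
  induction u using inl_mul_induction C with
  | hadd x y hx hy => rw [map_add, map_add, hx, hy]
  | h a b hb => rw [splitting_inl_mul hσ hg a hb, mulMap_tmul]

/-- The map `u ↦ h(u₋₁) u₀`. -/
def invMean (h : A →ₗ[ℂ] ℂ) : QCl σ g →ₗ[ℂ] QCl σ g :=
  (TensorProduct.lid ℂ (QCl σ g)).toLinearMap ∘ₗ h.rTensor _ ∘ₗ (coact hσ hg).toLinearMap

theorem invMean_apply (h : A →ₗ[ℂ] ℂ) (u : QCl σ g) : invMean hσ hg h u =
    TensorProduct.lid ℂ (QCl σ g) (h.rTensor _ (coact hσ hg u)) := rfl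

theorem invMean_inl_mul {h : A →ₗ[ℂ] ℂ} (hh : IsHaar h) (a : A) {b : QCl σ g}
    (hb : b ∈ formAlg C σ g) : invMean hσ hg h (inl σ g a * b) = h a • b := by
  have h1 := congrArg (fun x => inl σ g x * b) (hh.right a)
  simp only [map_sw, sw_mul_right, map_smul, map_one, smul_mul_assoc, one_mul] at h1
  rw [invMean_apply, coact_inl_mul hσ hg a hb, map_sw, map_sw, ← h1]
  exact sw_congr _ fun x y => by simp

theorem invMean_mul (h : A →ₗ[ℂ] ℂ) {b : QCl σ g} (hb : b ∈ formAlg C σ g) (u : QCl σ g) :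
    invMean hσ hg h (b * u) = b * invMean hσ hg h u := by
  rw [invMean_apply, invMean_apply, map_mul, coact_formAlg hσ hg hb]
  induction coact hσ hg u with
  | zero => simp
  | add u v hu hv => simp only [mul_add, map_add, hu, hv]
  | tmul a u => simp [Algebra.TensorProduct.tmul_mul_tmul]

/-! ### Covariant left ideals -/

/-- The subspace `A ⊗ J` of `A ⊗ Cl`. -/
def tensorIdeal (J : Ideal (QCl σ g)) : Submodule ℂ (A ⊗[ℂ] QCl σ g) :=
  LinearMap.range ((J.restrictScalars ℂ).subtype.lTensor A)

theorem tmul_mem_tensorIdeal {J : Ideal (QCl σ g)} (a : A) {u : QCl σ g} (hu : u ∈ J) :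
    a ⊗ₜ u ∈ tensorIdeal (A := A) J :=
  ⟨a ⊗ₜ ⟨u, hu⟩, rfl⟩

theorem tensorIdeal_induction {J : Ideal (QCl σ g)} {p : A ⊗[ℂ] QCl σ g → Prop}
    (hadd : ∀ x y, p x → p y → p (x + y)) (h : ∀ (a : A), ∀ u ∈ J, p (a ⊗ₜ u))
    {x : A ⊗[ℂ] QCl σ g} (hx : x ∈ tensorIdeal J) : p x := by
  obtain ⟨z, rfl⟩ := hx
  induction z with
  | zero => simpa using h 0 0 (zero_mem _)
  | add u v hu hv => rw [map_add]; exact hadd _ _ hu hv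
  | tmul a u => exact h a u u.2

theorem mul_mem_tensorIdeal {J : Ideal (QCl σ g)} (w : A ⊗[ℂ] QCl σ g) {x : A ⊗[ℂ] QCl σ g}
    (hx : x ∈ tensorIdeal J) : w * x ∈ tensorIdeal J := by
  refine tensorIdeal_induction (p := fun x => w * x ∈ tensorIdeal J) (fun x y hx hy => ?_)
    (fun a u hu => ?_) hx
  · rw [mul_add]; exact add_mem hx hy
  · induction w with
    | zero => rw [zero_mul]; exact zero_mem _
    | add v w hv hw => rw [add_mul]; exact add_mem hv hw
    | tmul b v =>
      rw [Algebra.TensorProduct.tmul_mul_tmul]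
      exact tmul_mem_tensorIdeal _ (J.mul_mem_left v hu)

theorem mul_mem_tensorIdeal_of_mul_mem {J S : Ideal (QCl σ g)} (h : ∀ s ∈ S, ∀ r, s * r ∈ J)
    (w : A ⊗[ℂ] QCl σ g) {x : A ⊗[ℂ] QCl σ g} (hx : x ∈ tensorIdeal S) : x * w ∈ tensorIdeal J := by
  refine tensorIdeal_induction (p := fun x => x * w ∈ tensorIdeal J) (fun x y hx hy => ?_)
    (fun a u hu => ?_) hx
  · rw [add_mul]; exact add_mem hx hy
  · induction w with
    | zero => rw [mul_zero]; exact zero_mem _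
    | add v w hv hw => rw [mul_add]; exact add_mem hv hw
    | tmul b v =>
      rw [Algebra.TensorProduct.tmul_mul_tmul]
      exact tmul_mem_tensorIdeal _ (h u hu v)

variable {hσ hg}

theorem isLeftCovariant_span_singleton {b : QCl σ g} (hb : b ∈ formAlg C σ g) :
    IsLeftCovariant hσ hg (Ideal.span {b}) := by
  intro u hu
  obtain ⟨r, rfl⟩ := Ideal.mem_span_singleton'.1 hu
  rw [map_mul, coact_formAlg hσ hg hb]
  exact mul_mem_tensorIdeal _ (tmul_mem_tensorIdeal _ (Ideal.mem_span_singleton_self b))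

theorem invProj_mem_of_mem {S : Ideal (QCl σ g)} (hS : IsLeftCovariant hσ hg S) {s : QCl σ g}
    (hs : s ∈ S) : invProj hσ hg s ∈ S := by
  rw [invProj, LinearMap.comp_apply, AlgHom.toLinearMap_apply]
  refine tensorIdeal_induction (p := fun x => TensorProduct.lift ((LinearMap.mul ℂ (QCl σ g)).compl₁₂
      ((inl σ g).toLinearMap ∘ₗ antipode ℂ) LinearMap.id) x ∈ S) (fun x y hx hy => ?_)
    (fun a u hu => S.mul_mem_left (inl σ g (antipode ℂ a)) hu) (hS s hs)
  rw [map_add]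
  exact add_mem hx hy

/-- The elements of a left-covariant left ideal are sums of products `av` with `a ∈ A` and
left-invariant elements `v` of the ideal. -/
theorem mem_induction {S : Ideal (QCl σ g)} (hS : IsLeftCovariant hσ hg S) {p : QCl σ g → Prop}
    (hadd : ∀ x y, p x → p y → p (x + y))
    (h : ∀ a : A, ∀ b ∈ S, b ∈ formAlg C σ g → p (inl σ g a * b)) {s : QCl σ g} (hs : s ∈ S) : p s := by
  rw [← mulMap_splitting hσ hg s, splitting_apply]
  refine tensorIdeal_induction (p := fun x => p (mulMap ((invProj hσ hg).lTensor A x)))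
    (fun x y hx hy => ?_) (fun a u hu => ?_) (hS s hs)
  · rw [map_add, map_add]; exact hadd _ _ hx hy
  · rw [LinearMap.lTensor_tmul, mulMap_tmul]
    exact h a _ (invProj_mem_of_mem hS hu) (invProj_mem hσ hg u)

/-- In a simple left-covariant algebra, `1` is a sum of products `vb` of a left-invariant element `v` of
a nonzero left-covariant left ideal and right `A`-module, and a left-invariant element `b`. -/
theorem one_mem_span_mul (hsimple : IsSimpleLeftCovariant hσ hg) {S : Ideal (QCl σ g)}
    (hS : IsMinimalSpinorModule hσ hg S) : (1 : QCl σ g) ∈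
      Submodule.span ℂ {x | ∃ v ∈ S, v ∈ formAlg C σ g ∧ ∃ b ∈ formAlg C σ g, x = v * b} := by
  set L := Submodule.span ℂ {x | ∃ v ∈ S, v ∈ formAlg C σ g ∧ ∃ b ∈ formAlg C σ g, x = v * b} with hL
  let J : Ideal (QCl σ g) := Ideal.span {x | ∃ s ∈ S, ∃ r, x = s * r}
  have hJ : ∀ s ∈ S, ∀ r, s * r ∈ J := fun s hs r => Ideal.subset_span ⟨s, hs, r, rfl⟩
  have hind : ∀ {p : QCl σ g → Prop}, (∀ x y, p x → p y → p (x + y)) →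
      (∀ s ∈ S, ∀ r, p (s * r)) → ∀ x ∈ J, p x := by
    intro p hadd h x hx
    induction hx using Submodule.closure_induction with
    | zero => simpa using h 0 S.zero_mem 0
    | add x y _ _ hx hy => exact hadd x y hx hy
    | smul_mem c x hx =>
      obtain ⟨s, hs, r, rfl⟩ := hx
      rw [smul_eq_mul, ← mul_assoc]
      exact h _ (S.mul_mem_left c hs) r
  have hJ2 : J.IsTwoSided := ⟨fun {x} r hx => by
    refine hind (p := fun x => x * r ∈ J) (fun x y hx hy => ?_) (fun s hs r' => ?_) x hx
    · rw [add_mul]; exact add_mem hx hy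
    · rw [mul_assoc]; exact hJ s hs _⟩
  have hJ3 : IsLeftCovariant hσ hg J := by
    refine hind (fun x y hx hy => ?_) fun s hs r => ?_
    · rw [map_add]; exact add_mem hx hy
    · rw [map_mul]; exact mul_mem_tensorIdeal_of_mul_mem hJ _ (hS.covariant s hs)
  have hJ4 : J = ⊤ := by
    refine (hsimple.2 J hJ2 hJ3).resolve_left fun h => hS.ne_bot ?_
    rw [eq_bot_iff, ← h]
    intro s hs
    simpa using hJ s hs 1
  have key : ∀ x ∈ J, invProj hσ hg x ∈ L := by
    refine hind (fun x y hx hy => ?_) fun s hs r => ?_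
    · rw [map_add]; exact add_mem hx hy
    · induction r using inl_mul_induction C with
      | hadd x y hx hy => rw [mul_add, map_add]; exact add_mem hx hy
      | h a b hb =>
        rw [← mul_assoc]
        refine mem_induction (p := fun x => invProj hσ hg (x * b) ∈ L) hS.covariant
          (fun x y hx hy => ?_) (fun c v hv hv' => ?_) (hS.mul_mem s hs a)
        · rw [add_mul, map_add]; exact add_mem hx hy
        · rw [mul_assoc, invProj_inl_mul hσ hg c (mul_mem hv' hb)]
          exact L.smul_mem _ (Submodule.subset_span ⟨v, hv, hv', b, hb, rfl⟩)
  have h1 := key 1 (hJ4 ▸ Submodule.mem_top)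
  rwa [invProj_of_mem hσ hg (one_mem _)] at h1

end QCl

/-! ### The metric on the spinor module -/

namespace QCl
open BimodTensor
variable {A : Type u} [Ring A] [HopfAlgebra ℂ A]
  {Γ : Type v} [AddCommGroup Γ] [Module ℂ Γ] [Module A Γ] [Module Aᵐᵒᵖ Γ]
  [SMulCommClass A Aᵐᵒᵖ Γ] [IsScalarTower ℂ A Γ] [IsScalarTower ℂ Aᵐᵒᵖ Γ]
  [StarRing A] [StarModule ℂ A] [StarAddMonoid Γ] [StarModule ℂ Γ]
  {C : StarCalculus A Γ} {hC : C.IsS2Invariant}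
  {σ : deg A Γ 2 ≃ₗ[ℂ] deg A Γ 2} {g : deg A Γ 2 →ₗ[ℂ] A}
  {hσ : C.IsBraiding hC σ} {hg : C.IsSigmaMetric hC σ g}
  {ρ : A ≃ₐ[ℂ] A} {β : QCl σ g → QCl σ g}

theorem IsMainInvolution.map_one (hβ : IsMainInvolution C hC σ g ρ β) : β 1 = 1 := by
  simpa using hβ.map_inl 1

theorem IsMainInvolution.map_zero (hβ : IsMainInvolution C hC σ g ρ β) : β 0 = 0 := by
  simpa using hβ.map_smul 0 0

theorem IsMainInvolution.mem_formAlg (hStar : IsHopfStar A) (hβ : IsMainInvolution C hC σ g ρ β)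
    {b : QCl σ g} (hb : b ∈ formAlg C σ g) : β b ∈ formAlg C σ g := by
  induction hb using Algebra.adjoin_induction with
  | mem u h =>
    obtain ⟨θ, hθ, rfl⟩ := h
    rw [hβ.map_inr θ hθ]
    exact neg_mem (inr_mem_formAlg (C.s2_mem_inv hC (C.star_mem_inv hStar hθ)))
  | algebraMap r =>
    rw [Algebra.algebraMap_eq_smul_one, hβ.map_smul, hβ.map_one]
    exact Subalgebra.smul_mem _ (one_mem _) _
  | add u v _ _ hu hv => rw [hβ.map_add]; exact add_mem hu hv
  | mul u v _ _ hu hv => rw [hβ.map_mul]; exact mul_mem hv hu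

theorem exists_involution_mul_ne_zero (hβ : IsMainInvolution C hC σ g ρ β)
    (hsimple : IsSimpleLeftCovariant hσ hg) {S : Ideal (QCl σ g)} (hS : IsMinimalSpinorModule hσ hg S) :
    ∃ v ∈ S, v ∈ formAlg C σ g ∧ ∃ w ∈ S, w ∈ formAlg C σ g ∧ β w * v ≠ 0 := by
  by_contra! hcon
  have h1 := one_mem_span_mul hsimple hS
  have h2 : ∀ w ∈ S, w ∈ formAlg C σ g → w = 0 := by
    intro w hw hw'
    have h3 : ∀ x ∈ Submodule.span ℂ {x | ∃ v ∈ S, v ∈ formAlg C σ g ∧ ∃ b ∈ formAlg C σ g, x = v * b},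
        β w * x = 0 := by
      intro x hx
      induction hx using Submodule.span_induction with
      | mem x h =>
        obtain ⟨v, hv, hv', b, -, rfl⟩ := h
        rw [← mul_assoc, hcon v hv hv' w hw hw', zero_mul]
      | zero => rw [mul_zero]
      | add x y _ _ hx hy => rw [mul_add, hx, hy, add_zero]
      | smul c x _ hx => rw [mul_smul_comm, hx, smul_zero]
    have h4 := h3 1 h1
    rw [mul_one] at h4
    rw [← hβ.involutive w, h4, hβ.map_zero]
  refine hS.ne_bot (eq_bot_iff.2 fun s hs => ?_)
  refine mem_induction (p := fun x => x ∈ (⊥ : Ideal (QCl σ g))) hS.covariant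
    (fun x y hx hy => add_mem hx hy) (fun a b hb hb' => ?_) hs
  rw [h2 b hb hb', mul_zero]
  exact zero_mem _

/-- A functional that does not vanish at a given element may be chosen hermitian. -/
theorem IsMainInvolution.exists_hermitian (hβ : IsMainInvolution C hC σ g ρ β) {x : QCl σ g} (hx : x ≠ 0) :
    ∃ f : QCl σ g →ₗ[ℂ] ℂ, (∀ u, f (β u) = star (f u)) ∧ f x ≠ 0 := by
  obtain ⟨f, hf⟩ := Module.Projective.exists_dual_ne_zero ℂ hx
  let f' : QCl σ g →ₗ[ℂ] ℂ :=
    { toFun := fun u => star (f (β u))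
      map_add' := fun u v => by rw [hβ.map_add, LinearMap.map_add, star_add]
      map_smul' := fun c u => by
        rw [hβ.map_smul, LinearMap.map_smul, star_smul, star_star]; rfl }
  have h1 : ∀ u, f' u = star (f (β u)) := fun _ => rfl
  have h2 : ∀ u, f' (β u) = star (f u) := fun u => by rw [h1, hβ.involutive]
  by_cases h : f x + f' x = 0
  · refine ⟨Complex.I • (f - f'), fun u => ?_, ?_⟩
    · simp only [LinearMap.smul_apply, LinearMap.sub_apply, h2, h1, smul_eq_mul, star_mul', star_sub,
        Complex.star_def, Complex.conj_I, Complex.conj_conj]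
      ring
    · have h3 : f' x = -f x := by linear_combination h
      simp only [LinearMap.smul_apply, LinearMap.sub_apply, h3, smul_eq_mul]
      refine mul_ne_zero Complex.I_ne_zero ?_
      rw [sub_neg_eq_add, ← two_mul]
      exact mul_ne_zero two_ne_zero hf
  · exact ⟨f + f', fun u => by
      rw [LinearMap.add_apply, LinearMap.add_apply, h2, h1, star_add, star_star, add_comm], h⟩

/-- The sesquilinear form `(u, v) ↦ f(β(v)u)`. -/
def involutionForm (hβ : IsMainInvolution C hC σ g ρ β) (f : QCl σ g →ₗ[ℂ] ℂ) :
    QCl σ g →ₗ[ℂ] QCl σ g →ₗ⋆[ℂ] ℂ :=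
  LinearMap.mk₂'ₛₗ (RingHom.id ℂ) (starRingEnd ℂ) (fun u v => f (β v * u))
    (fun u u' v => by rw [mul_add, map_add]) (fun c u v => by rw [mul_smul_comm, map_smul]; rfl)
    (fun u v v' => by rw [hβ.map_add, add_mul, map_add])
    (fun c u v => by rw [hβ.map_smul, smul_mul_assoc, map_smul]; rfl)

/-- The sesquilinear form `(a, b) ↦ ab*`. -/
def mulStarForm (A : Type u) [Ring A] [HopfAlgebra ℂ A] [StarRing A] [StarModule ℂ A] :
    A →ₗ[ℂ] A →ₗ⋆[ℂ] A :=
  LinearMap.mk₂'ₛₗ (RingHom.id ℂ) (starRingEnd ℂ) (fun a b => a * star b)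
    (fun u u' v => add_mul _ _ _) (fun c u v => smul_mul_assoc _ _ _)
    (fun u v v' => by rw [star_add, mul_add])
    (fun c u v => by rw [star_smul, mul_smul_comm]; rfl)

variable (hσ hg) in
/-- The `A`-valued form with `(au, bv) ↦ a f(β(v)u) b*` for left-invariant elements `u`, `v`. -/
def algForm (hβ : IsMainInvolution C hC σ g ρ β) (f : QCl σ g →ₗ[ℂ] ℂ) :
    QCl σ g →ₗ[ℂ] QCl σ g →ₗ⋆[ℂ] A :=
  LinearMap.mk₂'ₛₗ (RingHom.id ℂ) (starRingEnd ℂ)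
    (fun u v => TensorProduct.rid ℂ A (sesqTensor (mulStarForm A) (involutionForm hβ f)
      (splitting hσ hg u) (splitting hσ hg v)))
    (fun u u' v => by simp) (fun c u v => by simp) (fun u v v' => by simp) (fun c u v => by simp)

theorem algForm_apply (hβ : IsMainInvolution C hC σ g ρ β) (f : QCl σ g →ₗ[ℂ] ℂ) (u v : QCl σ g) :
    algForm hσ hg hβ f u v = TensorProduct.rid ℂ A (sesqTensor (mulStarForm A) (involutionForm hβ f)
      (splitting hσ hg u) (splitting hσ hg v)) := rfl

theorem algForm_inl_mul (hβ : IsMainInvolution C hC σ g ρ β) (f : QCl σ g →ₗ[ℂ] ℂ) (a b : A)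
    {u v : QCl σ g} (hu : u ∈ formAlg C σ g) (hv : v ∈ formAlg C σ g) :
    algForm hσ hg hβ f (inl σ g a * u) (inl σ g b * v) = f (β v * u) • (a * star b) := by
  rw [algForm_apply, splitting_inl_mul hσ hg a hu, splitting_inl_mul hσ hg b hv, sesqTensor_tmul,
    TensorProduct.rid_tmul]
  rfl

theorem algForm_mul_mul (hβ : IsMainInvolution C hC σ g ρ β) (f : QCl σ g →ₗ[ℂ] ℂ) (a b : A)
    (u v : QCl σ g) : algForm hσ hg hβ f (inl σ g a * u) (inl σ g b * v) =
      a * algForm hσ hg hβ f u v * star b := by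
  induction u using inl_mul_induction C with
  | hadd x y hx hy => simp only [mul_add, add_mul, map_add, LinearMap.add_apply, hx, hy]
  | h c u hu =>
    induction v using inl_mul_induction C with
    | hadd x y hx hy => simp only [mul_add, add_mul, map_add, hx, hy]
    | h d v hv =>
      rw [← mul_assoc, ← mul_assoc, ← map_mul, ← map_mul, algForm_inl_mul hβ f _ _ hu hv,
        algForm_inl_mul hβ f _ _ hu hv, star_mul, mul_smul_comm, smul_mul_assoc]
      simp only [mul_assoc]

theorem star_algForm (hβ : IsMainInvolution C hC σ g ρ β) {f : QCl σ g →ₗ[ℂ] ℂ}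
    (hf : ∀ u, f (β u) = star (f u)) (u v : QCl σ g) :
    star (algForm hσ hg hβ f u v) = algForm hσ hg hβ f v u := by
  induction u using inl_mul_induction C with
  | hadd x y hx hy => simp only [map_add, LinearMap.add_apply, star_add, hx, hy]
  | h c u hu =>
    induction v using inl_mul_induction C with
    | hadd x y hx hy => simp only [map_add, LinearMap.add_apply, star_add, hx, hy]
    | h d v hv =>
      rw [algForm_inl_mul hβ f _ _ hu hv, algForm_inl_mul hβ f _ _ hv hu, star_smul, star_mul,
        star_star, ← hf, hβ.map_mul, hβ.involutive]

theorem comul_algForm (hStar : IsHopfStar A) (hβ : IsMainInvolution C hC σ g ρ β)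
    (f : QCl σ g →ₗ[ℂ] ℂ) (u v : QCl σ g) : comul (R := ℂ) (algForm hσ hg hβ f u v) =
      sesqTensor (mulStarForm A) (algForm hσ hg hβ f) (coact hσ hg u) (coact hσ hg v) := by
  induction u using inl_mul_induction C with
  | hadd x y hx hy => simp only [map_add, LinearMap.add_apply, hx, hy]
  | h a u hu =>
    induction v using inl_mul_induction C with
    | hadd x y hx hy => simp only [map_add, hx, hy]
    | h b v hv =>
      have h1 : ∀ w z : A ⊗[ℂ] A, sesqTensor (mulStarForm A) (algForm hσ hg hβ f)
          (sw w fun x y => x ⊗ₜ (inl σ g y * u)) (sw z fun x y => x ⊗ₜ (inl σ g y * v)) =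
          f (β v * u) • (w * star z) := by
        have e : ∀ (u : QCl σ g) (w : A ⊗[ℂ] A), (sw w fun x y => x ⊗ₜ[ℂ] (inl σ g y * u)) =
            ((LinearMap.mulRight ℂ u ∘ₗ (inl σ g).toLinearMap).lTensor A) w := fun u w => by
          conv_rhs => rw [← sw_mk w, map_sw]
          rfl
        intro w z
        rw [e, e]
        induction w with
        | zero => simp
        | add w w' hw hw' => rw [map_add, map_add, LinearMap.add_apply, hw, hw', add_mul, smul_add]
        | tmul x y =>
          induction z with
          | zero => simp
          | add z z' hz hz' => rw [map_add, map_add, hz, hz', star_add, mul_add, smul_add]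
          | tmul p q =>
            simp only [LinearMap.lTensor_tmul, LinearMap.comp_apply, LinearMap.mulRight_apply,
              AlgHom.toLinearMap_apply, sesqTensor_tmul, algForm_inl_mul hβ f _ _ hu hv,
              TensorProduct.tmul_smul, TensorProduct.star_tmul, Algebra.TensorProduct.tmul_mul_tmul]
            rfl
      rw [algForm_inl_mul hβ f _ _ hu hv, coact_inl_mul hσ hg a hu, coact_inl_mul hσ hg b hv, h1,
        map_smul, Bialgebra.comul_mul, hStar]

theorem haar_algForm (hStar : IsHopfStar A) (hβ : IsMainInvolution C hC σ g ρ β) {h : A →ₗ[ℂ] ℂ}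
    (hh : IsHaar h) (hρ : ∀ a b, h (a * b) = h (b * ρ a)) (f : QCl σ g →ₗ[ℂ] ℂ) (u v : QCl σ g) :
    h (algForm hσ hg hβ f u v) = f (invMean hσ hg h (β v * u)) := by
  induction u using inl_mul_induction C with
  | hadd x y hx hy => simp only [mul_add, map_add, LinearMap.add_apply, hx, hy]
  | h a u hu =>
    induction v using inl_mul_induction C with
    | hadd x y hx hy => simp only [add_mul, map_add, hβ.map_add, hx, hy]
    | h b v hv =>
      have h1 : h (star (ρ b) * a) = h (a * star b) := by
        have h2 : star (h (star (ρ b) * a)) = star (h (a * star b)) := by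
          rw [← hh.map_star hStar, ← hh.map_star hStar, star_mul, star_mul, star_star, star_star, ← hρ]
        exact star_injective h2
      rw [algForm_inl_mul hβ f _ _ hu hv, hβ.map_mul, hβ.map_inl, mul_assoc,
        invMean_mul hσ hg h (hβ.mem_formAlg hStar hv), ← mul_assoc (inl σ g _), ← map_mul,
        invMean_inl_mul hσ hg hh _ hu, h1, mul_smul_comm, map_smul, map_smul, smul_eq_mul, smul_eq_mul,
        mul_comm]

theorem haar_algForm_mul (hStar : IsHopfStar A) (hβ : IsMainInvolution C hC σ g ρ β) {h : A →ₗ[ℂ] ℂ}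
    (hh : IsHaar h) (hρ : ∀ a b, h (a * b) = h (b * ρ a)) (f : QCl σ g →ₗ[ℂ] ℂ) (r u v : QCl σ g) :
    h (algForm hσ hg hβ f (r * u) v) = h (algForm hσ hg hβ f u (β r * v)) := by
  rw [haar_algForm hStar hβ hh hρ, haar_algForm hStar hβ hh hρ, hβ.map_mul, hβ.involutive, mul_assoc]

/-- The form is non-degenerate on the spinor module. -/
theorem eq_zero_of_haar_algForm_eq_zero (hStar : IsHopfStar A) (hβ : IsMainInvolution C hC σ g ρ β)
    {h : A →ₗ[ℂ] ℂ} (hh : IsHaar h) (hρ : ∀ a b, h (a * b) = h (b * ρ a)) {f : QCl σ g →ₗ[ℂ] ℂ}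
    {S : Ideal (QCl σ g)} (hS : IsMinimalSpinorModule hσ hg S) {v w : QCl σ g} (hv : v ∈ S)
    (hv' : v ∈ formAlg C σ g) (hw : w ∈ S) (hw' : w ∈ formAlg C σ g) (hf : f (β w * v) ≠ 0)
    {ψ : QCl σ g} (hψ : ψ ∈ S) (h0 : ∀ ψ' ∈ S, h (algForm hσ hg hβ f ψ ψ') = 0) : ψ = 0 := by
  have hb : ∀ {x y : QCl σ g} (b : A), x ∈ formAlg C σ g → y ∈ formAlg C σ g →
      algForm hσ hg hβ f x (inl σ g b * y) = f (β y * x) • star b := fun {x y} b hx hy => by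
    simpa using algForm_inl_mul (hσ := hσ) (hg := hg) hβ f 1 b hx hy
  have h1 : ∀ y ∈ S, algForm hσ hg hβ f ψ y = 0 := by
    intro y hy
    refine hh.eq_zero hStar _ fun b => ?_
    have := algForm_mul_mul (hσ := hσ) (hg := hg) hβ f 1 (star b) ψ y
    rw [map_one, one_mul, one_mul, star_star] at this
    rw [← this]
    exact h0 _ (S.mul_mem_left _ hy)
  let N : Ideal (QCl σ g) :=
    { carrier := {u | ∀ ψ' ∈ S, h (algForm hσ hg hβ f u ψ') = 0}
      add_mem' := fun {u u'} hu hu' ψ' hψ' => by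
        rw [map_add, LinearMap.add_apply, map_add, hu ψ' hψ', hu' ψ' hψ', add_zero]
      zero_mem' := fun ψ' _ => by simp
      smul_mem' := fun r u hu ψ' hψ' => by
        rw [smul_eq_mul, haar_algForm_mul hStar hβ hh hρ]
        exact hu _ (S.mul_mem_left _ hψ') }
  have h2 : ∀ x ∈ S, x ∈ formAlg C σ g → x ∈ N → x = 0 := by
    intro x hx hx' hxN
    have hle : Ideal.span {x} ≤ S := (Ideal.span_singleton_le_iff_mem S).2 hx
    rcases hS.minimal _ (isLeftCovariant_span_singleton hx') hle with hJ | hJ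
    · exact Ideal.span_singleton_eq_bot.1 hJ
    · have hvN : v ∈ N := by
        rw [← hJ] at hv
        exact (Ideal.span_singleton_le_iff_mem N).2 hxN hv
      have h3 := hvN w hw
      have h4 := hb 1 hv' hw'
      rw [map_one, one_mul, star_one] at h4
      rw [h4, map_smul, hh.map_one, smul_eq_mul, mul_one] at h3
      exact absurd h3 hf
  have h3 : ∀ φ : Module.Dual ℂ A,
      TensorProduct.lid ℂ (QCl σ g) (φ.rTensor _ (splitting hσ hg ψ)) = 0 := by
    intro φ
    have hmem : ∀ z ∈ tensorIdeal S, TensorProduct.lid ℂ (QCl σ g)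
        (φ.rTensor _ ((invProj hσ hg).lTensor A z)) ∈ S ∧
        TensorProduct.lid ℂ (QCl σ g)
        (φ.rTensor _ ((invProj hσ hg).lTensor A z)) ∈ formAlg C σ g := by
      intro z hz
      refine tensorIdeal_induction (p := fun z => TensorProduct.lid ℂ (QCl σ g)
        (φ.rTensor _ ((invProj hσ hg).lTensor A z)) ∈ S ∧
        TensorProduct.lid ℂ (QCl σ g)
        (φ.rTensor _ ((invProj hσ hg).lTensor A z)) ∈ formAlg C σ g)
        (fun x y hx hy => ?_) (fun a u hu => ?_) hz
      · simp only [map_add]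
        exact ⟨add_mem hx.1 hy.1, add_mem hx.2 hy.2⟩
      · simp only [LinearMap.lTensor_tmul, LinearMap.rTensor_tmul, TensorProduct.lid_tmul]
        exact ⟨(S.restrictScalars ℂ).smul_mem _ (invProj_mem_of_mem hS.covariant hu),
          Subalgebra.smul_mem _ (invProj_mem hσ hg u) _⟩
    obtain ⟨hx, hx'⟩ := hmem _ (hS.covariant ψ hψ)
    rw [← splitting_apply] at hx hx'
    refine h2 _ hx hx' fun y hy => ?_
    have h4 : ∀ (y : QCl σ g) (z : A ⊗[ℂ] QCl σ g), f (β y * TensorProduct.lid ℂ (QCl σ g)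
        (φ.rTensor _ z)) = φ (TensorProduct.rid ℂ A (sesqTensor (mulStarForm A)
          (involutionForm hβ f) z (1 ⊗ₜ y))) := by
      intro y z
      induction z with
      | zero => simp
      | add z z' hz hz' => simp only [map_add, mul_add, LinearMap.add_apply, hz, hz']
      | tmul a u => simp [sesqTensor_tmul, involutionForm, mulStarForm, mul_comm]
    refine mem_induction (p := fun y => h (algForm hσ hg hβ f (TensorProduct.lid ℂ (QCl σ g)
        (φ.rTensor _ (splitting hσ hg ψ))) y) = 0) hS.covariant
      (fun x y hx hy => ?_) (fun b y hyS hy => ?_) hy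
    · rw [map_add, map_add, hx, hy, add_zero]
    · have h5 := h1 y hyS
      rw [algForm_apply, splitting_of_mem hσ hg hy] at h5
      rw [hb b hx' hy, h4, h5, map_zero, zero_smul, map_zero]
  have h6 : splitting hσ hg ψ = 0 := by
    rw [← (TensorProduct.comm ℂ A (QCl σ g)).map_eq_zero_iff]
    refine dual_sep _ fun φ => ?_
    rw [← (TensorProduct.comm ℂ (QCl σ g) ℂ).map_eq_zero_iff,
      ← (TensorProduct.lid ℂ (QCl σ g)).map_eq_zero_iff, ← h3 φ]
    induction splitting hσ hg ψ with
    | zero => simp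
    | add z z' hz hz' => simp only [map_add, hz, hz']
    | tmul a u => simp
  rw [← mulMap_splitting hσ hg ψ, h6, map_zero]

theorem exists_isSpinorMetric (hStar : IsHopfStar A) (hsimple : IsSimpleLeftCovariant hσ hg)
    {S : Ideal (QCl σ g)} (hS : IsMinimalSpinorModule hσ hg S) {h : A →ₗ[ℂ] ℂ} (hh : IsHaar h)
    (hρ : ∀ a b, h (a * b) = h (b * ρ a)) (hβ : IsMainInvolution C hC σ g ρ β) :
    ∃ m : S →ₗ[ℂ] S →ₗ⋆[ℂ] ℂ, IsSpinorMetric hσ hg h S m ∧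
      ∀ (u : QCl σ g) (ψ ψ' : S), m (u • ψ) ψ' = m ψ (β u • ψ') := by
  obtain ⟨v, hv, hv', w, hw, hw', hne⟩ := exists_involution_mul_ne_zero hβ hsimple hS
  obtain ⟨f, hf, hf0⟩ := hβ.exists_hermitian hne
  let m₀ : S →ₗ[ℂ] S →ₗ⋆[ℂ] A := LinearMap.mk₂'ₛₗ (RingHom.id ℂ) (starRingEnd ℂ)
    (fun x y => algForm hσ hg hβ f x y) (by intros; simp) (by intros; simp) (by intros; simp)
    (by intros; simp)
  let m : S →ₗ[ℂ] S →ₗ⋆[ℂ] ℂ := LinearMap.mk₂'ₛₗ (RingHom.id ℂ) (starRingEnd ℂ)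
    (fun x y => h (algForm hσ hg hβ f x y)) (by intros; simp) (by intros; simp) (by intros; simp)
    (by intros; simp)
  have hm : ∀ x y, m x y = h (algForm hσ hg hβ f x y) := fun _ _ => rfl
  have hherm : ∀ x y, m y x = star (m x y) := fun x y => by
    rw [hm, hm, ← hh.map_star hStar, star_algForm hβ hf]
  have hleft : ∀ ψ, (∀ ψ', m ψ ψ' = 0) → ψ = 0 := fun ψ h0 =>
    Subtype.ext <| eq_zero_of_haar_algForm_eq_zero hStar hβ hh hρ hS hv hv' hw hw' hf0 ψ.2
      fun ψ' hψ' => h0 ⟨ψ', hψ'⟩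
  refine ⟨m, ⟨⟨m₀, fun a b ψ ψ' => algForm_mul_mul hβ f a b ψ ψ', ?_, fun _ _ => rfl⟩, hherm, hleft,
    fun ψ' h0 => hleft ψ' fun ψ => by rw [hherm ψ, h0, star_zero]⟩, fun u ψ ψ' =>
      haar_algForm_mul hStar hβ hh hρ f u ψ ψ'⟩
  intro ψ ψ' n k a φ b φ' h1 h2
  change comul (R := ℂ) (algForm hσ hg hβ f ψ ψ') = _
  rw [comul_algForm hStar, h1, h2]
  simp only [map_sum, LinearMap.sum_apply, sesqTensor_tmul]
  rw [Finset.sum_comm]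
  rfl

end QCl

end QuantumClifford

end

theorem mainTheorem10 {A : Type u} [Ring A] [HopfAlgebra ℂ A] [StarRing A] [StarModule ℂ A]
    {Γ : Type v} [AddCommGroup Γ] [Module ℂ Γ] [Module A Γ] [Module Aᵐᵒᵖ Γ]
    [SMulCommClass A Aᵐᵒᵖ Γ] [IsScalarTower ℂ A Γ] [IsScalarTower ℂ Aᵐᵒᵖ Γ]
    [StarAddMonoid Γ] [StarModule ℂ Γ]
    (hStar : QuantumClifford.IsHopfStar A) (hA : QuantumClifford.IsCosemisimple A)
    (C : QuantumClifford.StarCalculus A Γ) (hC : C.IsS2Invariant)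
    (σ : QuantumClifford.BimodTensor.deg A Γ 2 ≃ₗ[ℂ] QuantumClifford.BimodTensor.deg A Γ 2)
    (hσ : C.IsBraiding hC σ)
    (g : QuantumClifford.BimodTensor.deg A Γ 2 →ₗ[ℂ] A) (hg : C.IsSigmaMetric hC σ g)
    (hsimple : QuantumClifford.QCl.IsSimpleLeftCovariant hσ hg)
    (S : Ideal (QuantumClifford.QCl σ g))
    (hS : QuantumClifford.QCl.IsMinimalSpinorModule hσ hg S) :
    (∃ (h : A →ₗ[ℂ] ℂ) (ρ : A ≃ₐ[ℂ] A) (β : QuantumClifford.QCl σ g → QuantumClifford.QCl σ g),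
      QuantumClifford.IsHaar h ∧ (∀ a b, h (a * b) = h (b * ρ a)) ∧
      QuantumClifford.QCl.IsMainInvolution C hC σ g ρ β) ∧
    ∀ (h : A →ₗ[ℂ] ℂ) (ρ : A ≃ₐ[ℂ] A) (β : QuantumClifford.QCl σ g → QuantumClifford.QCl σ g),
      QuantumClifford.IsHaar h → (∀ a b, h (a * b) = h (b * ρ a)) →
      QuantumClifford.QCl.IsMainInvolution C hC σ g ρ β →
      ∃ m : S →ₗ[ℂ] S →ₗ⋆[ℂ] ℂ, QuantumClifford.QCl.IsSpinorMetric hσ hg h S m ∧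
        ∀ (u : QuantumClifford.QCl σ g) (ψ ψ' : S), m (u • ψ) ψ' = m ψ (β u • ψ') := by
  refine ⟨?_, fun h ρ β hh hρ hβ =>
    QuantumClifford.QCl.exists_isSpinorMetric hStar hsimple hS hh hρ hβ⟩
  obtain ⟨h, hh⟩ := QuantumClifford.exists_isHaar hStar hA
  obtain ⟨β, hβ⟩ := QuantumClifford.QCl.exists_isMainInvolution hσ hg hStar hh
  exact ⟨h, hh.modularEquiv hStar, β, hh, fun a b => hh.modular_spec hStar a b, hβ⟩
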